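/- **Conventions.** For a finite set $S$, a *sign function* on $S$ is a map $\chi$ from the ordered triples of distinct elements of $S$ to $\{-1,+1\}$ with $\chi(x,y,z)=\chi(y,z,x)=\chi(z,x,y)=-\chi(z,y,x)=-\chi(y,x,z)=-\chi(x,z,y)$. It is a *chirotope* if for all distinct elements (i) $\chi(t,y,z)=\chi(x,t,z)=\chi(x,y,t)=1$ implies $\chi(x,y,z)=1$, and (ii) $\chi(t,s,x)=\chi(t,s,y)=\chi(t,s,z)=\chi(x,y,t)=\chi(y,z,t)=1$ implies $\chi(x,z,t)=1$. A *rooted chirotope* $(\chi,u)$ is a chirotope $\chi$ on $X\cup\{u\}$ ($u\notin X$, $X$ finite) whose root $u$ is extreme, i.e. there is $y\in X$ such that $\chi(u,y,z)$ is the same for all $z\in X\setminus\{y\}$. If $|X|\ge 2$, we write $u^+$ and $u^-$ for the unique elements of $X$ with $\chi(u,u^+,z)=1$ for all $z\in X\setminus\{u^+\}$ and $\chi(u^-,u,z)=1$ for all $z\in X\setminus\{u^-\}$. *Join.* $(\chi_1,u_1)\vee(\chi_2,u_2)=(\chi_3,u_3)$, where $\chi_3$ is the sign function on $X_3\cup\{u_3\}$,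 $X_3$ is the disjoint union of $X_1$ and $X_2$ with $u_1^-$ and $u_2^+$ identified, and (for distinct arguments) $\chi_3(x,y,z)$ equals $\chi_1(x,y,z)$ if $x,y,z\in X_1$; $\chi_2(x,y,z)$ if $x,y,z\in X_2$; $\chi_1(x,y,u_1)$ if $x,y\in X_1$, $z\in X_2\setminus\{u_2^+\}$; $\chi_2(u_2,y,z)$ if $x\in X_1\setminus\{u_1^-\}$, $y,z\in X_2$; and $\chi_3(x,y,u_3)$ equals $\chi_1(x,y,u_1)$ if $x,y\in X_1$; $\chi_2(x,y,u_2)$ if $x,y\in X_2$; $1$ if $x\in X_1\setminus\{u_1^-\}$, $y\in X_2\setminus\{u_2^+\}$. *Twist and meet.* The twist $\neg(\chi,u)=(\widetilde\chi,v)$ on $X\cup\{v\}$ is given by $\widetilde\chi=\chi$ on triples of $X$ and $\widetilde\chi(x,y,v)=-\chi(x,y,u)$ (extended by symmetry). The meet is $(\chi_1,u_1)\wedge(\chi_2,u_2)=\neg\big(\neg(\chi_1,u_1)\vee\neg(\chi_2,u_2)\big)$. *Weak triangulations.* For a sign function $\chi$ on $X\cup\{u\}$, add an element $v$ and put $\chi(x,y,v)=-\chi(x,y,u)$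 for $x,y\in X$. Two segments $xy$, $zt$ with four distinct endpoints in $X\cup\{u,v\}$, not including both $u$ and $v$, cross if $\chi(x,y,z)=-\chi(x,y,t)$ and $\chi(z,t,x)=-\chi(z,t,y)$; other pairs of segments do not cross. A weak triangulation of $(\chi,u)$ is an inclusion-maximal set of pairwise non-crossing segments with endpoints in $X\cup\{u,v\}$ that does not contain the segment $uv$. With $\mathfrak W(\chi,u)$ the set of weak triangulations, let $$P_{(\chi,u)}(u,v)=\sum_{\Delta\in\mathfrak W(\chi,u)}u^{\deg_\Delta(u)}v^{\deg_\Delta(v)}\in\mathbb Z[u,v].$$ **Proposition.** Let $(\chi_1,u_1)$ and $(\chi_2,u_2)$ be two rooted chirotopes on at least three elements each (roots included). Then $$P_{(\chi_1,u_1)\vee(\chi_2,u_2)}(u,v)=\sum_{d_1\ge2}\sum_{d_2\ge2}[u^{d_1}]P_{(\chi_1,u_1)}(u,v)\cdot[u^{d_2}]P_{(\chi_2,u_2)}(u,v)\cdot N_{d_1,d_2}(u)\,v^{-1},$$ where $$N_{d_1,d_2}(u)=u^{d_1+d_2-1}+\sum_{i_1=1}^{d_1-1}\sum_{i_2=1}^{d_2-1}\binom{d_1-i_1+d_2-i_2-2}{d_1-i_1-1}u^{i_1+i_2}.$$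 Moreover, the same formula with the roles of $u$ and $v$ exchanged holds for meets: $$P_{(\chi_1,u_1)\wedge(\chi_2,u_2)}(u,v)=\sum_{d_1\ge2}\sum_{d_2\ge2}[v^{d_1}]P_{(\chi_1,u_1)}(u,v)\cdot[v^{d_2}]P_{(\chi_2,u_2)}(u,v)\cdot N_{d_1,d_2}(v)\,u^{-1}.$$ -/

import Mathlib

open Polynomial

universe u v

/-! ### Chirotopes

A sign map on `α` is a total function `α → α → α → ℤˣ`.  Only its values on triples of pairwise
distinct elements carry information; nothing below ever looks at the other values. -/

/-- The symmetry axiom: `χ` is a sign function. -/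
def IsSignFunction {α : Type u} (χ : α → α → α → ℤˣ) : Prop :=
  ∀ x y z : α, x ≠ y → x ≠ z → y ≠ z →
    χ x y z = χ y z x ∧ χ x y z = χ z x y ∧
    χ x y z = -χ z y x ∧ χ x y z = -χ y x z ∧ χ x y z = -χ x z y

/-- (Simple, abstract) chirotopes: symmetry, interiority, transitivity. -/
structure IsChirotope {α : Type u} (χ : α → α → α → ℤˣ) : Prop where
  symmetry : IsSignFunction χ
  interiority : ∀ t x y z : α, t ≠ x → t ≠ y → t ≠ z → x ≠ y → x ≠ z → y ≠ z →
    χ t y z = 1 → χ x t z = 1 → χ x y t = 1 → χ x y z = 1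
  transitivity : ∀ s t x y z : α, s ≠ t → s ≠ x → s ≠ y → s ≠ z → t ≠ x → t ≠ y → t ≠ z →
    x ≠ y → x ≠ z → y ≠ z →
    χ t s x = 1 → χ t s y = 1 → χ t s z = 1 → χ x y t = 1 → χ y z t = 1 → χ x z t = 1

/-- `x` is an extreme element: for some `y ≠ x`, the sign `χ x y z` does not depend on `z`. -/
def IsExtremeElement {α : Type u} (χ : α → α → α → ℤˣ) (x : α) : Prop :=
  ∃ y : α, y ≠ x ∧ ∃ ε : ℤˣ, ∀ z : α, z ≠ x → z ≠ y → χ x y z = ε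

/-- Sign maps on the ground set `X ∪ {u}`, the root `u` being `none : Option X`. -/
abbrev RootedSignMap (X : Type u) : Type u := Option X → Option X → Option X → ℤˣ

/-- `(χ, u)` is a rooted chirotope: `χ` is a chirotope on `X ∪ {u}` and `u` is extreme. -/
def IsRootedChirotope {X : Type u} (χ : RootedSignMap X) : Prop :=
  IsChirotope χ ∧ IsExtremeElement χ none

/-- `y` is the counterclockwise successor of the root on the convex hull: all the other elements
lie to the left of the directed line `u y`. -/
def IsHullSucc {X : Type u} (χ : RootedSignMap X) (y : X) : Prop :=
  ∀ z : X, z ≠ y → χ none (some y) (some z) = 1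

/-- `y` is the counterclockwise predecessor of the root on the convex hull: all the other elements
lie to the left of the directed line `y u`. -/
def IsHullPred {X : Type u} (χ : RootedSignMap X) (y : X) : Prop :=
  ∀ z : X, z ≠ y → χ (some y) none (some z) = 1

/-- `u⁺`.  For rooted chirotopes it is characterized by `hullSucc_spec` and `IsHullSucc.unique`. -/
noncomputable def hullSucc {X : Type u} [Nonempty X] (χ : RootedSignMap X) : X :=
  Classical.epsilon (IsHullSucc χ)

/-- `u⁻`.  For rooted chirotopes it is characterized by `hullPred_spec` and `IsHullPred.unique`. -/
noncomputable def hullPred {X : Type u} [Nonempty X] (χ : RootedSignMap X) : X :=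
  Classical.epsilon (IsHullPred χ)

theorem IsSignFunction.rot {α : Type u} {χ : α → α → α → ℤˣ} (h : IsSignFunction χ) {x y z : α}
    (hxy : x ≠ y) (hxz : x ≠ z) (hyz : y ≠ z) : χ x y z = χ y z x :=
  (h x y z hxy hxz hyz).1

theorem IsSignFunction.swap {α : Type u} {χ : α → α → α → ℤˣ} (h : IsSignFunction χ) {x y z : α}
    (hxy : x ≠ y) (hxz : x ≠ z) (hyz : y ≠ z) : χ x z y = -χ x y z := by
  rw [(h x y z hxy hxz hyz).2.2.2.2, neg_neg]

theorem int_units_neg_ne (a : ℤˣ) : -a ≠ a := by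
  rcases Int.units_eq_one_or a with rfl | rfl <;> decide

theorem IsHullSucc.unique {X : Type u} {χ : RootedSignMap X} (hχ : IsSignFunction χ) {y y' : X}
    (h : IsHullSucc χ y) (h' : IsHullSucc χ y') : y = y' := by
  by_contra hne
  have h1 := h y' (Ne.symm hne)
  have h2 := h' y hne
  rw [hχ.swap (by simp) (by simp) (by simpa using hne), h1] at h2
  exact int_units_neg_ne 1 h2

theorem IsHullPred.unique {X : Type u} {χ : RootedSignMap X} (hχ : IsSignFunction χ) {y y' : X}
    (h : IsHullPred χ y) (h' : IsHullPred χ y') : y = y' := by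
  by_contra hne
  have h1 := h y' (Ne.symm hne)
  have h2 := h' y hne
  rw [hχ.rot (by simp) (by simpa [eq_comm] using hne) (by simp)] at h1
  rw [hχ.rot (by simp) (by simpa [eq_comm] using hne) (by simp)] at h2
  rw [hχ.swap (by simp) (by simp) (by simpa [eq_comm] using hne), h2] at h1
  exact int_units_neg_ne 1 h1

/-- The mirror image of the transitivity axiom. -/
theorem IsChirotope.transitivity' {α : Type u} {χ : α → α → α → ℤˣ} (h : IsChirotope χ)
    {s t p q r : α} (hst : s ≠ t) (hsp : s ≠ p) (hsq : s ≠ q) (hsr : s ≠ r) (htp : t ≠ p)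
    (htq : t ≠ q) (htr : t ≠ r) (hpq : p ≠ q) (hpr : p ≠ r) (hqr : q ≠ r)
    (h1 : χ s t p = 1) (h2 : χ s t q = 1) (h3 : χ s t r = 1) (h4 : χ t p q = 1)
    (h5 : χ t q r = 1) : χ t p r = 1 := by
  by_contra hc
  have hS := h.symmetry
  have key : ∀ {x y z : α}, x ≠ y → x ≠ z → y ≠ z → χ x y z ≠ 1 → χ y x z = 1 := by
    intro x y z hxy hxz hyz hn
    have h1 := (hS x y z hxy hxz hyz).2.2.2.1
    rcases Int.units_eq_one_or (χ y x z) with h2 | h2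
    · exact h2
    · rw [h2, neg_neg] at h1
      exact absurd h1 hn
  have key' : ∀ {x y z : α}, x ≠ y → x ≠ z → y ≠ z → χ x y z = 1 → χ y x z = 1 → False := by
    intro x y z hxy hxz hyz h1 h2
    rw [(hS x y z hxy hxz hyz).2.2.2.1, h2] at h1
    exact int_units_neg_ne 1 h1
  have rot : ∀ {x y z : α}, x ≠ y → x ≠ z → y ≠ z → χ x y z = 1 → χ y z x = 1 := by
    intro x y z hxy hxz hyz h1
    rw [← hS.rot hxy hxz hyz, h1]
  have e0 : χ p t r = 1 := key htp htr hpr hc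
  have e1 : χ t r p = 1 := rot htp.symm hpr htr e0
  have e2 : χ r p t = 1 := rot htr htp hpr.symm e1
  have f4 : χ p q t = 1 := rot htp htq hpq h4
  have f5 : χ q r t = 1 := rot htq htr hqr h5
  have c1 : χ p q r = 1 := h.interiority t p q r htp htq htr hpq hpr hqr h5 e0 f4
  have c2 : χ q r p = 1 := rot hpq hpr hqr c1
  have c3 : χ r p q = 1 := rot hqr hpq.symm hpr.symm c2
  have s1 : χ p q s = 1 → χ r p s = 1 := fun ha =>
    rot hsr hsp hpr.symm (h.transitivity q p s t r hpq.symm hsq.symm htq.symm hqr hsp.symm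
      htp.symm hpr hst hsr htr ha f4 c1 (h1) e1)
  have s2 : χ q r s = 1 → χ p q s = 1 := fun ha =>
    rot hsp hsq hpq (h.transitivity r q s t p hqr.symm hsr.symm htr.symm hpr.symm hsq.symm
      htq.symm hpq.symm hst hsp htp ha f5 c2 h2 h4)
  have s3 : χ r p s = 1 → χ q r s = 1 := fun ha =>
    rot hsq hsr hqr (h.transitivity p r s t q hpr hsp.symm htp.symm hpq hsr.symm
      htr.symm hqr.symm hst hsq htq ha e2 c3 h3 h5)
  by_cases ha : χ p q s = 1
  · have hb := s1 ha
    have hd := s3 hb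
    exact key' hpr hsp.symm hsr.symm (h.transitivity t s p q r hst.symm htp htq htr hsp hsq hsr
      hpq hpr hqr h1 h2 h3 ha hd) hb
  · have hd : χ q r s ≠ 1 := fun h6 => ha (s2 h6)
    have hb : χ r p s ≠ 1 := fun h6 => hd (s3 h6)
    exact hb (h.transitivity t s r q p hst.symm htr htq htp hsr hsq hsp
      hqr.symm hpr.symm hpq.symm h3 h2 h1 (key hqr hsq.symm hsr.symm hd)
      (key hpq hsp.symm hsq.symm ha))

/-- The elements other than an extreme root are linearly ordered around it. -/
theorem IsRootedChirotope.trans {X : Type u} {χ : RootedSignMap X} (h : IsRootedChirotope χ)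
    {a b c : X} (hab : a ≠ b) (hac : a ≠ c) (hbc : b ≠ c)
    (h1 : χ none (some a) (some b) = 1) (h2 : χ none (some b) (some c) = 1) :
    χ none (some a) (some c) = 1 := by
  obtain ⟨hc, y, hy, ε, hε⟩ := h
  have hS := hc.symmetry
  obtain ⟨y, rfl⟩ := Option.ne_none_iff_exists'.mp hy
  have hab' : some a ≠ some b := by simpa using hab
  have hac' : some a ≠ some c := by simpa using hac
  have hbc' : some b ≠ some c := by simpa using hbc
  have hε' : ∀ z : X, z ≠ y → χ none (some y) (some z) = ε := fun z hz =>
    hε _ (by simp) (by simpa using hz)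
  have na : ∀ z : X, (none : Option X) ≠ some z := fun z => by simp
  have hsw : ∀ z : X, z ≠ y → χ none (some z) (some y) = -ε := fun z hz => by
    rw [hS.swap (na _) (na _) (by simpa using hz.symm), hε' z hz]
  have rot : ∀ {x y z : Option X}, x ≠ y → x ≠ z → y ≠ z → χ x y z = 1 → χ y z x = 1 := by
    intro x y z hxy hxz hyz h1
    rw [← hS.rot hxy hxz hyz, h1]
  rcases Int.units_eq_one_or ε with rfl | rfl
  · rcases eq_or_ne a y with rfl | hay
    · exact hε' c hac.symm
    rcases eq_or_ne b y with rfl | hby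
    · exact absurd ((hsw a hay).symm.trans h1) (int_units_neg_ne 1)
    rcases eq_or_ne c y with rfl | hcy
    · exact absurd ((hsw b hby).symm.trans h2) (int_units_neg_ne 1)
    have := hc.transitivity (some y) none (some a) (some b) (some c) (by simp)
      (by simpa using hay.symm) (by simpa using hby.symm) (by simpa using hcy.symm)
      (na _) (na _) (na _) hab' hac' hbc' (hε' a hay) (hε' b hby) (hε' c hcy)
      (rot (na _) (na _) hab' h1) (rot (na _) (na _) hbc' h2)
    rw [← hS.rot (na _) (na _) hac'] at this
    exact this
  · rcases eq_or_ne a y with rfl | hay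
    · exact absurd ((hε' b hab.symm).symm.trans h1) (int_units_neg_ne 1)
    rcases eq_or_ne b y with rfl | hby
    · exact absurd ((hε' c hbc.symm).symm.trans h2) (int_units_neg_ne 1)
    rcases eq_or_ne c y with rfl | hcy
    · rw [hsw a hay, neg_neg]
    have hr : ∀ z : X, z ≠ y → χ (some y) none (some z) = 1 := fun z hz => by
      have h3 := (hS none (some y) (some z) (na _) (na _) (by simpa using hz.symm)).2.2.2.1
      rw [hε' z hz, neg_inj] at h3
      exact h3.symm
    exact hc.transitivity' (by simp) (by simpa using hay.symm) (by simpa using hby.symm)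
      (by simpa using hcy.symm) (na _) (na _) (na _) hab' hac' hbc' (hr a hay) (hr b hby)
      (hr c hcy) h1 h2

/-- A linear order on a finite set, given by a relation on distinct elements, has a minimum. -/
theorem exists_min_of_rel {X : Type u} [Finite X] [Nonempty X] (r : X → X → Prop)
    (htot : ∀ a b : X, a ≠ b → r a b ∨ r b a)
    (htr : ∀ a b c : X, a ≠ b → a ≠ c → b ≠ c → r a b → r b c → r a c) :
    ∃ m : X, ∀ z : X, z ≠ m → r m z := by
  classical
  have := Fintype.ofFinite X
  have main : ∀ s : Finset X, s.Nonempty → ∃ m ∈ s, ∀ z ∈ s, z ≠ m → r m z := by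
    intro s hs
    induction hs using Finset.Nonempty.cons_induction with
    | singleton a => exact ⟨a, by simp, by simp⟩
    | cons a s ha hs ih =>
      obtain ⟨m, hm, hmz⟩ := ih
      have ham : a ≠ m := fun h => ha (h ▸ hm)
      rcases htot a m ham with h | h
      · refine ⟨a, by simp, fun z hz hza => ?_⟩
        rcases Finset.mem_cons.mp hz with rfl | hz
        · exact absurd rfl hza
        rcases eq_or_ne z m with rfl | hzm
        · exact h
        exact htr a m z ham hza.symm hzm.symm h (hmz z hz hzm)
      · refine ⟨m, by simp [hm], fun z hz hzm => ?_⟩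
        rcases Finset.mem_cons.mp hz with rfl | hz
        · exact h
        exact hmz z hz hzm
  obtain ⟨m, -, hm⟩ := main Finset.univ Finset.univ_nonempty
  exact ⟨m, fun z hz => hm z (Finset.mem_univ z) hz⟩

theorem IsSignFunction.total {X : Type u} {χ : RootedSignMap X} (h : IsSignFunction χ) {a b : X}
    (hab : a ≠ b) : χ none (some a) (some b) = 1 ∨ χ none (some b) (some a) = 1 := by
  rcases Int.units_eq_one_or (χ none (some a) (some b)) with h1 | h1
  · exact Or.inl h1
  · right
    rw [h.swap (by simp) (by simp) (by simpa using hab), h1, neg_neg]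

theorem hullSucc_spec {X : Type u} [Finite X] [Nonempty X] {χ : RootedSignMap X}
    (h : IsRootedChirotope χ) : IsHullSucc χ (hullSucc χ) := by
  refine Classical.epsilon_spec (exists_min_of_rel
    (fun a b => χ none (some a) (some b) = 1) (fun a b hab => h.1.symmetry.total hab) ?_)
  intro a b c hab hac hbc h1 h2
  exact h.trans hab hac hbc h1 h2

theorem hullPred_spec {X : Type u} [Finite X] [Nonempty X] {χ : RootedSignMap X}
    (h : IsRootedChirotope χ) : IsHullPred χ (hullPred χ) := by
  obtain ⟨m, hm⟩ := exists_min_of_rel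
    (fun a b => χ none (some b) (some a) = 1) (fun a b hab => h.1.symmetry.total hab.symm) (by
      intro a b c hab hac hbc h1 h2
      exact h.trans hbc.symm hac.symm hab.symm h2 h1)
  refine Classical.epsilon_spec (p := IsHullPred χ) ⟨m, fun z hz => ?_⟩
  rw [h.1.symmetry.rot (by simp) (by simpa using hz.symm) (by simp)]
  exact hm z hz

/-! ### Join, twist and meet -/

/-- The ground set `X₃` of the join without its root: the disjoint union of `X₁` and `X₂` in which
`u₁⁻` and `u₂⁺` are identified.  The identified point `x₀` is represented by `inl u₁⁻`. -/
abbrev JoinSet (X₁ : Type u) {X₂ : Type v} [Nonempty X₂] (χ₂ : RootedSignMap X₂) : Type (max u v) :=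
  X₁ ⊕ {y : X₂ // y ≠ hullSucc χ₂}

/-- Sends the elements of `X₁` to themselves and all other elements of `X₃ ∪ {u₃}` to `u₁`. -/
def joinLeft {X₁ : Type u} {X₂ : Type v} [Nonempty X₂] (χ₂ : RootedSignMap X₂) :
    Option (JoinSet X₁ χ₂) → Option X₁
  | some (Sum.inl x) => some x
  | some (Sum.inr _) => none
  | none => none

open Classical in
/-- Sends the elements of `X₂` (among them `x₀`, which is `u₂⁺` there) to themselves and all other
elements of `X₃ ∪ {u₃}` to `u₂`. -/
noncomputable def joinRight {X₁ : Type u} {X₂ : Type v} [Nonempty X₁] [Nonempty X₂]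
    (χ₁ : RootedSignMap X₁) (χ₂ : RootedSignMap X₂) : Option (JoinSet X₁ χ₂) → Option X₂
  | some (Sum.inl x) => if x = hullPred χ₁ then some (hullSucc χ₂) else none
  | some (Sum.inr y) => some y.1
  | none => none

/-- The position in the counterclockwise triple (element of `X₁ \ {u₁⁻}`, element of
`X₂ \ {u₂⁺}`, root). -/
def joinRank {X₁ : Type u} {X₂ : Type v} [Nonempty X₂] (χ₂ : RootedSignMap X₂) :
    Option (JoinSet X₁ χ₂) → ZMod 3
  | some (Sum.inl _) => 0
  | some (Sum.inr _) => 1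
  | none => 2

open Classical in
/-- The join `(χ₁, u₁) ∨ (χ₂, u₂)`, a sign map on `X₃ ∪ {u₃}`.  A triple with at least two elements
in `X₁` is oriented by `χ₁`, every element outside `X₁` acting as `u₁`; a triple with at least two
elements in `X₂` is oriented by `χ₂`, every element outside `X₂` acting as `u₂`; the remaining
triples are, up to order, `(x, y, u₃)` with `x ∈ X₁ \ {u₁⁻}` and `y ∈ X₂ \ {u₂⁺}`, and these are
counterclockwise.  The defining equations in their usual form are `join_mk` below. -/
noncomputable def join {X₁ : Type u} {X₂ : Type v} [Nonempty X₁] [Nonempty X₂]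
    (χ₁ : RootedSignMap X₁) (χ₂ : RootedSignMap X₂) : RootedSignMap (JoinSet X₁ χ₂) :=
  fun p q r =>
    if [joinLeft χ₂ p, joinLeft χ₂ q, joinLeft χ₂ r].Nodup then
      χ₁ (joinLeft χ₂ p) (joinLeft χ₂ q) (joinLeft χ₂ r)
    else if [joinRight χ₁ χ₂ p, joinRight χ₁ χ₂ q, joinRight χ₁ χ₂ r].Nodup then
      χ₂ (joinRight χ₁ χ₂ p) (joinRight χ₁ χ₂ q) (joinRight χ₁ χ₂ r)
    else if joinRank χ₂ q = joinRank χ₂ p + 1 ∧ joinRank χ₂ r = joinRank χ₂ q + 1 then 1 else -1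

open Classical in
/-- The twist `¬(χ, u)`: the root is replaced by an element `v` (again `none`) such that
`(x, y, v)` and `(x, y, u)` have opposite orientations. -/
noncomputable def twist {X : Type u} (χ : RootedSignMap X) : RootedSignMap X :=
  fun p q r => if none ∈ [p, q, r] then -χ p q r else χ p q r

/-- The meet `(χ₁, u₁) ∧ (χ₂, u₂) = ¬(¬(χ₁, u₁) ∨ ¬(χ₂, u₂))`. -/
noncomputable def meet {X₁ : Type u} {X₂ : Type v} [Nonempty X₁] [Nonempty X₂]
    (χ₁ : RootedSignMap X₁) (χ₂ : RootedSignMap X₂) : RootedSignMap (JoinSet X₁ (twist χ₂)) :=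
  twist (join (twist χ₁) (twist χ₂))

/-- The element of `X₃` coming from an element of `X₂`. -/
noncomputable def joinInr {X₁ : Type u} {X₂ : Type v} [Nonempty X₁] [Nonempty X₂]
    (χ₁ : RootedSignMap X₁) (χ₂ : RootedSignMap X₂) (y : X₂) : JoinSet X₁ χ₂ :=
  open Classical in
  if h : y = hullSucc χ₂ then Sum.inl (hullPred χ₁) else Sum.inr ⟨y, h⟩

theorem nodup_three {β : Type u} {a b c : β} : [a, b, c].Nodup ↔ a ≠ b ∧ a ≠ c ∧ b ≠ c := by
  simp; tauto

theorem nodup_three_swap₁ {β : Type u} {a b c : β} : [a, b, c].Nodup ↔ [b, a, c].Nodup :=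
  (List.Perm.swap _ _ _).nodup_iff

theorem nodup_three_swap₂ {β : Type u} {a b c : β} : [a, b, c].Nodup ↔ [a, c, b].Nodup :=
  ((List.Perm.swap _ _ _).cons _).nodup_iff

/-- The join is a sign function. -/
theorem join_isSignFunction {X₁ : Type u} {X₂ : Type v} [Nonempty X₁] [Nonempty X₂]
    {χ₁ : RootedSignMap X₁} {χ₂ : RootedSignMap X₂} (h₁ : IsSignFunction χ₁)
    (h₂ : IsSignFunction χ₂) : IsSignFunction (join χ₁ χ₂) := by
  have rank3 : ∀ p q r : Option (JoinSet X₁ χ₂), p ≠ q → p ≠ r → q ≠ r →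
      ¬ [joinLeft χ₂ p, joinLeft χ₂ q, joinLeft χ₂ r].Nodup →
      ¬ [joinRight χ₁ χ₂ p, joinRight χ₁ χ₂ q, joinRight χ₁ χ₂ r].Nodup →
      [joinRank χ₂ p, joinRank χ₂ q, joinRank χ₂ r].Nodup := by
    have hd : [(0 : ZMod 3), 1, 2].Nodup ∧ [(0 : ZMod 3), 2, 1].Nodup ∧ [(1 : ZMod 3), 0, 2].Nodup ∧
      [(1 : ZMod 3), 2, 0].Nodup ∧ [(2 : ZMod 3), 0, 1].Nodup ∧ [(2 : ZMod 3), 1, 0].Nodup := by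
      decide
    have hs : ∀ y : {y : X₂ // y ≠ hullSucc χ₂}, hullSucc χ₂ ≠ y.1 ∧ y.1 ≠ hullSucc χ₂ :=
      fun y => ⟨y.2.symm, y.2⟩
    rintro (_ | x | x) (_ | y | y) (_ | z | z) hpq hpr hqr hL hR
    all_goals first
      | exact absurd rfl hpq
      | exact absurd rfl hpr
      | exact absurd rfl hqr
      | (simp only [joinRank]; tauto)
      | (exfalso; revert hL hR; simp_all [joinLeft, joinRight, Subtype.ext_iff]; done)
      | (exfalso; apply hR; have := hs x; have := hs y; simp_all [joinRight, Subtype.ext_iff])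
      | (exfalso; apply hR; have := hs x; have := hs z; simp_all [joinRight, Subtype.ext_iff])
      | (exfalso; apply hR; have := hs y; have := hs z; simp_all [joinRight, Subtype.ext_iff])
  have hrank : ∀ a b c : ZMod 3, [a, b, c].Nodup →
      ((if b = a + 1 ∧ c = b + 1 then (1 : ℤˣ) else -1) =
        -(if a = b + 1 ∧ c = a + 1 then (1 : ℤˣ) else -1)) ∧
      ((if b = a + 1 ∧ c = b + 1 then (1 : ℤˣ) else -1) =
        -(if c = a + 1 ∧ b = c + 1 then (1 : ℤˣ) else -1)) := by decide
  have main : ∀ p q r : Option (JoinSet X₁ χ₂), p ≠ q → p ≠ r → q ≠ r →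
      join χ₁ χ₂ p q r = -join χ₁ χ₂ q p r ∧ join χ₁ χ₂ p q r = -join χ₁ χ₂ p r q := by
    intro p q r hpq hpr hqr
    by_cases hL : [joinLeft χ₂ p, joinLeft χ₂ q, joinLeft χ₂ r].Nodup
    · obtain ⟨a, b, c⟩ := nodup_three.mp hL
      have := h₁ _ _ _ a b c
      unfold join
      rw [if_pos hL, if_pos (nodup_three_swap₁.mp hL), if_pos (nodup_three_swap₂.mp hL)]
      exact this.2.2.2
    by_cases hR : [joinRight χ₁ χ₂ p, joinRight χ₁ χ₂ q, joinRight χ₁ χ₂ r].Nodup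
    · obtain ⟨a, b, c⟩ := nodup_three.mp hR
      have := h₂ _ _ _ a b c
      unfold join
      rw [if_neg hL, if_neg (mt nodup_three_swap₁.mpr hL), if_neg (mt nodup_three_swap₂.mpr hL), if_pos hR,
        if_pos (nodup_three_swap₁.mp hR), if_pos (nodup_three_swap₂.mp hR)]
      exact this.2.2.2
    unfold join
    rw [if_neg hL, if_neg (mt nodup_three_swap₁.mpr hL), if_neg (mt nodup_three_swap₂.mpr hL), if_neg hR,
      if_neg (mt nodup_three_swap₁.mpr hR), if_neg (mt nodup_three_swap₂.mpr hR)]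
    have := hrank _ _ _ (rank3 p q r hpq hpr hqr hL hR)
    convert this
  intro x y z hxy hxz hyz
  have m1 := main x y z hxy hxz hyz
  have m2 := main y x z hxy.symm hyz hxz
  have m3 := main x z y hxz hxy hyz.symm
  have m4 := main z x y hxz.symm hyz.symm hxy
  refine ⟨?_, ?_, ?_, m1.1, m1.2⟩
  · rw [m1.1, m2.2, neg_neg]
  · rw [m1.2, m3.1, neg_neg]
  · rw [m1.2, m3.1, m4.2, neg_neg]

/-- The defining equations of the join. -/
theorem join_mk {X₁ : Type u} {X₂ : Type v} [Finite X₁] [Finite X₂] [Nonempty X₁] [Nonempty X₂]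
    {χ₁ : RootedSignMap X₁} {χ₂ : RootedSignMap X₂} (h₁ : IsRootedChirotope χ₁)
    (h₂ : IsRootedChirotope χ₂) :
    joinInr χ₁ χ₂ (hullSucc χ₂) = Sum.inl (hullPred χ₁) ∧
    (∀ x y z : X₁, x ≠ y → x ≠ z → y ≠ z →
      join χ₁ χ₂ (some (Sum.inl x)) (some (Sum.inl y)) (some (Sum.inl z)) =
        χ₁ (some x) (some y) (some z)) ∧
    (∀ x y z : X₂, x ≠ y → x ≠ z → y ≠ z →
      join χ₁ χ₂ (some (joinInr χ₁ χ₂ x)) (some (joinInr χ₁ χ₂ y)) (some (joinInr χ₁ χ₂ z)) =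
        χ₂ (some x) (some y) (some z)) ∧
    (∀ (x y : X₁) (z : X₂), x ≠ y → z ≠ hullSucc χ₂ →
      join χ₁ χ₂ (some (Sum.inl x)) (some (Sum.inl y)) (some (joinInr χ₁ χ₂ z)) =
        χ₁ (some x) (some y) none) ∧
    (∀ (x : X₁) (y z : X₂), x ≠ hullPred χ₁ → y ≠ z →
      join χ₁ χ₂ (some (Sum.inl x)) (some (joinInr χ₁ χ₂ y)) (some (joinInr χ₁ χ₂ z)) =
        χ₂ none (some y) (some z)) ∧
    (∀ x y : X₁, x ≠ y →
      join χ₁ χ₂ (some (Sum.inl x)) (some (Sum.inl y)) none = χ₁ (some x) (some y) none) ∧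
    (∀ x y : X₂, x ≠ y →
      join χ₁ χ₂ (some (joinInr χ₁ χ₂ x)) (some (joinInr χ₁ χ₂ y)) none =
        χ₂ (some x) (some y) none) ∧
    (∀ (x : X₁) (y : X₂), x ≠ hullPred χ₁ → y ≠ hullSucc χ₂ →
      join χ₁ χ₂ (some (Sum.inl x)) (some (joinInr χ₁ χ₂ y)) none = 1) := by
  have hs := hullSucc_spec h₂
  have hp := hullPred_spec h₁
  have q1 : ∀ x : X₁, x ≠ hullPred χ₁ → χ₁ (some x) (some (hullPred χ₁)) none = 1 := by
    intro x hx
    rw [h₁.1.symmetry.rot (by simpa using hx) (by simp) (by simp)]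
    exact hp x hx
  have q2 : ∀ x : X₁, x ≠ hullPred χ₁ → χ₁ (some x) none (some (hullPred χ₁)) = -1 := by
    intro x hx
    rw [h₁.1.symmetry.swap (by simpa using hx) (by simp) (by simp), q1 x hx]
  have q3 : ∀ y : X₂, y ≠ hullSucc χ₂ → χ₂ none (some y) (some (hullSucc χ₂)) = -1 := by
    intro y hy
    rw [h₂.1.symmetry.swap (by simp) (by simp) (by simpa using hy.symm), hs y hy]
  refine ⟨?_, ?_, ?_, ?_, ?_, ?_, ?_, ?_⟩
  · simp [joinInr]
  · intro x y z hxy hxz hyz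
    simp [join, joinLeft, hxy, hxz, hyz]
  · intro x y z hxy hxz hyz
    by_cases hx : x = hullSucc χ₂ <;> by_cases hy : y = hullSucc χ₂ <;>
      by_cases hz : z = hullSucc χ₂ <;>
      simp_all [join, joinLeft, joinRight, joinInr]
  · intro x y z hxy hz
    simp [join, joinLeft, joinInr, hxy, hz]
  · intro x y z hx hyz
    by_cases hy : y = hullSucc χ₂
    · subst hy
      simp [join, joinLeft, joinInr, hx, hyz.symm, q1 x hx, hs z hyz.symm]
    · by_cases hz : z = hullSucc χ₂
      · subst hz
        simp [join, joinLeft, joinInr, hx, hyz, q2 x hx, q3 y hyz]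
      · simp [join, joinLeft, joinRight, joinInr, hx, hyz, hy, hz]
  · intro x y hxy
    simp [join, joinLeft, hxy]
  · intro x y hxy
    by_cases hx : x = hullSucc χ₂ <;> by_cases hy : y = hullSucc χ₂ <;>
      simp_all [join, joinLeft, joinRight, joinInr]
  · intro x y hx hy
    simp [join, joinLeft, joinRight, joinInr, joinRank, hx, hy]
    try decide

/-! ### Weak triangulations -/

/-- The vertex set `X ∪ {u, v}`. -/
inductive Vertex (X : Type u) : Type u
  | pt : X → Vertex X
  | root : Vertex X
  | anti : Vertex X

/-- Identifies the extra element `v` with `u`. -/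
def Vertex.fold {X : Type u} : Vertex X → Option X
  | .pt x => some x
  | .root => none
  | .anti => none

open Classical in
/-- The extension of `χ` to triples containing `v` (but not `u`), by
`χ(x, y, v) = -χ(x, y, u)`. The values on triples containing both `u` and `v` are never used. -/
noncomputable def extSign {X : Type u} (χ : RootedSignMap X) (p q r : Vertex X) : ℤˣ :=
  if Vertex.anti ∈ [p, q, r] then -χ p.fold q.fold r.fold else χ p.fold q.fold r.fold

/-- Two segments with endpoints in `X ∪ {u, v}` cross: they have four distinct endpoints, not
including both `u` and `v`, each segment separating the endpoints of the other one. -/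
def Crossing {X : Type u} (χ : RootedSignMap X) (e f : Sym2 (Vertex X)) : Prop :=
  ∃ p q r s : Vertex X, e = s(p, q) ∧ f = s(r, s) ∧ [p, q, r, s].Nodup ∧
    ¬ (Vertex.root ∈ [p, q, r, s] ∧ Vertex.anti ∈ [p, q, r, s]) ∧
    extSign χ p q r = -extSign χ p q s ∧ extSign χ r s p = -extSign χ r s q

/-- Non-crossing collections of segments on `X ∪ {u, v}` not containing the segment `uv`. -/
structure IsNonCrossing {X : Type u} (χ : RootedSignMap X) (Δ : Set (Sym2 (Vertex X))) : Prop where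
  not_isDiag : ∀ e ∈ Δ, ¬ e.IsDiag
  root_anti_notMem : s(Vertex.root, Vertex.anti) ∉ Δ
  not_crossing : ∀ e ∈ Δ, ∀ f ∈ Δ, ¬ Crossing χ e f

/-- The set of weak triangulations of `(χ, u)`. -/
def weakTriangulations {X : Type u} (χ : RootedSignMap X) : Set (Set (Sym2 (Vertex X))) :=
  {Δ | Maximal (IsNonCrossing χ) Δ}

/-- The degree of `p` in a set of edges. -/
noncomputable def edgeDegree {X : Type u} (Δ : Set (Sym2 (Vertex X))) (p : Vertex X) : ℕ :=
  {e ∈ Δ | p ∈ e}.ncard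

instance Vertex.instFinite {X : Type u} [Finite X] : Finite (Vertex X) :=
  Finite.of_injective (β := X ⊕ Bool)
    (fun p => match p with
      | .pt x => Sum.inl x
      | .root => Sum.inr true
      | .anti => Sum.inr false)
    (by rintro (x | _ | _) (y | _ | _) h <;> simp_all)

/-- The polynomial `P_{(χ,u)}(u, v) = ∑ u ^ deg u * v ^ deg v`, the sum being over all weak
triangulations, as an element of `ℤ[v][u]`: the outer variable `X` is `u` and the inner variable
`C X` is `v`, so that the coefficient of `u ^ d` is a polynomial in `v`. -/
noncomputable def weakPoly {V : Type u} [Finite V] (χ : RootedSignMap V) : ℤ[X][X] :=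
  ∑ Δ ∈ (Set.toFinite (weakTriangulations χ)).toFinset,
    X ^ edgeDegree Δ Vertex.root * C (X ^ edgeDegree Δ Vertex.anti)

/-- The polynomial `N_{d₁,d₂}`, in one variable over a commutative ring `R`. -/
noncomputable def joinKernel (R : Type u) [CommRing R] (d₁ d₂ : ℕ) : R[X] :=
  X ^ (d₁ + d₂ - 1) + ∑ i₁ ∈ Finset.Icc 1 (d₁ - 1), ∑ i₂ ∈ Finset.Icc 1 (d₂ - 1),
    (((d₁ - i₁) + (d₂ - i₂) - 2).choose (d₁ - i₁ - 1) : R[X]) * X ^ (i₁ + i₂)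

/-- For `P₁, P₂ ∈ ℤ[y][x]`, the expression
`∑_{d₁ ≥ 2} ∑_{d₂ ≥ 2} [x ^ d₁] P₁ * [x ^ d₂] P₂ * N_{d₁,d₂}(x) * y⁻¹`, an element of
`ℤ[y, y⁻¹][x]`. -/
noncomputable def joinFormula (P₁ P₂ : ℤ[X][X]) : (LaurentPolynomial ℤ)[X] :=
  ∑ d₁ ∈ Finset.Icc 2 P₁.natDegree, ∑ d₂ ∈ Finset.Icc 2 P₂.natDegree,
    C (toLaurent (P₁.coeff d₁)) * C (toLaurent (P₂.coeff d₂)) *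
      joinKernel (LaurentPolynomial ℤ) d₁ d₂ * C (LaurentPolynomial.T (-1))

/-!
The argument uses only that each `χᵢ` is a sign function and that the root orders the other
elements linearly (`IsRootOrdered`); the twist has this property too, and it exchanges the two
variables (`weakPoly_twist`), so the formula for meets follows from the one for joins.

A weak triangulation is determined by its segments that avoid the root, its *core*: a root segment
`u x` belongs to it exactly if it crosses nothing in the core.  So `weakPoly` is a sum over cores
(`weakPoly_eq_sum_cores`).

A segment of the join that avoids the root lies on the left side `X₁ ∪ {v}`, or on the right side
`X₂ ∪ {v}`, or is a bridge between `X₁ \ {x₀}` and `X₂ \ {x₀}`.  The two sides never cross each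
other.  A bridge `x y` crosses the same segments on the left side as `u₁ x` does in `χ₁`, and on
the right side the same as `u₂ y` does in `χ₂`.  Two bridges are compatible exactly if they are
nested around `x₀`, and a root segment crosses a bridge exactly if it starts strictly below it.
Hence the cores of the join are obtained by gluing a core of `χ₁`, a core of `χ₂` and a maximal
family of nested bridges between elements that see the roots `u₁` and `u₂` (`IsBridging`,
`sum_cores_join`).  The point needing care is that gluing preserves maximality: an element hidden
from the root by a bridge is itself the endpoint of a bridge (`IsBridging.exists_fst_eq`,
`IsBridging.exists_snd_eq`), which then blocks the segments that its root segment used to block.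

Given `d₁` and `d₂` elements that see the roots, the empty family contributes
`X ^ (d₁ + d₂ - 1)`.  A family with outermost bridge `c` is a maximal chain in the product of two
finite linear orders with top element `c`, that is, a lattice path (`card_maxChains`), and summing
over `c` yields the kernel `N` (`sum_bridgings`).  The segment `v x₀` crosses nothing and is shared
by both sides, whence the factor `v⁻¹`.
-/

set_option linter.unusedSectionVars false

/-! ### Sign functions whose root induces a linear order, and crossings -/

/-- A sign function for which `χ(u, a, b) = 1` is a linear order of the elements other than the root
`u`.  Rooted chirotopes are the main example, and the property is stable under twists. -/
structure IsRootOrdered {X : Type u} (χ : RootedSignMap X) : Prop where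
  sign : IsSignFunction χ
  trans : ∀ {a b c : X}, a ≠ b → a ≠ c → b ≠ c → χ none (some a) (some b) = 1 →
    χ none (some b) (some c) = 1 → χ none (some a) (some c) = 1

theorem IsRootedChirotope.isRootOrdered {X : Type u} {χ : RootedSignMap X}
    (h : IsRootedChirotope χ) : IsRootOrdered χ :=
  ⟨h.1.symmetry, h.trans⟩

theorem units_eq_neg_iff_ne {a b : ℤˣ} : a = -b ↔ a ≠ b := by
  rcases Int.units_eq_one_or a with rfl | rfl <;> rcases Int.units_eq_one_or b with rfl | rfl <;>
    decide

theorem IsSignFunction.twist {X : Type u} {χ : RootedSignMap X} (h : IsSignFunction χ) :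
    IsSignFunction (twist χ) := by
  intro x y z hxy hxz hyz
  obtain ⟨h1, h2, h3, h4, h5⟩ := h x y z hxy hxz hyz
  have e : ∀ p q r : Option X, _root_.twist χ p q r =
    if (none = p ∨ none = q ∨ none = r) then -χ p q r else χ p q r := by
    intro p q r; simp [_root_.twist]
  simp only [e]
  by_cases hn : none = x ∨ none = y ∨ none = z
  · have a1 : none = y ∨ none = z ∨ none = x := by tauto
    have a2 : none = z ∨ none = x ∨ none = y := by tauto
    have a3 : none = z ∨ none = y ∨ none = x := by tauto
    have a4 : none = y ∨ none = x ∨ none = z := by tauto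
    have a5 : none = x ∨ none = z ∨ none = y := by tauto
    simp only [if_pos hn, if_pos a1, if_pos a2, if_pos a3, if_pos a4, if_pos a5, neg_inj]
    exact ⟨h1, h2, h3, h4, h5⟩
  · have a1 : ¬ (none = y ∨ none = z ∨ none = x) := by tauto
    have a2 : ¬ (none = z ∨ none = x ∨ none = y) := by tauto
    have a3 : ¬ (none = z ∨ none = y ∨ none = x) := by tauto
    have a4 : ¬ (none = y ∨ none = x ∨ none = z) := by tauto
    have a5 : ¬ (none = x ∨ none = z ∨ none = y) := by tauto
    simp only [if_neg hn, if_neg a1, if_neg a2, if_neg a3, if_neg a4, if_neg a5]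
    exact ⟨h1, h2, h3, h4, h5⟩

theorem twist_none {X : Type u} (χ : RootedSignMap X) (p q : Option X) :
    twist χ none p q = -χ none p q := by
  simp [twist]

theorem IsSignFunction.none_swap {X : Type u} {χ : RootedSignMap X} (h : IsSignFunction χ)
    {a b : X} (hab : a ≠ b) : χ none (some a) (some b) = - χ none (some b) (some a) :=
  h.swap (by simp) (by simp) (by simpa using hab.symm)

theorem IsRootOrdered.twist {X : Type u} {χ : RootedSignMap X} (h : IsRootOrdered χ) :
    IsRootOrdered (twist χ) := by
  refine ⟨h.sign.twist, fun {a b c} hab hac hbc h1 h2 => ?_⟩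
  rw [twist_none, h.sign.none_swap (by assumption), neg_neg] at *
  exact h.trans hbc.symm hac.symm hab.symm h2 h1

theorem IsRootOrdered.isHullSucc {X : Type u} [Finite X] [Nonempty X] {χ : RootedSignMap X}
    (h : IsRootOrdered χ) : IsHullSucc χ (hullSucc χ) :=
  Classical.epsilon_spec (p := IsHullSucc χ) (exists_min_of_rel
    (fun a b => χ none (some a) (some b) = 1) (fun _ _ hab => h.sign.total hab)
    (fun _ _ _ hab hac hbc h1 h2 => h.trans hab hac hbc h1 h2))

theorem IsRootOrdered.isHullPred {X : Type u} [Finite X] [Nonempty X] {χ : RootedSignMap X}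
    (h : IsRootOrdered χ) : IsHullPred χ (hullPred χ) := by
  obtain ⟨m, hm⟩ := exists_min_of_rel
    (fun a b => χ none (some b) (some a) = 1) (fun a b hab => h.sign.total hab.symm)
    (fun a b c hab hac hbc h1 h2 => h.trans hbc.symm hac.symm hab.symm h2 h1)
  refine Classical.epsilon_spec (p := IsHullPred χ) ⟨m, fun z hz => ?_⟩
  rw [h.sign.rot (by simp) (by simpa using hz.symm) (by simp)]
  exact hm z hz

theorem IsRootOrdered.none_hullSucc {X : Type u} [Finite X] [Nonempty X] {χ : RootedSignMap X}
    (h : IsRootOrdered χ) {z : X} (hz : z ≠ hullSucc χ) :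
    χ none (some (hullSucc χ)) (some z) = 1 := h.isHullSucc z hz

theorem IsRootOrdered.none_hullPred {X : Type u} [Finite X] [Nonempty X] {χ : RootedSignMap X}
    (h : IsRootOrdered χ) {z : X} (hz : z ≠ hullPred χ) :
    χ none (some z) (some (hullPred χ)) = 1 := by
  have := h.isHullPred z hz
  rwa [h.sign.rot (by simp) (by simpa using hz.symm) (by simp)] at this

section crossing

variable {X : Type u} {χ : RootedSignMap X}

theorem extSign_swap₁₂ (h : IsSignFunction χ) {p q r : Vertex X}
    (hd : p.fold ≠ q.fold ∧ p.fold ≠ r.fold ∧ q.fold ≠ r.fold) :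
    extSign χ q p r = -extSign χ p q r := by
  have e := (h _ _ _ hd.1 hd.2.1 hd.2.2).2.2.2.1
  have hm : Vertex.anti ∈ [q, p, r] ↔ Vertex.anti ∈ [p, q, r] := by simp; tauto
  unfold extSign
  by_cases ha : Vertex.anti ∈ [p, q, r]
  · rw [if_pos ha, if_pos (hm.2 ha), e]; simp
  · rw [if_neg ha, if_neg (mt hm.1 ha), e]; simp

theorem nodup_fold_iff {p q r s : Vertex X} :
    ([p, q, r, s].map Vertex.fold).Nodup ↔
      [p, q, r, s].Nodup ∧ ¬ (Vertex.root ∈ [p, q, r, s] ∧ Vertex.anti ∈ [p, q, r, s]) := by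
  cases p <;> cases q <;> cases r <;> cases s <;> simp [Vertex.fold]

/-- Crossing can be tested on any representatives of the two segments. -/
theorem crossing_mk (h : IsSignFunction χ) {p q r s : Vertex X} :
    Crossing χ s(p, q) s(r, s) ↔ ([p, q, r, s].map Vertex.fold).Nodup ∧
      extSign χ p q r ≠ extSign χ p q s ∧ extSign χ r s p ≠ extSign χ r s q := by
  have key : ∀ p q r s : Vertex X, ([p, q, r, s].map Vertex.fold).Nodup →
      (extSign χ q p r = -extSign χ p q r ∧ extSign χ q p s = -extSign χ p q s) ∧
      (extSign χ s r p = -extSign χ r s p ∧ extSign χ s r q = -extSign χ r s q) := by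
    intro p q r s hn
    simp only [List.map_cons, List.map_nil, List.nodup_cons, List.mem_cons, List.not_mem_nil,
      or_false, not_or] at hn
    obtain ⟨⟨a, b, c⟩, ⟨d, e⟩, f, -⟩ := hn
    exact ⟨⟨extSign_swap₁₂ h ⟨a, b, d⟩, extSign_swap₁₂ h ⟨a, c, e⟩⟩,
      extSign_swap₁₂ h ⟨f, Ne.symm b, Ne.symm c⟩, extSign_swap₁₂ h ⟨f, Ne.symm d, Ne.symm e⟩⟩
  constructor
  · rintro ⟨p', q', r', s', he, hf, h1, h2, h3, h4⟩
    have hn := nodup_fold_iff.2 ⟨h1, h2⟩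
    obtain ⟨⟨k1, k2⟩, k3, k4⟩ := key _ _ _ _ hn
    rw [units_eq_neg_iff_ne] at h3 h4
    have P1 : ([q', p', r', s'].map Vertex.fold).Nodup := by
      rw [(((List.Perm.swap _ _ _).map _).nodup_iff)]; exact hn
    have P2 : ([p', q', s', r'].map Vertex.fold).Nodup := by
      rw [(((((List.Perm.swap _ _ _).cons _).cons _).map _).nodup_iff)]; exact hn
    have P3 : ([q', p', s', r'].map Vertex.fold).Nodup := by
      rw [(((List.Perm.swap _ _ _).map _).nodup_iff)]; exact P2
    rcases Sym2.eq_iff.1 he with ⟨rfl, rfl⟩ | ⟨rfl, rfl⟩ <;>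
      rcases Sym2.eq_iff.1 hf with ⟨rfl, rfl⟩ | ⟨rfl, rfl⟩
    · exact ⟨hn, h3, h4⟩
    · exact ⟨P2, h3.symm, by rwa [k3, k4, Ne, neg_inj]⟩
    · exact ⟨P1, by rwa [k1, k2, Ne, neg_inj], h4.symm⟩
    · exact ⟨P3, by rw [k1, k2, Ne, neg_inj]; exact h3.symm,
        by rw [k3, k4, Ne, neg_inj]; exact h4.symm⟩
  · rintro ⟨h1, h2, h3⟩
    obtain ⟨a, b⟩ := nodup_fold_iff.1 h1
    exact ⟨p, q, r, s, rfl, rfl, a, b, units_eq_neg_iff_ne.2 h2, units_eq_neg_iff_ne.2 h3⟩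

theorem Crossing.symm {e f : Sym2 (Vertex X)} (h : Crossing χ e f) : Crossing χ f e := by
  obtain ⟨p, q, r, s, he, hf, h1, h2, h3, h4⟩ := h
  refine ⟨r, s, p, q, hf, he, ?_, ?_, h4, h3⟩
  · exact (List.perm_append_comm (l₁ := [p, q]) (l₂ := [r, s])).nodup_iff.1 h1
  · have : ∀ a, a ∈ [r, s, p, q] ↔ a ∈ [p, q, r, s] := fun a =>
      (List.perm_append_comm (l₁ := [r, s]) (l₂ := [p, q])).mem_iff
    simpa only [this] using h2

theorem crossing_comm {e f : Sym2 (Vertex X)} : Crossing χ e f ↔ Crossing χ f e :=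
  ⟨Crossing.symm, Crossing.symm⟩

/-- Crossing segments have no endpoint in common. -/
theorem Crossing.disjoint {e f : Sym2 (Vertex X)} (h : Crossing χ e f) {a : Vertex X}
    (ha : a ∈ e) : a ∉ f := by
  obtain ⟨p, q, r, s, rfl, rfl, h1, -⟩ := h
  simp only [List.nodup_cons, List.mem_cons, List.not_mem_nil, or_false, not_or] at h1
  simp only [Sym2.mem_iff] at *
  rintro (rfl | rfl) <;> rcases ha with rfl | rfl <;> simp_all

end crossing

/-! ### The two sides of the join -/

section join

variable {X₁ : Type u} {X₂ : Type v} [Nonempty X₁] [Nonempty X₂]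
  {χ₁ : RootedSignMap X₁} {χ₂ : RootedSignMap X₂}

theorem join_left {p q r : Option (JoinSet X₁ χ₂)}
    (h : [joinLeft χ₂ p, joinLeft χ₂ q, joinLeft χ₂ r].Nodup) :
    join χ₁ χ₂ p q r = χ₁ (joinLeft χ₂ p) (joinLeft χ₂ q) (joinLeft χ₂ r) := by
  rw [join, if_pos h]

/-- A triple of the join that is nondegenerate in `X₂` is oriented by `χ₂`; if it is nondegenerate
in `X₁` as well, then it consists of `x₀` and of one further element on each side, and both
orientations agree. -/
theorem join_right [Finite X₁] [Finite X₂] (h₁ : IsRootOrdered χ₁) (h₂ : IsRootOrdered χ₂)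
    {p q r : Option (JoinSet X₁ χ₂)}
    (h : [joinRight χ₁ χ₂ p, joinRight χ₁ χ₂ q, joinRight χ₁ χ₂ r].Nodup) :
    join χ₁ χ₂ p q r =
      χ₂ (joinRight χ₁ χ₂ p) (joinRight χ₁ χ₂ q) (joinRight χ₁ χ₂ r) := by
  by_cases hl : [joinLeft χ₂ p, joinLeft χ₂ q, joinLeft χ₂ r].Nodup
  swap
  · rw [join, if_neg hl, if_pos h]
  rw [join_left hl]
  have A : ∀ x : X₁, x ≠ hullPred χ₁ →
      χ₁ none (some x) (some (hullPred χ₁)) = 1 ∧ χ₁ (some x) (some (hullPred χ₁)) none = 1 ∧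
      χ₁ (some (hullPred χ₁)) none (some x) = 1 ∧
      χ₁ none (some (hullPred χ₁)) (some x) = -1 ∧ χ₁ (some x) none (some (hullPred χ₁)) = -1 ∧
      χ₁ (some (hullPred χ₁)) (some x) none = -1 := by
    intro x hx
    have e := h₁.none_hullPred hx
    obtain ⟨a, b, c, d, f⟩ := h₁.sign none (some x) (some (hullPred χ₁)) (by simp) (by simp)
      (by simpa using hx)
    rw [e] at a b c d f
    exact ⟨e, a.symm, b.symm, by rw [f]; simp, by rw [d]; simp, by rw [c]; simp⟩
  have B : ∀ x : X₂, x ≠ hullSucc χ₂ →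
      χ₂ none (some (hullSucc χ₂)) (some x) = 1 ∧ χ₂ (some (hullSucc χ₂)) (some x) none = 1 ∧
      χ₂ (some x) none (some (hullSucc χ₂)) = 1 ∧
      χ₂ none (some x) (some (hullSucc χ₂)) = -1 ∧ χ₂ (some (hullSucc χ₂)) none (some x) = -1 ∧
      χ₂ (some x) (some (hullSucc χ₂)) none = -1 := by
    intro x hx
    have e := h₂.none_hullSucc hx
    obtain ⟨a, b, c, d, f⟩ := h₂.sign none (some (hullSucc χ₂)) (some x) (by simp) (by simp)
      (by simpa using hx.symm)
    rw [e] at a b c d f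
    exact ⟨e, a.symm, b.symm, by rw [f]; simp, by rw [d]; simp, by rw [c]; simp⟩
  rw [nodup_three] at h hl
  rcases p with _ | x | x <;> rcases q with _ | y | y <;> rcases r with _ | z | z <;>
    simp only [joinLeft, joinRight, ne_eq, reduceCtorEq, not_true_eq_false, not_false_eq_true,
      and_false, false_and, and_true, true_and, Option.some.injEq] at h hl ⊢ <;>
    (try by_cases hx : x = hullPred χ₁) <;> (try by_cases hy : y = hullPred χ₁) <;>
    (try by_cases hz : z = hullPred χ₁) <;>
    (try have := B _ x.2) <;> (try have := B _ y.2) <;> (try have := B _ z.2) <;>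
    (try have := A _ hx) <;> (try have := A _ hy) <;> (try have := A _ hz) <;>
    simp_all

/-- The map `X₃ ∪ {u₃, v₃} → X₁ ∪ {u₁, v₁}` that collapses the rest of `X₂` to `u₁`. -/
def Vertex.toLeft (χ₂ : RootedSignMap X₂) : Vertex (JoinSet X₁ χ₂) → Vertex X₁
  | .pt (Sum.inl x) => .pt x
  | .pt (Sum.inr _) => .root
  | .root => .root
  | .anti => .anti

open Classical in
/-- The map `X₃ ∪ {u₃, v₃} → X₂ ∪ {u₂, v₂}` that collapses the rest of `X₁` to `u₂`. -/
noncomputable def Vertex.toRight (χ₁ : RootedSignMap X₁) (χ₂ : RootedSignMap X₂) :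
    Vertex (JoinSet X₁ χ₂) → Vertex X₂
  | .pt (Sum.inl x) => if x = hullPred χ₁ then .pt (hullSucc χ₂) else .root
  | .pt (Sum.inr y) => .pt y.1
  | .root => .root
  | .anti => .anti

theorem Vertex.fold_toLeft (p : Vertex (JoinSet X₁ χ₂)) :
    (p.toLeft χ₂).fold = joinLeft χ₂ p.fold := by
  rcases p with (_ | _) | _ | _ <;> rfl

theorem Vertex.fold_toRight (p : Vertex (JoinSet X₁ χ₂)) :
    (p.toRight χ₁ χ₂).fold = joinRight χ₁ χ₂ p.fold := by
  rcases p with (_ | _) | _ | _ <;> simp only [toRight, fold, joinRight]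
  split_ifs <;> rfl

theorem Vertex.anti_eq_toLeft {p : Vertex (JoinSet X₁ χ₂)} :
    .anti = p.toLeft χ₂ ↔ .anti = p := by
  rcases p with (_ | _) | _ | _ <;> simp [toLeft]

theorem Vertex.anti_eq_toRight {p : Vertex (JoinSet X₁ χ₂)} :
    .anti = p.toRight χ₁ χ₂ ↔ .anti = p := by
  rcases p with (_ | _) | _ | _ <;> simp only [toRight, reduceCtorEq]
  split_ifs <;> simp

theorem extSign_join_left {p q r : Vertex (JoinSet X₁ χ₂)}
    (h : [(p.toLeft χ₂).fold, (q.toLeft χ₂).fold, (r.toLeft χ₂).fold].Nodup) :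
    extSign (join χ₁ χ₂) p q r = extSign χ₁ (p.toLeft χ₂) (q.toLeft χ₂) (r.toLeft χ₂) := by
  simp only [Vertex.fold_toLeft] at h
  have hm : .anti ∈ [p.toLeft χ₂, q.toLeft χ₂, r.toLeft χ₂] ↔ .anti ∈ [p, q, r] := by
    simp only [List.mem_cons, List.not_mem_nil, or_false, Vertex.anti_eq_toLeft]
  by_cases ha : Vertex.anti ∈ [p, q, r]
  · rw [extSign, extSign, if_pos ha, if_pos (hm.2 ha)]
    simp only [Vertex.fold_toLeft, join_left h]
  · rw [extSign, extSign, if_neg ha, if_neg (mt hm.1 ha)]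
    simp only [Vertex.fold_toLeft, join_left h]

theorem extSign_join_right [Finite X₁] [Finite X₂] (h₁ : IsRootOrdered χ₁) (h₂ : IsRootOrdered χ₂)
    {p q r : Vertex (JoinSet X₁ χ₂)}
    (h : [(p.toRight χ₁ χ₂).fold, (q.toRight χ₁ χ₂).fold, (r.toRight χ₁ χ₂).fold].Nodup) :
    extSign (join χ₁ χ₂) p q r =
      extSign χ₂ (p.toRight χ₁ χ₂) (q.toRight χ₁ χ₂) (r.toRight χ₁ χ₂) := by
  simp only [Vertex.fold_toRight] at h
  have hm : .anti ∈ [p.toRight χ₁ χ₂, q.toRight χ₁ χ₂, r.toRight χ₁ χ₂] ↔ .anti ∈ [p, q, r] := by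
    simp only [List.mem_cons, List.not_mem_nil, or_false, Vertex.anti_eq_toRight]
  by_cases ha : Vertex.anti ∈ [p, q, r]
  · rw [extSign, extSign, if_pos ha, if_pos (hm.2 ha)]
    simp only [Vertex.fold_toRight, join_right h₁ h₂ h]
  · rw [extSign, extSign, if_neg ha, if_neg (mt hm.1 ha)]
    simp only [Vertex.fold_toRight, join_right h₁ h₂ h]

/-- Four points with distinct images in `X₁ ∪ {u₁, v₁}` cross exactly if their images do. -/
theorem crossing_join_left (h₁ : IsSignFunction χ₁) (h₂ : IsSignFunction χ₂)
    {p q r s : Vertex (JoinSet X₁ χ₂)}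
    (h : ([p.toLeft χ₂, q.toLeft χ₂, r.toLeft χ₂, s.toLeft χ₂].map Vertex.fold).Nodup) :
    Crossing (join χ₁ χ₂) s(p, q) s(r, s) ↔
      Crossing χ₁ s(p.toLeft χ₂, q.toLeft χ₂) s(r.toLeft χ₂, s.toLeft χ₂) := by
  have h' : ([p, q, r, s].map Vertex.fold).Nodup := by
    refine List.Nodup.of_map (joinLeft χ₂) ?_
    simpa only [List.map_cons, List.map_nil, ← Vertex.fold_toLeft] using h
  rw [crossing_mk h₁, crossing_mk (join_isSignFunction h₁ h₂), and_iff_right h, and_iff_right h']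
  simp only [List.map_cons, List.map_nil, List.nodup_cons, List.mem_cons, List.not_mem_nil,
    or_false, not_or] at h
  obtain ⟨⟨a, b, c⟩, ⟨d, e⟩, f, -⟩ := h
  rw [extSign_join_left (nodup_three.2 ⟨a, b, d⟩), extSign_join_left (nodup_three.2 ⟨a, c, e⟩),
    extSign_join_left (nodup_three.2 ⟨f, Ne.symm b, Ne.symm c⟩),
    extSign_join_left (nodup_three.2 ⟨f, Ne.symm d, Ne.symm e⟩)]

/-- Four points with distinct images in `X₂ ∪ {u₂, v₂}` cross exactly if their images do. -/
theorem crossing_join_right [Finite X₁] [Finite X₂] (h₁ : IsRootOrdered χ₁)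
    (h₂ : IsRootOrdered χ₂) {p q r s : Vertex (JoinSet X₁ χ₂)}
    (h : ([p.toRight χ₁ χ₂, q.toRight χ₁ χ₂, r.toRight χ₁ χ₂, s.toRight χ₁ χ₂].map
      Vertex.fold).Nodup) :
    Crossing (join χ₁ χ₂) s(p, q) s(r, s) ↔
      Crossing χ₂ s(p.toRight χ₁ χ₂, q.toRight χ₁ χ₂) s(r.toRight χ₁ χ₂, s.toRight χ₁ χ₂) := by
  have h' : ([p, q, r, s].map Vertex.fold).Nodup := by
    refine List.Nodup.of_map (joinRight χ₁ χ₂) ?_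
    simpa only [List.map_cons, List.map_nil, ← Vertex.fold_toRight] using h
  rw [crossing_mk h₂.sign, crossing_mk (join_isSignFunction h₁.sign h₂.sign), and_iff_right h,
    and_iff_right h']
  simp only [List.map_cons, List.map_nil, List.nodup_cons, List.mem_cons, List.not_mem_nil,
    or_false, not_or] at h
  obtain ⟨⟨a, b, c⟩, ⟨d, e⟩, f, -⟩ := h
  rw [extSign_join_right h₁ h₂ (nodup_three.2 ⟨a, b, d⟩),
    extSign_join_right h₁ h₂ (nodup_three.2 ⟨a, c, e⟩),
    extSign_join_right h₁ h₂ (nodup_three.2 ⟨f, Ne.symm b, Ne.symm c⟩),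
    extSign_join_right h₁ h₂ (nodup_three.2 ⟨f, Ne.symm d, Ne.symm e⟩)]

/-- The inclusion of `X₁ ∪ {u₁, v₁}` into `X₃ ∪ {u₃, v₃}`. -/
def Vertex.inl (χ₂ : RootedSignMap X₂) : Vertex X₁ → Vertex (JoinSet X₁ χ₂)
  | .pt x => .pt (Sum.inl x)
  | .root => .root
  | .anti => .anti

/-- The inclusion of `X₂ ∪ {u₂, v₂}` into `X₃ ∪ {u₃, v₃}`. -/
noncomputable def Vertex.inr (χ₁ : RootedSignMap X₁) (χ₂ : RootedSignMap X₂) :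
    Vertex X₂ → Vertex (JoinSet X₁ χ₂)
  | .pt y => .pt (joinInr χ₁ χ₂ y)
  | .root => .root
  | .anti => .anti

theorem Vertex.toLeft_inl (p : Vertex X₁) : (p.inl χ₂).toLeft χ₂ = p := by
  cases p <;> rfl

theorem Vertex.toRight_inr (p : Vertex X₂) : (p.inr χ₁ χ₂).toRight χ₁ χ₂ = p := by
  rcases p with y | _ | _ <;> try rfl
  by_cases hy : y = hullSucc χ₂ <;> simp [inr, joinInr, hy, toRight]

theorem Vertex.inl_injective : Function.Injective (Vertex.inl (X₁ := X₁) χ₂) :=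
  Function.LeftInverse.injective Vertex.toLeft_inl

theorem Vertex.inr_injective : Function.Injective (Vertex.inr χ₁ χ₂) :=
  Function.LeftInverse.injective Vertex.toRight_inr

theorem joinInr_injective : Function.Injective (joinInr χ₁ χ₂) := by
  intro x y h
  simpa using Vertex.inr_injective (χ₁ := χ₁) (χ₂ := χ₂) (a₁ := .pt x) (a₂ := .pt y)
    (by simp [Vertex.inr, h])

theorem joinInr_hullSucc : joinInr χ₁ χ₂ (hullSucc χ₂) = Sum.inl (hullPred χ₁) := by
  simp [joinInr]

theorem joinInr_of_ne {y : X₂} (hy : y ≠ hullSucc χ₂) : joinInr χ₁ χ₂ y = Sum.inr ⟨y, hy⟩ := by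
  simp [joinInr, hy]

theorem inl_eq_joinInr {x : X₁} {y : X₂} :
    (Sum.inl x : JoinSet X₁ χ₂) = joinInr χ₁ χ₂ y ↔ x = hullPred χ₁ ∧ y = hullSucc χ₂ := by
  by_cases hy : y = hullSucc χ₂ <;> simp [joinInr, hy]

theorem nodup_fold_inl {p q r s : Vertex X₁} :
    ([p.inl χ₂, q.inl χ₂, r.inl χ₂, s.inl χ₂].map Vertex.fold).Nodup ↔
      ([p, q, r, s].map Vertex.fold).Nodup := by
  cases p <;> cases q <;> cases r <;> cases s <;> simp [Vertex.inl, Vertex.fold]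

theorem nodup_fold_inr {p q r s : Vertex X₂} :
    ([p.inr χ₁ χ₂, q.inr χ₁ χ₂, r.inr χ₁ χ₂, s.inr χ₁ χ₂].map Vertex.fold).Nodup ↔
      ([p, q, r, s].map Vertex.fold).Nodup := by
  cases p <;> cases q <;> cases r <;> cases s <;>
    simp [Vertex.inr, Vertex.fold, joinInr_injective.eq_iff]

theorem crossing_inl (h₁ : IsSignFunction χ₁) (h₂ : IsSignFunction χ₂)
    {e f : Sym2 (Vertex X₁)} :
    Crossing (join χ₁ χ₂) (e.map (Vertex.inl χ₂)) (f.map (Vertex.inl χ₂)) ↔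
      Crossing χ₁ e f := by
  induction e with | _ p q
  induction f with | _ r s
  simp only [Sym2.map_mk]
  by_cases h : ([p, q, r, s].map Vertex.fold).Nodup
  · rw [crossing_join_left h₁ h₂] <;> simp only [Vertex.toLeft_inl, h]
  · rw [crossing_mk h₁, crossing_mk (join_isSignFunction h₁ h₂), nodup_fold_inl]
    simp only [h, false_and]

theorem crossing_inr [Finite X₁] [Finite X₂] (h₁ : IsRootOrdered χ₁) (h₂ : IsRootOrdered χ₂)
    {e f : Sym2 (Vertex X₂)} :
    Crossing (join χ₁ χ₂) (e.map (Vertex.inr χ₁ χ₂)) (f.map (Vertex.inr χ₁ χ₂)) ↔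
      Crossing χ₂ e f := by
  induction e with | _ p q
  induction f with | _ r s
  simp only [Sym2.map_mk]
  by_cases h : ([p, q, r, s].map Vertex.fold).Nodup
  · rw [crossing_join_right h₁ h₂] <;> simp only [Vertex.toRight_inr, h]
  · rw [crossing_mk h₂.sign, crossing_mk (join_isSignFunction h₁.sign h₂.sign), nodup_fold_inr]
    simp only [h, false_and]

/-- The root orders `X₁` before `X₂`. -/
theorem join_none_inl_joinInr [Finite X₁] [Finite X₂] (h₁ : IsRootOrdered χ₁)
    (h₂ : IsRootOrdered χ₂) {x : X₁} {y : X₂} (h : Sum.inl x ≠ joinInr χ₁ χ₂ y) :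
    join χ₁ χ₂ none (some (Sum.inl x)) (some (joinInr χ₁ χ₂ y)) = 1 := by
  by_cases hy : y = hullSucc χ₂
  · subst hy
    rw [joinInr_hullSucc] at h ⊢
    rw [join_left] <;> simp only [joinLeft]
    · exact h₁.none_hullPred (by simpa using h)
    · simpa using h
  · by_cases hx : x = hullPred χ₁
    · subst hx
      rw [join_right h₁ h₂] <;> simp [joinRight, joinInr, hy]
      · exact h₂.none_hullSucc hy
      · exact Ne.symm hy
    · simp [join, joinLeft, joinRight, joinInr, hy, hx, joinRank]
      decide

end join

/-! ### Crossings with bridges -/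

section bridges

variable {X₁ : Type u} {X₂ : Type v} [Nonempty X₁] [Nonempty X₂]
  {χ₁ : RootedSignMap X₁} {χ₂ : RootedSignMap X₂}

theorem join_inl_joinInr_inl (h₁ : IsSignFunction χ₁) {x z : X₁} {y : X₂}
    (hy : y ≠ hullSucc χ₂) (hxz : x ≠ z) :
    join χ₁ χ₂ (some (Sum.inl x)) (some (joinInr χ₁ χ₂ y)) (some (Sum.inl z)) =
      χ₁ none (some z) (some x) := by
  rw [joinInr_of_ne hy, join_left] <;> simp only [joinLeft]
  · exact h₁.rot (by simp) (by simpa using hxz) (by simp)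
  · simpa using hxz

theorem joinRight_inl_of_ne {x : X₁} (hx : x ≠ hullPred χ₁) :
    joinRight χ₁ χ₂ (some (Sum.inl x)) = none := by
  simp [joinRight, hx]

theorem joinRight_joinInr (y : X₂) : joinRight χ₁ χ₂ (some (joinInr χ₁ χ₂ y)) = some y := by
  by_cases hy : y = hullSucc χ₂ <;> simp [joinInr, hy, joinRight]

variable [Finite X₁] [Finite X₂]

theorem join_inl_joinInr_joinInr (h₁ : IsRootOrdered χ₁) (h₂ : IsRootOrdered χ₂) {x : X₁}
    {y z : X₂} (hx : x ≠ hullPred χ₁) (hyz : y ≠ z) :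
    join χ₁ χ₂ (some (Sum.inl x)) (some (joinInr χ₁ χ₂ y)) (some (joinInr χ₁ χ₂ z)) =
      χ₂ none (some y) (some z) := by
  rw [join_right h₁ h₂] <;> simp only [joinRight_inl_of_ne hx, joinRight_joinInr]
  simpa using hyz

theorem join_inl_joinInr_none (h₁ : IsRootOrdered χ₁) (h₂ : IsRootOrdered χ₂) {x : X₁} {y : X₂}
    (h : Sum.inl x ≠ joinInr χ₁ χ₂ y) :
    join χ₁ χ₂ (some (Sum.inl x)) (some (joinInr χ₁ χ₂ y)) none = 1 := by
  rw [← (join_isSignFunction h₁.sign h₂.sign).rot (by simp) (by simp) (by simpa using h)]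
  exact join_none_inl_joinInr h₁ h₂ h

theorem join_none_inl_inl {x z : X₁} (h : x ≠ z) :
    join χ₁ χ₂ none (some (Sum.inl x)) (some (Sum.inl z)) = χ₁ none (some x) (some z) := by
  rw [join_left] <;> simp only [joinLeft]
  simpa using h

theorem join_none_joinInr_joinInr (h₁ : IsRootOrdered χ₁) (h₂ : IsRootOrdered χ₂) {x z : X₂}
    (h : x ≠ z) :
    join χ₁ χ₂ none (some (joinInr χ₁ χ₂ x)) (some (joinInr χ₁ χ₂ z)) =
      χ₂ none (some x) (some z) := by
  have e : joinRight χ₁ χ₂ none = none := rfl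
  rw [join_right h₁ h₂] <;> simp only [joinRight_joinInr, e]
  simpa using h

theorem join_none_joinInr_inl (h₁ : IsRootOrdered χ₁)
    (h₂ : IsRootOrdered χ₂) {x : X₁} {y : X₂} (h : Sum.inl x ≠ joinInr χ₁ χ₂ y) :
    join χ₁ χ₂ none (some (joinInr χ₁ χ₂ y)) (some (Sum.inl x)) = -1 := by
  rw [(join_isSignFunction h₁.sign h₂.sign).swap (by simp) (by simp) (by simpa using h),
    join_none_inl_joinInr h₁ h₂ h]

/-- A segment between the two sides of the join, other than a root segment. -/
noncomputable def bridge (χ₁ : RootedSignMap X₁) (χ₂ : RootedSignMap X₂) (x : X₁) (y : X₂) :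
    Sym2 (Vertex (JoinSet X₁ χ₂)) :=
  s(.pt (Sum.inl x), .pt (joinInr χ₁ χ₂ y))

theorem extSign_pt {X : Type u} {χ : RootedSignMap X} (x y z : X) :
    extSign χ (.pt x) (.pt y) (.pt z) = χ (some x) (some y) (some z) := by
  simp [extSign, Vertex.fold]

theorem extSign_root_pt {X : Type u} {χ : RootedSignMap X} (x y : X) :
    extSign χ .root (.pt x) (.pt y) = χ none (some x) (some y) := by
  simp [extSign, Vertex.fold]

theorem extSign_anti_pt {X : Type u} {χ : RootedSignMap X} (x y : X) :
    extSign χ .anti (.pt x) (.pt y) = -χ none (some x) (some y) := by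
  simp [extSign, Vertex.fold]

theorem extSign_pt_root {X : Type u} {χ : RootedSignMap X} (x y : X) :
    extSign χ (.pt x) (.pt y) .root = χ (some x) (some y) none := by
  simp [extSign, Vertex.fold]

theorem extSign_pt_anti {X : Type u} {χ : RootedSignMap X} (x y : X) :
    extSign χ (.pt x) (.pt y) .anti = -χ (some x) (some y) none := by
  simp [extSign, Vertex.fold]

/-- Two bridges cross unless they are nested around `x₀`. -/
theorem crossing_bridge_bridge (h₁ : IsRootOrdered χ₁) (h₂ : IsRootOrdered χ₂) {x x' : X₁}
    {y y' : X₂} (hx : x ≠ hullPred χ₁) (hx' : x' ≠ hullPred χ₁) (hy : y ≠ hullSucc χ₂)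
    (hy' : y' ≠ hullSucc χ₂) :
    Crossing (join χ₁ χ₂) (bridge χ₁ χ₂ x y) (bridge χ₁ χ₂ x' y') ↔
      x ≠ x' ∧ y ≠ y' ∧ χ₁ none (some x) (some x') = χ₂ none (some y) (some y') := by
  rw [bridge, bridge, crossing_mk (join_isSignFunction h₁.sign h₂.sign)]
  have A : ∀ {a : X₁} {b : X₂}, a ≠ hullPred χ₁ → Sum.inl a ≠ joinInr χ₁ χ₂ b := fun ha => by
    rw [Ne, inl_eq_joinInr]; tauto
  have hn : ([Vertex.pt (Sum.inl x), .pt (joinInr χ₁ χ₂ y), .pt (Sum.inl x'),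
      .pt (joinInr χ₁ χ₂ y')].map Vertex.fold).Nodup ↔ x ≠ x' ∧ y ≠ y' := by
    have := A (b := y) hx; have := A (b := y') hx; have := A (b := y) hx'
    have := A (b := y') hx'
    simp [Vertex.fold, joinInr_injective.eq_iff]
    tauto
  rw [hn]
  by_cases hxx : x = x'
  · simp [hxx]
  by_cases hyy : y = y'
  · simp [hyy]
  simp only [extSign_pt, join_inl_joinInr_inl h₁.sign hy hxx,
    join_inl_joinInr_inl h₁.sign hy' (Ne.symm hxx),
    join_inl_joinInr_joinInr h₁ h₂ hx hyy, join_inl_joinInr_joinInr h₁ h₂ hx' (Ne.symm hyy)]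
  rw [h₁.sign.none_swap (Ne.symm hxx), h₂.sign.none_swap (Ne.symm hyy)]
  rcases Int.units_eq_one_or (χ₁ none (some x) (some x')) with e | e <;>
    rcases Int.units_eq_one_or (χ₂ none (some y) (some y')) with e' | e' <;>
    rw [e, e'] <;> simp [hxx, hyy]

/-- A root segment on the left side crosses a bridge exactly if it starts below the bridge. -/
theorem crossing_root_inl_bridge (h₁ : IsRootOrdered χ₁) (h₂ : IsRootOrdered χ₂) {x z : X₁}
    {y : X₂} (hx : x ≠ hullPred χ₁) (hy : y ≠ hullSucc χ₂) :
    Crossing (join χ₁ χ₂) s(.root, .pt (Sum.inl z)) (bridge χ₁ χ₂ x y) ↔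
      x ≠ z ∧ χ₁ none (some x) (some z) = 1 := by
  rw [bridge, crossing_mk (join_isSignFunction h₁.sign h₂.sign)]
  have A : Sum.inl x ≠ joinInr χ₁ χ₂ y := by rw [Ne, inl_eq_joinInr]; tauto
  have B : Sum.inl z ≠ joinInr χ₁ χ₂ y := by rw [Ne, inl_eq_joinInr]; tauto
  by_cases hxz : x = z
  · simp [hxz, Vertex.fold]
  have hn : ([Vertex.root, .pt (Sum.inl z), .pt (Sum.inl x),
      .pt (joinInr χ₁ χ₂ y)].map Vertex.fold).Nodup := by
    simp [Vertex.fold, Ne.symm hxz, A, B]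
  simp only [hn, extSign_pt, extSign_root_pt, extSign_pt_root,
    join_inl_joinInr_none h₁ h₂ A, join_none_inl_inl (Ne.symm hxz),
    join_inl_joinInr_inl h₁.sign hy hxz, join_none_inl_joinInr h₁ h₂ B, true_and]
  rw [h₁.sign.none_swap (Ne.symm hxz)]
  rcases Int.units_eq_one_or (χ₁ none (some x) (some z)) with e | e <;> rw [e] <;> simp [hxz]

/-- A root segment on the right side crosses a bridge exactly if it starts below the bridge. -/
theorem crossing_root_joinInr_bridge (h₁ : IsRootOrdered χ₁) (h₂ : IsRootOrdered χ₂) {x : X₁}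
    {y z : X₂} (hx : x ≠ hullPred χ₁) :
    Crossing (join χ₁ χ₂) s(.root, .pt (joinInr χ₁ χ₂ z)) (bridge χ₁ χ₂ x y) ↔
      z ≠ y ∧ χ₂ none (some z) (some y) = 1 := by
  rw [bridge, crossing_mk (join_isSignFunction h₁.sign h₂.sign)]
  have A : Sum.inl x ≠ joinInr χ₁ χ₂ y := by rw [Ne, inl_eq_joinInr]; tauto
  have B : Sum.inl x ≠ joinInr χ₁ χ₂ z := by rw [Ne, inl_eq_joinInr]; tauto
  by_cases hyz : z = y
  · simp [hyz, Vertex.fold]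
  have hn : ([Vertex.root, .pt (joinInr χ₁ χ₂ z), .pt (Sum.inl x),
      .pt (joinInr χ₁ χ₂ y)].map Vertex.fold).Nodup := by
    simp [Vertex.fold, hyz, A, Ne.symm B, joinInr_injective.eq_iff]
  simp only [hn, extSign_pt, extSign_root_pt, extSign_pt_root,
    join_inl_joinInr_none h₁ h₂ A, join_none_joinInr_joinInr h₁ h₂ hyz,
    join_inl_joinInr_joinInr h₁ h₂ hx (Ne.symm hyz), join_none_joinInr_inl h₁ h₂ B, true_and]
  rw [h₂.sign.none_swap (Ne.symm hyz)]
  rcases Int.units_eq_one_or (χ₂ none (some z) (some y)) with e | e <;> rw [e] <;> simp [hyz]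

theorem not_crossing_anti_inl_bridge (h₁ : IsRootOrdered χ₁) (h₂ : IsRootOrdered χ₂) {x z : X₁}
    {y : X₂} (hx : x ≠ hullPred χ₁) (hy : y ≠ hullSucc χ₂) :
    ¬ Crossing (join χ₁ χ₂) s(.anti, .pt (Sum.inl z)) (bridge χ₁ χ₂ x y) := by
  rw [bridge, crossing_mk (join_isSignFunction h₁.sign h₂.sign)]
  have A : Sum.inl x ≠ joinInr χ₁ χ₂ y := by rw [Ne, inl_eq_joinInr]; tauto
  have B : Sum.inl z ≠ joinInr χ₁ χ₂ y := by rw [Ne, inl_eq_joinInr]; tauto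
  by_cases hxz : x = z
  · simp [hxz, Vertex.fold]
  simp only [extSign_pt, extSign_anti_pt, extSign_pt_anti,
    join_inl_joinInr_none h₁ h₂ A, join_none_inl_inl (Ne.symm hxz),
    join_inl_joinInr_inl h₁.sign hy hxz, join_none_inl_joinInr h₁ h₂ B]
  rcases Int.units_eq_one_or (χ₁ none (some z) (some x)) with e | e <;> rw [e] <;> simp

theorem not_crossing_anti_joinInr_bridge (h₁ : IsRootOrdered χ₁) (h₂ : IsRootOrdered χ₂) {x : X₁}
    {y z : X₂} (hx : x ≠ hullPred χ₁) :
    ¬ Crossing (join χ₁ χ₂) s(.anti, .pt (joinInr χ₁ χ₂ z)) (bridge χ₁ χ₂ x y) := by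
  rw [bridge, crossing_mk (join_isSignFunction h₁.sign h₂.sign)]
  have A : Sum.inl x ≠ joinInr χ₁ χ₂ y := by rw [Ne, inl_eq_joinInr]; tauto
  have B : Sum.inl x ≠ joinInr χ₁ χ₂ z := by rw [Ne, inl_eq_joinInr]; tauto
  by_cases hyz : z = y
  · simp [hyz, Vertex.fold]
  simp only [extSign_pt, extSign_anti_pt, extSign_pt_anti,
    join_inl_joinInr_none h₁ h₂ A, join_none_joinInr_joinInr h₁ h₂ hyz,
    join_inl_joinInr_joinInr h₁ h₂ hx (Ne.symm hyz), join_none_joinInr_inl h₁ h₂ B]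
  rw [h₂.sign.none_swap (Ne.symm hyz)]
  rcases Int.units_eq_one_or (χ₂ none (some z) (some y)) with e | e <;> rw [e] <;> simp

theorem not_crossing_root_anti {X : Type u} {χ : RootedSignMap X} {e f : Sym2 (Vertex X)}
    (hr : .root ∈ e) (ha : .anti ∈ f) : ¬ Crossing χ e f := by
  rintro ⟨p, q, r, s, rfl, rfl, -, h, -⟩
  simp only [Sym2.mem_iff] at hr ha
  apply h
  simp only [List.mem_cons, List.not_mem_nil, or_false]
  tauto

/-- Within `X₁ ∪ {v₁}`, a bridge crosses the same segments as the root segment of its left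
endpoint. -/
theorem crossing_bridge_inl (h₁ : IsRootOrdered χ₁) (h₂ : IsRootOrdered χ₂) {x : X₁} {y : X₂}
    (hx : x ≠ hullPred χ₁) (hy : y ≠ hullSucc χ₂) {e : Sym2 (Vertex X₁)} (he : .root ∉ e) :
    Crossing (join χ₁ χ₂) (bridge χ₁ χ₂ x y) (e.map (Vertex.inl χ₂)) ↔
      Crossing χ₁ s(.root, .pt x) e := by
  induction e with | _ r s
  have key : ∀ r : Vertex X₁, ¬ Crossing (join χ₁ χ₂) (bridge χ₁ χ₂ x y)
      (s(.anti, r).map (Vertex.inl χ₂)) := by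
    intro r
    rcases r with z | _ | _
    · exact fun h => not_crossing_anti_inl_bridge h₁ h₂ hx hy h.symm
    · rintro ⟨a, b, c, d, -, h, h', h'', -⟩
      rcases Sym2.eq_iff.1 h with ⟨rfl, rfl⟩ | ⟨rfl, rfl⟩ <;> simp [Vertex.inl] at h''
    · rintro ⟨a, b, c, d, -, h, h', h'', -⟩
      rcases Sym2.eq_iff.1 h with ⟨rfl, rfl⟩ | ⟨rfl, rfl⟩ <;> simp [Vertex.inl] at h'
  by_cases ha : Vertex.anti ∈ s(r, s)
  · refine iff_of_false ?_ (not_crossing_root_anti (by simp) ha)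
    rcases Sym2.mem_iff.1 ha with rfl | rfl
    · exact key _
    · rw [Sym2.eq_swap]; exact key _
  rcases r with r | _ | _ <;> rcases s with s | _ | _ <;> try simp at he ha
  rw [Sym2.eq_swap (a := Vertex.root)]
  simp only [Sym2.map_mk, bridge, Vertex.inl, joinInr_of_ne hy]
  by_cases h : ([.pt x, .root, .pt r, .pt s].map Vertex.fold).Nodup
  · rw [crossing_join_left h₁.sign h₂.sign] <;> simp only [Vertex.toLeft, h]
  · rw [crossing_mk h₁.sign, crossing_mk (join_isSignFunction h₁.sign h₂.sign)]
    refine iff_of_false (fun h' => h ?_) (fun h' => h h'.1)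
    simpa [Vertex.fold] using h'.1

/-- Within `X₂ ∪ {v₂}`, a bridge crosses the same segments as the root segment of its right
endpoint. -/
theorem crossing_bridge_inr (h₁ : IsRootOrdered χ₁) (h₂ : IsRootOrdered χ₂) {x : X₁} {y : X₂}
    (hx : x ≠ hullPred χ₁) {e : Sym2 (Vertex X₂)} (he : .root ∉ e) :
    Crossing (join χ₁ χ₂) (bridge χ₁ χ₂ x y) (e.map (Vertex.inr χ₁ χ₂)) ↔
      Crossing χ₂ s(.root, .pt y) e := by
  induction e with | _ r s
  have key : ∀ r : Vertex X₂, ¬ Crossing (join χ₁ χ₂) (bridge χ₁ χ₂ x y)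
      (s(.anti, r).map (Vertex.inr χ₁ χ₂)) := by
    intro r
    rcases r with z | _ | _
    · exact fun h => not_crossing_anti_joinInr_bridge h₁ h₂ hx h.symm
    · rintro ⟨a, b, c, d, -, h, h', h'', -⟩
      rcases Sym2.eq_iff.1 h with ⟨rfl, rfl⟩ | ⟨rfl, rfl⟩ <;> simp [Vertex.inr] at h''
    · rintro ⟨a, b, c, d, -, h, h', h'', -⟩
      rcases Sym2.eq_iff.1 h with ⟨rfl, rfl⟩ | ⟨rfl, rfl⟩ <;> simp [Vertex.inr] at h'
  by_cases ha : Vertex.anti ∈ s(r, s)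
  · refine iff_of_false ?_ (not_crossing_root_anti (by simp) ha)
    rcases Sym2.mem_iff.1 ha with rfl | rfl
    · exact key _
    · rw [Sym2.eq_swap]; exact key _
  rcases r with r | _ | _ <;> rcases s with s | _ | _ <;> try simp at he ha
  have hb : ∀ {b : X₂}, Sum.inl x ≠ joinInr χ₁ χ₂ b := fun {b} => by
    rw [Ne, inl_eq_joinInr]; tauto
  have t1 : Vertex.toRight χ₁ χ₂ (.pt (Sum.inl x)) = .root := by simp [Vertex.toRight, hx]
  have t2 : ∀ b, Vertex.toRight χ₁ χ₂ (.pt (joinInr χ₁ χ₂ b)) = .pt b := fun b =>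
    Vertex.toRight_inr (.pt b)
  simp only [Sym2.map_mk, bridge, Vertex.inr]
  by_cases h : ([.root, .pt y, .pt r, .pt s].map Vertex.fold).Nodup
  · rw [crossing_join_right h₁ h₂] <;> simp only [t1, t2, h]
  · rw [crossing_mk h₂.sign, crossing_mk (join_isSignFunction h₁.sign h₂.sign)]
    refine iff_of_false (fun h' => h ?_) (fun h' => h h'.1)
    simpa [Vertex.fold, joinInr_injective.eq_iff, hb] using h'.1

/-- Segments on different sides of the join do not cross. -/
theorem not_crossing_inl_inr (h₁ : IsRootOrdered χ₁) (h₂ : IsRootOrdered χ₂)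
    (e : Sym2 (Vertex X₁)) (f : Sym2 (Vertex X₂)) :
    ¬ Crossing (join χ₁ χ₂) (e.map (Vertex.inl χ₂)) (f.map (Vertex.inr χ₁ χ₂)) := by
  have hS := join_isSignFunction h₁.sign h₂.sign
  -- a root segment on one side sees the other side as a whole
  have key₁ : ∀ (z : X₁) (y y' : X₂), ¬ Crossing (join χ₁ χ₂) s(.root, .pt (Sum.inl z))
      s(.pt (joinInr χ₁ χ₂ y), .pt (joinInr χ₁ χ₂ y')) ∧ ¬ Crossing (join χ₁ χ₂)
      s(.anti, .pt (Sum.inl z)) s(.pt (joinInr χ₁ χ₂ y), .pt (joinInr χ₁ χ₂ y')) := by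
    intro z y y'
    constructor <;> rw [crossing_mk hS] <;> rintro ⟨hn, h, -⟩ <;>
      simp only [Vertex.fold, List.map_cons, List.nodup_cons, List.mem_cons, Option.some.injEq,
        not_or] at hn
    · rw [extSign_root_pt, extSign_root_pt, join_none_inl_joinInr h₁ h₂ hn.2.1.1,
        join_none_inl_joinInr h₁ h₂ hn.2.1.2.1] at h
      exact h rfl
    · rw [extSign_anti_pt, extSign_anti_pt, join_none_inl_joinInr h₁ h₂ hn.2.1.1,
        join_none_inl_joinInr h₁ h₂ hn.2.1.2.1] at h
      exact h rfl
  have key₂ : ∀ (y : X₂) (z z' : X₁), ¬ Crossing (join χ₁ χ₂) s(.root, .pt (joinInr χ₁ χ₂ y))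
      s(.pt (Sum.inl z), .pt (Sum.inl z')) ∧ ¬ Crossing (join χ₁ χ₂)
      s(.anti, .pt (joinInr χ₁ χ₂ y)) s(.pt (Sum.inl z), .pt (Sum.inl z')) := by
    intro y z z'
    constructor <;> rw [crossing_mk hS] <;> rintro ⟨hn, h, -⟩ <;>
      simp only [Vertex.fold, List.map_cons, List.nodup_cons, List.mem_cons, Option.some.injEq,
        not_or] at hn
    · rw [extSign_root_pt, extSign_root_pt, join_none_joinInr_inl h₁ h₂ (Ne.symm hn.2.1.1),
        join_none_joinInr_inl h₁ h₂ (Ne.symm hn.2.1.2.1)] at h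
      exact h rfl
    · rw [extSign_anti_pt, extSign_anti_pt, join_none_joinInr_inl h₁ h₂ (Ne.symm hn.2.1.1),
        join_none_joinInr_inl h₁ h₂ (Ne.symm hn.2.1.2.1)] at h
      exact h rfl
  have key₃ : ∀ (x x' : X₁) (y y' : X₂), ¬ Crossing (join χ₁ χ₂)
      s(.pt (Sum.inl x), .pt (Sum.inl x'))
      s(.pt (joinInr χ₁ χ₂ y), .pt (joinInr χ₁ χ₂ y')) := by
    intro x x' y y'
    rw [crossing_mk hS]
    rintro ⟨hn, h, h'⟩
    simp only [Vertex.fold, List.map_cons, List.nodup_cons, List.mem_cons, Option.some.injEq,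
      not_or] at hn
    obtain ⟨⟨n1, n2, n3, -⟩, ⟨n4, n5, -⟩, ⟨n6, -⟩, -⟩ := hn
    by_cases hx : x = hullPred χ₁ ∨ x' = hullPred χ₁
    · -- one endpoint is `x₀`, hence neither `y` nor `y'` is
      have hy : y ≠ hullSucc χ₂ ∧ y' ≠ hullSucc χ₂ := by
        simp only [inl_eq_joinInr] at n2 n3 n4 n5
        tauto
      rw [joinInr_of_ne hy.1, joinInr_of_ne hy.2] at h
      have n1' : x ≠ x' := by simpa using n1
      rw [extSign_pt, extSign_pt, join_left (by simpa [joinLeft] using n1'),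
        join_left (by simpa [joinLeft] using n1')] at h
      exact h rfl
    · rw [not_or] at hx
      have n6' : y ≠ y' := fun h => n6 (by rw [h])
      have R : ∀ a, a ≠ hullPred χ₁ → [joinRight χ₁ χ₂ (some (joinInr χ₁ χ₂ y)),
          joinRight χ₁ χ₂ (some (joinInr χ₁ χ₂ y')), joinRight χ₁ χ₂ (some (Sum.inl a))].Nodup := by
        intro a ha
        rw [joinRight_joinInr, joinRight_joinInr, joinRight_inl_of_ne ha]
        simpa using n6'
      rw [extSign_pt, extSign_pt, join_right h₁ h₂ (R _ hx.1), join_right h₁ h₂ (R _ hx.2),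
        joinRight_inl_of_ne hx.1, joinRight_inl_of_ne hx.2] at h'
      exact h' rfl
  induction e with | _ p q
  induction f with | _ r s
  rw [Sym2.map_mk, Sym2.map_mk]
  rcases p with p | _ | _ <;> rcases q with q | _ | _ <;> rcases r with r | _ | _ <;>
    rcases s with s | _ | _ <;> simp only [Vertex.inl, Vertex.inr] <;>
  first
  | (rw [crossing_mk hS]; simp [Vertex.fold]; done)
  | exact key₃ _ _ _ _
  | exact (key₁ _ _ _).1
  | exact (key₁ _ _ _).2
  | (rw [Sym2.eq_swap]; exact (key₁ _ _ _).1)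
  | (rw [Sym2.eq_swap]; exact (key₁ _ _ _).2)
  | (rw [crossing_comm]; exact (key₂ _ _ _).1)
  | (rw [crossing_comm]; exact (key₂ _ _ _).2)
  | (rw [crossing_comm, Sym2.eq_swap]; exact (key₂ _ _ _).1)
  | (rw [crossing_comm, Sym2.eq_swap]; exact (key₂ _ _ _).2)

end bridges

/-! ### Cores of weak triangulations -/

section cores

variable {X : Type u} {χ : RootedSignMap X}

theorem not_crossing_self (e : Sym2 (Vertex X)) : ¬ Crossing χ e e := by
  induction e with | _ p q
  exact fun h => h.disjoint (Sym2.mem_mk_left p q) (Sym2.mem_mk_left p q)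

theorem mem_weakTriangulations_iff {Δ : Set (Sym2 (Vertex X))} :
    Δ ∈ weakTriangulations χ ↔ IsNonCrossing χ Δ ∧
      ∀ e : Sym2 (Vertex X), ¬ e.IsDiag → e ≠ s(.root, .anti) →
        (∀ f ∈ Δ, ¬ Crossing χ e f) → e ∈ Δ := by
  constructor
  · rintro ⟨h, hmax⟩
    refine ⟨h, fun e hd hu hc => ?_⟩
    have : IsNonCrossing χ (insert e Δ) := by
      refine ⟨?_, ?_, ?_⟩
      · rintro f (rfl | hf)
        exacts [hd, h.not_isDiag f hf]
      · rintro (h' | h')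
        exacts [hu h'.symm, h.root_anti_notMem h']
      · rintro f (rfl | hf) g (rfl | hg)
        exacts [not_crossing_self _, hc g hg, fun h' => hc f hf h'.symm, h.not_crossing f hf g hg]
    exact hmax this (Set.subset_insert e Δ) (Set.mem_insert e Δ)
  · rintro ⟨h, hmax⟩
    refine ⟨h, fun Δ' h' hle e he => hmax e (h'.not_isDiag e he) ?_ ?_⟩
    · rintro rfl
      exact h'.root_anti_notMem he
    · exact fun f hf => h'.not_crossing e he f (hle hf)

/-- The elements of `X` whose root segment crosses no segment of `A`. -/
def rootVisible (χ : RootedSignMap X) (A : Set (Sym2 (Vertex X))) : Set X :=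
  {x | ∀ f ∈ A, ¬ Crossing χ s(.root, .pt x) f}

/-- A core is what remains of a weak triangulation when the segments at the root are removed.  The
root segments are recovered from a core `A` as those ending in `rootVisible χ A`, so maximality
can be stated in terms of `A` alone. -/
structure IsCore (χ : RootedSignMap X) (A : Set (Sym2 (Vertex X))) : Prop where
  not_isDiag : ∀ e ∈ A, ¬ e.IsDiag
  root_notMem : ∀ e ∈ A, .root ∉ e
  not_crossing : ∀ e ∈ A, ∀ f ∈ A, ¬ Crossing χ e f
  mem : ∀ e : Sym2 (Vertex X), ¬ e.IsDiag → .root ∉ e → (∀ f ∈ A, ¬ Crossing χ e f) →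
    (∀ x ∈ rootVisible χ A, ¬ Crossing χ s(.root, .pt x) e) → e ∈ A

/-- Adds all compatible root segments. -/
def addRoot (χ : RootedSignMap X) (A : Set (Sym2 (Vertex X))) : Set (Sym2 (Vertex X)) :=
  A ∪ (fun x => s(.root, .pt x)) '' rootVisible χ A

/-- Removes all root segments. -/
def removeRoot (Δ : Set (Sym2 (Vertex X))) : Set (Sym2 (Vertex X)) :=
  {e ∈ Δ | .root ∉ e}

theorem exists_pt_of_root_mem {e : Sym2 (Vertex X)} (hr : .root ∈ e) (hd : ¬ e.IsDiag)
    (hu : e ≠ s(.root, .anti)) : ∃ x, e = s(.root, .pt x) := by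
  obtain ⟨a, rfl⟩ := Sym2.mem_iff_exists.1 hr
  rcases a with x | _ | _
  · exact ⟨x, rfl⟩
  · simp at hd
  · exact absurd rfl hu

theorem not_crossing_root_root {e f : Sym2 (Vertex X)} (he : .root ∈ e) (hf : .root ∈ f) :
    ¬ Crossing χ e f := fun h => h.disjoint he hf

theorem rootVisible_removeRoot {Δ : Set (Sym2 (Vertex X))} (h : Δ ∈ weakTriangulations χ) {x : X} :
    x ∈ rootVisible χ (removeRoot Δ) ↔ s(.root, .pt x) ∈ Δ := by
  rw [mem_weakTriangulations_iff] at h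
  constructor
  · refine fun hx => h.2 _ (by simp) (by simp) fun f hf => ?_
    by_cases hr : .root ∈ f
    · exact not_crossing_root_root (by simp) hr
    · exact hx f ⟨hf, hr⟩
  · exact fun hx f hf => h.1.not_crossing _ hx f hf.1

theorem addRoot_removeRoot {Δ : Set (Sym2 (Vertex X))} (h : Δ ∈ weakTriangulations χ) :
    addRoot χ (removeRoot Δ) = Δ := by
  ext e
  constructor
  · rintro (he | ⟨x, hx, rfl⟩)
    · exact he.1
    · exact (rootVisible_removeRoot h).1 hx
  · intro he
    by_cases hr : .root ∈ e
    · obtain ⟨x, rfl⟩ := exists_pt_of_root_mem hr (h.1.not_isDiag e he)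
        (fun h' => h.1.root_anti_notMem (h' ▸ he))
      exact Or.inr ⟨x, (rootVisible_removeRoot h).2 he, rfl⟩
    · exact Or.inl ⟨he, hr⟩

theorem isCore_removeRoot {Δ : Set (Sym2 (Vertex X))} (h : Δ ∈ weakTriangulations χ) :
    IsCore χ (removeRoot Δ) := by
  refine ⟨fun e he => h.1.not_isDiag e he.1, fun e he => he.2,
    fun e he f hf => h.1.not_crossing e he.1 f hf.1, fun e hd hr hc hv => ⟨?_, hr⟩⟩
  refine (mem_weakTriangulations_iff.1 h).2 e hd (by rintro rfl; simp at hr) fun f hf => ?_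
  rw [← addRoot_removeRoot h] at hf
  rcases hf with hf | ⟨x, hx, rfl⟩
  exacts [hc f hf, fun h' => hv x hx h'.symm]

theorem removeRoot_addRoot {A : Set (Sym2 (Vertex X))} (h : IsCore χ A) :
    removeRoot (addRoot χ A) = A := by
  ext e
  constructor
  · rintro ⟨he | ⟨x, hx, rfl⟩, hr⟩
    exacts [he, absurd (Sym2.mem_mk_left _ _) hr]
  · exact fun he => ⟨Or.inl he, h.root_notMem e he⟩

theorem addRoot_mem_weakTriangulations {A : Set (Sym2 (Vertex X))} (h : IsCore χ A) :
    addRoot χ A ∈ weakTriangulations χ := by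
  rw [mem_weakTriangulations_iff]
  refine ⟨⟨?_, ?_, ?_⟩, ?_⟩
  · rintro e (he | ⟨x, hx, rfl⟩)
    exacts [h.not_isDiag e he, by simp]
  · rintro (he | ⟨x, hx, hx'⟩)
    · exact h.root_notMem _ he (Sym2.mem_mk_left _ _)
    · simp at hx'
  · rintro e (he | ⟨x, hx, rfl⟩) f (hf | ⟨y, hy, rfl⟩)
    exacts [h.not_crossing e he f hf, fun h' => hy e he h'.symm, hx f hf,
      not_crossing_root_root (by simp) (by simp)]
  · intro e hd hu hc
    by_cases hr : .root ∈ e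
    · obtain ⟨x, rfl⟩ := exists_pt_of_root_mem hr hd hu
      exact Or.inr ⟨x, fun f hf => hc f (Or.inl hf), rfl⟩
    · exact Or.inl (h.mem e hd hr (fun f hf => hc f (Or.inl hf))
        fun x hx h' => hc _ (Or.inr ⟨x, hx, rfl⟩) h'.symm)

theorem edgeDegree_addRoot_root {A : Set (Sym2 (Vertex X))} (h : IsCore χ A) :
    edgeDegree (addRoot χ A) .root = (rootVisible χ A).ncard := by
  have e : {e ∈ addRoot χ A | .root ∈ e} = (fun x => s(.root, .pt x)) '' rootVisible χ A := by
    ext e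
    constructor
    · rintro ⟨he | he, hr⟩
      exacts [absurd hr (h.root_notMem e he), he]
    · rintro ⟨x, hx, rfl⟩
      exact ⟨Or.inr ⟨x, hx, rfl⟩, Sym2.mem_mk_left _ _⟩
  rw [edgeDegree, e, Set.ncard_image_of_injective]
  intro x y hxy
  simpa using hxy

theorem edgeDegree_addRoot_anti {A : Set (Sym2 (Vertex X))} :
    edgeDegree (addRoot χ A) .anti = edgeDegree A .anti := by
  unfold edgeDegree
  congr 1
  ext e
  constructor
  · rintro ⟨he | ⟨x, hx, rfl⟩, hr⟩
    exacts [⟨he, hr⟩, by simp at hr]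
  · exact fun he => ⟨Or.inl he.1, he.2⟩

theorem weakPoly_eq_sum_cores [Finite X] (χ : RootedSignMap X) :
    weakPoly χ = ∑ A ∈ (Set.toFinite {A | IsCore χ A}).toFinset,
      (Polynomial.X : ℤ[X][X]) ^ (rootVisible χ A).ncard *
        C (Polynomial.X ^ edgeDegree A .anti) := by
  refine Finset.sum_nbij' removeRoot (addRoot χ) ?_ ?_ ?_ ?_ ?_
  · intro Δ h
    rw [Set.Finite.mem_toFinset] at h ⊢
    exact isCore_removeRoot h
  · intro A h
    rw [Set.Finite.mem_toFinset] at h ⊢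
    exact addRoot_mem_weakTriangulations h
  · intro Δ h
    rw [Set.Finite.mem_toFinset] at h
    exact addRoot_removeRoot h
  · intro A h
    rw [Set.Finite.mem_toFinset] at h
    exact removeRoot_addRoot h
  · intro Δ h
    rw [Set.Finite.mem_toFinset] at h
    rw [← edgeDegree_addRoot_root (isCore_removeRoot h), 
      ← edgeDegree_addRoot_anti (χ := χ) (A := removeRoot Δ), addRoot_removeRoot h]

end cores

/-! ### The twist exchanges the roles of `u` and `v` -/

section twist

variable {X : Type u} {χ : RootedSignMap X}

/-- Exchanges `u` and `v`. -/
def Vertex.flip : Vertex X → Vertex X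
  | .pt x => .pt x
  | .root => .anti
  | .anti => .root

theorem Vertex.flip_flip (p : Vertex X) : p.flip.flip = p := by cases p <;> rfl

theorem Vertex.flip_involutive : Function.Involutive (Vertex.flip (X := X)) := Vertex.flip_flip

theorem twist_twist (χ : RootedSignMap X) : twist (twist χ) = χ := by
  funext p q r
  simp only [twist]
  split_ifs <;> simp

theorem extSign_twist {p q r : Vertex X} (h : ¬ (.root ∈ [p, q, r] ∧ .anti ∈ [p, q, r])) :
    extSign (twist χ) p.flip q.flip r.flip = extSign χ p q r := by
  rcases p with p | _ | _ <;> rcases q with q | _ | _ <;> rcases r with r | _ | _ <;>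
    simp at h <;> simp [extSign, Vertex.flip, Vertex.fold, twist]

theorem Crossing.flip {e f : Sym2 (Vertex X)} (h : Crossing χ e f) :
    Crossing (twist χ) (e.map Vertex.flip) (f.map Vertex.flip) := by
  obtain ⟨p, q, r, s, rfl, rfl, h1, h2, h3, h4⟩ := h
  refine ⟨p.flip, q.flip, r.flip, s.flip, rfl, rfl,
    (List.nodup_map_iff (l := [p, q, r, s]) Vertex.flip_involutive.injective).2 h1, ?_, ?_, ?_⟩
  · have e1 : ∀ a : Vertex X, .root = a.flip ↔ .anti = a := by rintro (_ | _ | _) <;> simp [Vertex.flip]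
    have e2 : ∀ a : Vertex X, .anti = a.flip ↔ .root = a := by rintro (_ | _ | _) <;> simp [Vertex.flip]
    simp only [List.mem_cons, List.not_mem_nil, or_false, e1, e2] at h2 ⊢
    tauto
  all_goals
    simp only [List.mem_cons, List.not_mem_nil, or_false] at h2
    rw [extSign_twist, extSign_twist]
    · assumption
    all_goals simp only [List.mem_cons, List.not_mem_nil, or_false]; tauto

theorem map_flip_map_flip (e : Sym2 (Vertex X)) : (e.map Vertex.flip).map Vertex.flip = e := by
  rw [Sym2.map_map, Vertex.flip_involutive.comp_self, Sym2.map_id, id]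

theorem image_flip_image_flip (Δ : Set (Sym2 (Vertex X))) :
    Sym2.map Vertex.flip '' (Sym2.map Vertex.flip '' Δ) = Δ := by
  rw [Set.image_image]
  simp only [map_flip_map_flip, Set.image_id']

theorem image_flip_mem_weakTriangulations {Δ : Set (Sym2 (Vertex X))}
    (h : Δ ∈ weakTriangulations χ) :
    Sym2.map Vertex.flip '' Δ ∈ weakTriangulations (twist χ) := by
  have hc : ∀ {e f : Sym2 (Vertex X)}, Crossing (twist χ) (e.map Vertex.flip) f →
      Crossing χ e (f.map Vertex.flip) := by
    intro e f h
    have := h.flip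
    rwa [twist_twist, map_flip_map_flip] at this
  have hd : ∀ {e : Sym2 (Vertex X)}, (e.map Vertex.flip).IsDiag ↔ e.IsDiag := by
    intro e
    induction e with | _ p q
    simp [Vertex.flip_involutive.injective.eq_iff]
  rw [mem_weakTriangulations_iff] at h ⊢
  refine ⟨⟨?_, ?_, ?_⟩, ?_⟩
  · rintro _ ⟨e, he, rfl⟩
    exact mt hd.1 (h.1.not_isDiag e he)
  · rintro ⟨e, he, h'⟩
    have := congrArg (Sym2.map Vertex.flip) h'
    rw [map_flip_map_flip, Sym2.map_mk, Vertex.flip, Vertex.flip, Sym2.eq_swap] at this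
    exact h.1.root_anti_notMem (this ▸ he)
  · rintro _ ⟨e, he, rfl⟩ _ ⟨f, hf, rfl⟩ h'
    have := hc h'
    rw [map_flip_map_flip] at this
    exact h.1.not_crossing e he f hf this
  · intro e he hu h'
    refine ⟨e.map Vertex.flip, h.2 _ (mt hd.1 he) ?_ ?_, map_flip_map_flip e⟩
    · intro h''
      have := congrArg (Sym2.map Vertex.flip) h''
      rw [map_flip_map_flip, Sym2.map_mk, Vertex.flip, Vertex.flip, Sym2.eq_swap] at this
      exact hu this
    · intro f hf hcr
      have := hcr.flip
      rw [map_flip_map_flip] at this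
      exact h' _ ⟨f, hf, rfl⟩ this

theorem edgeDegree_image_flip (Δ : Set (Sym2 (Vertex X))) (p : Vertex X) :
    edgeDegree (Sym2.map Vertex.flip '' Δ) p = edgeDegree Δ p.flip := by
  have e : {e ∈ Sym2.map Vertex.flip '' Δ | p ∈ e} =
      Sym2.map Vertex.flip '' {e ∈ Δ | p.flip ∈ e} := by
    ext e
    constructor
    · rintro ⟨⟨e, he, rfl⟩, hp⟩
      obtain ⟨q, hq, rfl⟩ := Sym2.mem_map.1 hp
      exact ⟨e, ⟨he, by rwa [Vertex.flip_flip]⟩, rfl⟩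
    · rintro ⟨e, ⟨he, hp⟩, rfl⟩
      exact ⟨⟨e, he, rfl⟩, Sym2.mem_map.2 ⟨_, hp, p.flip_flip⟩⟩
  rw [edgeDegree, e, Set.ncard_image_of_injective _
    (Function.LeftInverse.injective map_flip_map_flip), edgeDegree]

/-- The twist exchanges the two variables. -/
theorem weakPoly_twist [Finite X] (χ : RootedSignMap X) :
    weakPoly (twist χ) = Bivariate.swap (weakPoly χ) := by
  rw [weakPoly, weakPoly, map_sum]
  refine Finset.sum_nbij' (Sym2.map Vertex.flip '' ·) (Sym2.map Vertex.flip '' ·) ?_ ?_ ?_ ?_ ?_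
  · intro Δ h
    rw [Set.Finite.mem_toFinset] at h ⊢
    have := image_flip_mem_weakTriangulations h
    rwa [twist_twist] at this
  · intro Δ h
    rw [Set.Finite.mem_toFinset] at h ⊢
    exact image_flip_mem_weakTriangulations h
  · intro Δ _
    exact image_flip_image_flip Δ
  · intro Δ _
    exact image_flip_image_flip Δ
  · intro Δ _
    rw [edgeDegree_image_flip, edgeDegree_image_flip]
    simp only [Vertex.flip, map_mul, map_pow, Bivariate.swap_X, Bivariate.swap_Y, mul_comm]

end twist

/-! ### Nested bridges and lattice paths -/

section chains

variable {α : Type u} {β : Type v} [LinearOrder α] [LinearOrder β]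

/-- A maximal chain in the product of two finite linear orders. -/
structure IsMaxChainIn (s : Finset α) (t : Finset β) (B : Finset (α × β)) : Prop where
  subset : B ⊆ s ×ˢ t
  chain : ∀ b ∈ B, ∀ c ∈ B, b ≤ c ∨ c ≤ b
  mem : ∀ c ∈ s ×ˢ t, (∀ b ∈ B, b ≤ c ∨ c ≤ b) → c ∈ B

theorem IsMaxChainIn.top_mem {s : Finset α} {t : Finset β} {B : Finset (α × β)}
    (h : IsMaxChainIn s t B) {a : α} {b : β} (ha : IsGreatest (s : Set α) a)
    (hb : IsGreatest (t : Set β) b) : (a, b) ∈ B := by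
  refine h.mem _ (Finset.mem_product.2 ⟨ha.1, hb.1⟩) fun c hc => Or.inl ?_
  have := Finset.mem_product.1 (h.subset hc)
  exact ⟨ha.2 this.1, hb.2 this.2⟩

/-- A maximal chain without its top element lies in one of the two products obtained by removing
the maximum of one factor. -/
theorem IsMaxChainIn.erase {s : Finset α} {t : Finset β} {B : Finset (α × β)}
    (h : IsMaxChainIn s t B) {a : α} {b : β} (ha : IsGreatest (s : Set α) a)
    (hb : IsGreatest (t : Set β) b) :
    IsMaxChainIn (s.erase a) t (B.erase (a, b)) ∨
      IsMaxChainIn s (t.erase b) (B.erase (a, b)) := by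
  have hle : ∀ c ∈ s ×ˢ t, c ≤ (a, b) := fun c hc =>
    ⟨ha.2 (Finset.mem_product.1 hc).1, hb.2 (Finset.mem_product.1 hc).2⟩
  have hch : ∀ c ∈ B.erase (a, b), ∀ d ∈ B.erase (a, b), c ≤ d ∨ d ≤ c := fun c hc d hd =>
    h.chain c (Finset.mem_of_mem_erase hc) d (Finset.mem_of_mem_erase hd)
  have hmem : ∀ c ∈ s ×ˢ t, c ≠ (a, b) → (∀ d ∈ B.erase (a, b), d ≤ c ∨ c ≤ d) →
      c ∈ B.erase (a, b) := by
    refine fun c hc hne hd => Finset.mem_erase.2 ⟨hne, h.mem c hc fun d hdB => ?_⟩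
    rcases eq_or_ne d (a, b) with rfl | hne'
    · exact Or.inr (hle c hc)
    · exact hd d (Finset.mem_erase.2 ⟨hne', hdB⟩)
  by_cases hq : ∃ q, (a, q) ∈ B.erase (a, b)
  · right
    obtain ⟨q, hq⟩ := hq
    refine ⟨fun c hc => ?_, hch, fun c hc hd => ?_⟩
    · have hc' := Finset.mem_product.1 (h.subset (Finset.mem_of_mem_erase hc))
      refine Finset.mem_product.2 ⟨hc'.1, Finset.mem_erase.2 ⟨fun hcb => ?_, hc'.2⟩⟩
      have hqb : q ≠ b := fun e => Finset.ne_of_mem_erase hq (by rw [e])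
      have hqt := (Finset.mem_product.1 (h.subset (Finset.mem_of_mem_erase hq))).2
      have hqlt : q < b := lt_of_le_of_ne (hb.2 hqt) hqb
      rcases hch c hc _ hq with hle' | hle'
      · exact absurd (hcb ▸ hle'.2) (not_le.2 hqlt)
      · exact Finset.ne_of_mem_erase hc (Prod.ext (le_antisymm (ha.2 hc'.1) hle'.1) hcb)
    · have hc' := Finset.mem_product.1 hc
      refine hmem c (Finset.mem_product.2 ⟨hc'.1, Finset.mem_of_mem_erase hc'.2⟩) ?_ hd
      rintro rfl
      exact Finset.ne_of_mem_erase hc'.2 rfl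
  · left
    refine ⟨fun c hc => ?_, hch, fun c hc hd => ?_⟩
    · have hc' := Finset.mem_product.1 (h.subset (Finset.mem_of_mem_erase hc))
      refine Finset.mem_product.2 ⟨Finset.mem_erase.2 ⟨fun hca => hq ⟨c.2, ?_⟩, hc'.1⟩, hc'.2⟩
      simpa only [← hca] using hc
    · have hc' := Finset.mem_product.1 hc
      refine hmem c (Finset.mem_product.2 ⟨Finset.mem_of_mem_erase hc'.1, hc'.2⟩) ?_ hd
      rintro rfl
      exact Finset.ne_of_mem_erase hc'.1 rfl

theorem IsMaxChainIn.insert_left {s : Finset α} {t : Finset β} {B : Finset (α × β)}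
    {a : α} {b : β} (ha : IsGreatest (s : Set α) a) (hb : IsGreatest (t : Set β) b)
    (hs : (s.erase a).Nonempty) (h : IsMaxChainIn (s.erase a) t B) :
    IsMaxChainIn s t (insert (a, b) B) := by
  have hsub : B ⊆ s ×ˢ t := h.subset.trans
    (Finset.product_subset_product (Finset.erase_subset _ _) subset_rfl)
  have hle : ∀ c ∈ s ×ˢ t, c ≤ (a, b) := fun c hc =>
    ⟨ha.2 (Finset.mem_product.1 hc).1, hb.2 (Finset.mem_product.1 hc).2⟩
  refine ⟨Finset.insert_subset (Finset.mem_product.2 ⟨ha.1, hb.1⟩) hsub, ?_, ?_⟩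
  · intro c hc d hd
    rcases Finset.mem_insert.1 hc with rfl | hc
    · rcases Finset.mem_insert.1 hd with rfl | hd
      exacts [Or.inl le_rfl, Or.inr (hle d (hsub hd))]
    · rcases Finset.mem_insert.1 hd with rfl | hd
      exacts [Or.inl (hle c (hsub hc)), h.chain c hc d hd]
  · intro c hc hd
    have hc' := Finset.mem_product.1 hc
    rw [Finset.mem_insert]
    by_cases hca : c.1 = a
    · left
      have htop := h.top_mem ((s.erase a).isGreatest_max' hs) hb
      have hm := Finset.mem_erase.1 ((s.erase a).max'_mem hs)
      have hlt : (s.erase a).max' hs < a := lt_of_le_of_ne (ha.2 hm.2) hm.1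
      rcases hd _ (Finset.mem_insert_of_mem htop) with h' | h'
      · exact Prod.ext hca (le_antisymm (hb.2 hc'.2) h'.2)
      · exact absurd (hca ▸ h'.1) (not_le.2 hlt)
    · right
      exact h.mem c (Finset.mem_product.2 ⟨Finset.mem_erase.2 ⟨hca, hc'.1⟩, hc'.2⟩)
        fun d hdB => hd d (Finset.mem_insert_of_mem hdB)

theorem IsMaxChainIn.insert_right {s : Finset α} {t : Finset β} {B : Finset (α × β)}
    {a : α} {b : β} (ha : IsGreatest (s : Set α) a) (hb : IsGreatest (t : Set β) b)
    (ht : (t.erase b).Nonempty) (h : IsMaxChainIn s (t.erase b) B) :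
    IsMaxChainIn s t (insert (a, b) B) := by
  have hsub : B ⊆ s ×ˢ t := h.subset.trans
    (Finset.product_subset_product subset_rfl (Finset.erase_subset _ _))
  have hle : ∀ c ∈ s ×ˢ t, c ≤ (a, b) := fun c hc =>
    ⟨ha.2 (Finset.mem_product.1 hc).1, hb.2 (Finset.mem_product.1 hc).2⟩
  refine ⟨Finset.insert_subset (Finset.mem_product.2 ⟨ha.1, hb.1⟩) hsub, ?_, ?_⟩
  · intro c hc d hd
    rcases Finset.mem_insert.1 hc with rfl | hc
    · rcases Finset.mem_insert.1 hd with rfl | hd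
      exacts [Or.inl le_rfl, Or.inr (hle d (hsub hd))]
    · rcases Finset.mem_insert.1 hd with rfl | hd
      exacts [Or.inl (hle c (hsub hc)), h.chain c hc d hd]
  · intro c hc hd
    have hc' := Finset.mem_product.1 hc
    rw [Finset.mem_insert]
    by_cases hcb : c.2 = b
    · left
      have htop := h.top_mem ha ((t.erase b).isGreatest_max' ht)
      have hm := Finset.mem_erase.1 ((t.erase b).max'_mem ht)
      have hlt : (t.erase b).max' ht < b := lt_of_le_of_ne (hb.2 hm.2) hm.1
      rcases hd _ (Finset.mem_insert_of_mem htop) with h' | h'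
      · exact Prod.ext (le_antisymm (ha.2 hc'.1) h'.1) hcb
      · exact absurd (hcb ▸ h'.2) (not_le.2 hlt)
    · right
      exact h.mem c (Finset.mem_product.2 ⟨hc'.1, Finset.mem_erase.2 ⟨hcb, hc'.2⟩⟩)
        fun d hdB => hd d (Finset.mem_insert_of_mem hdB)

open Classical in
/-- The maximal chains of `s × t`. -/
noncomputable def maxChains (s : Finset α) (t : Finset β) : Finset (Finset (α × β)) :=
  {B ∈ (s ×ˢ t).powerset | IsMaxChainIn s t B}

theorem mem_maxChains {s : Finset α} {t : Finset β} {B : Finset (α × β)} :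
    B ∈ maxChains s t ↔ IsMaxChainIn s t B := by
  simp only [maxChains, Finset.mem_filter, Finset.mem_powerset, and_iff_right_iff_imp]
  exact fun h => h.subset

theorem maxChains_of_total {s : Finset α} {t : Finset β}
    (h : ∀ c ∈ s ×ˢ t, ∀ d ∈ s ×ˢ t, c ≤ d ∨ d ≤ c) : maxChains s t = {s ×ˢ t} := by
  ext B
  rw [mem_maxChains, Finset.mem_singleton]
  constructor
  · exact fun hB => hB.subset.antisymm fun c hc => hB.mem c hc fun d hd => h d (hB.subset hd) c hc
  · rintro rfl
    exact ⟨subset_rfl, h, fun c hc _ => hc⟩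

theorem card_maxChains_rec {s : Finset α} {t : Finset β} {a : α} {b : β}
    (ha : IsGreatest (s : Set α) a) (hb : IsGreatest (t : Set β) b)
    (hs : (s.erase a).Nonempty) (ht : (t.erase b).Nonempty) :
    (maxChains s t).card = (maxChains (s.erase a) t).card + (maxChains s (t.erase b)).card := by
  have hdisj : Disjoint (maxChains (s.erase a) t) (maxChains s (t.erase b)) := by
    rw [Finset.disjoint_left]
    intro B h1 h2
    rw [mem_maxChains] at h1 h2
    have := Finset.mem_product.1 (h2.subset (h1.top_mem ((s.erase a).isGreatest_max' hs) hb))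
    exact Finset.ne_of_mem_erase this.2 rfl
  rw [← Finset.card_union_of_disjoint hdisj]
  refine Finset.card_nbij' (fun B => B.erase (a, b)) (fun B => insert (a, b) B) ?_ ?_ ?_ ?_
  · intro B hB
    simp only [Finset.coe_union, Set.mem_union, Finset.mem_coe, mem_maxChains] at hB ⊢
    exact hB.erase ha hb
  · intro B hB
    simp only [Finset.coe_union, Set.mem_union, Finset.mem_coe, mem_maxChains] at hB ⊢
    rcases hB with hB | hB
    exacts [hB.insert_left ha hb hs, hB.insert_right ha hb ht]
  · intro B hB
    rw [Finset.mem_coe, mem_maxChains] at hB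
    exact Finset.insert_erase (hB.top_mem ha hb)
  · intro B hB
    simp only [Finset.coe_union, Set.mem_union, Finset.mem_coe, mem_maxChains] at hB
    refine Finset.erase_insert fun h => ?_
    rcases hB with hB | hB
    · exact Finset.ne_of_mem_erase (Finset.mem_product.1 (hB.subset h)).1 rfl
    · exact Finset.ne_of_mem_erase (Finset.mem_product.1 (hB.subset h)).2 rfl

/-- Maximal chains are lattice paths. -/
theorem card_maxChains {s : Finset α} {t : Finset β} (hs : s.Nonempty) (ht : t.Nonempty) :
    (maxChains s t).card = (s.card + t.card - 2).choose (s.card - 1) := by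
  induction hn : s.card + t.card using Nat.strong_induction_on generalizing s t with
  | _ n ih =>
    subst hn
    have ha := s.isGreatest_max' hs
    have hb := t.isGreatest_max' ht
    have ca := Finset.card_erase_add_one (s.max'_mem hs)
    have cb := Finset.card_erase_add_one (t.max'_mem ht)
    rcases (s.erase (s.max' hs)).eq_empty_or_nonempty with hs' | hs'
    · have hc : s.card = 1 := by rw [← ca, hs', Finset.card_empty]
      obtain ⟨x, rfl⟩ := Finset.card_eq_one.1 hc
      rw [maxChains_of_total]
      · simp
      · intro c hc d hd
        simp only [Finset.mem_product, Finset.mem_singleton] at hc hd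
        rcases le_total c.2 d.2 with h | h
        exacts [Or.inl ⟨by rw [hc.1, hd.1], h⟩, Or.inr ⟨by rw [hc.1, hd.1], h⟩]
    rcases (t.erase (t.max' ht)).eq_empty_or_nonempty with ht' | ht'
    · have hc : t.card = 1 := by rw [← cb, ht', Finset.card_empty]
      obtain ⟨x, rfl⟩ := Finset.card_eq_one.1 hc
      rw [maxChains_of_total]
      · rw [Finset.card_singleton, Finset.card_singleton,
          show s.card + 1 - 2 = s.card - 1 by omega, Nat.choose_self]
      · intro c hc d hd
        simp only [Finset.mem_product, Finset.mem_singleton] at hc hd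
        rcases le_total c.1 d.1 with h | h
        exacts [Or.inl ⟨h, by rw [hc.2, hd.2]⟩, Or.inr ⟨h, by rw [hc.2, hd.2]⟩]
    have ps := hs'.card_pos
    have pt := ht'.card_pos
    rw [card_maxChains_rec ha hb hs' ht', ih _ (by omega) hs' ht rfl, ih _ (by omega) hs ht' rfl]
    obtain ⟨k, hk⟩ : ∃ k, (s.erase (s.max' hs)).card = k + 1 :=
      ⟨_, (Nat.sub_add_cancel ps).symm⟩
    obtain ⟨l, hl⟩ : ∃ l, (t.erase (t.max' ht)).card = l + 1 :=
      ⟨_, (Nat.sub_add_cancel pt).symm⟩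
    rw [← ca, ← cb, hk, hl, show k + 1 + (l + 1 + 1) - 2 = k + l + 1 by omega,
      show k + 1 + 1 + (l + 1) - 2 = k + l + 1 by omega,
      show k + 1 + 1 + (l + 1 + 1) - 2 = k + l + 1 + 1 by omega]
    simp only [Nat.add_sub_cancel]
    exact (Nat.choose_succ_succ _ _).symm

/-- A maximal family of nested bridges between `S` and `T`, both ordered outwards from `x₀`, in the
presence of the root segments of all elements that are not strictly below a bridge.  The last two
premises of `mem` say that no such root segment crosses the bridge `c`.  The premise `B.Nonempty`
says the same of the root segment of `x₀`, which crosses every bridge and is present exactly if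
there is no bridge. -/
structure IsBridging (S : Finset α) (T : Finset β) (B : Finset (α × β)) : Prop where
  subset : B ⊆ S ×ˢ T
  chain : ∀ b ∈ B, ∀ c ∈ B, b ≤ c ∨ c ≤ b
  mem : ∀ c ∈ S ×ˢ T, B.Nonempty → (∀ b ∈ B, b ≤ c ∨ c ≤ b) →
    (∀ z ∈ S, (∀ b ∈ B, b.1 ≤ z) → c.1 ≤ z) → (∀ z ∈ T, (∀ b ∈ B, b.2 ≤ z) → c.2 ≤ z) → c ∈ B

/-- An element strictly below a bridge is an endpoint of a bridge: otherwise it could be joined to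
the right endpoint of the innermost bridge above it. -/
theorem IsBridging.exists_fst_eq {S : Finset α} {T : Finset β} {B : Finset (α × β)}
    (h : IsBridging S T B) {z : α} (hz : z ∈ S) (hB : ∃ b ∈ B, z < b.1) : ∃ b ∈ B, b.1 = z := by
  by_contra! hne
  obtain ⟨b₀, hb₀, hzb₀⟩ := hB
  obtain ⟨b, hb, hmin⟩ := Finset.exists_min_image (B.filter (z < ·.1)) Prod.snd
    ⟨b₀, Finset.mem_filter.2 ⟨hb₀, hzb₀⟩⟩
  rw [Finset.mem_filter] at hb
  refine hne (z, b.2) (h.mem _ ?_ ⟨b, hb.1⟩ ?_ ?_ ?_) rfl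
  · exact Finset.mem_product.2 ⟨hz, (Finset.mem_product.1 (h.subset hb.1)).2⟩
  · intro c hc
    rcases lt_or_gt_of_ne (hne c hc) with hlt | hlt
    · left
      rcases h.chain c hc b hb.1 with h' | h'
      · exact ⟨hlt.le, h'.2⟩
      · exact absurd (h'.1.trans_lt hlt) (not_lt.2 hb.2.le)
    · exact Or.inr ⟨hlt.le, hmin c (Finset.mem_filter.2 ⟨hc, hlt⟩)⟩
  · exact fun w _ hw => hb.2.le.trans (hw b hb.1)
  · exact fun w _ hw => hw b hb.1

theorem IsBridging.exists_snd_eq {S : Finset α} {T : Finset β} {B : Finset (α × β)}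
    (h : IsBridging S T B) {z : β} (hz : z ∈ T) (hB : ∃ b ∈ B, z < b.2) : ∃ b ∈ B, b.2 = z := by
  by_contra! hne
  obtain ⟨b₀, hb₀, hzb₀⟩ := hB
  obtain ⟨b, hb, hmin⟩ := Finset.exists_min_image (B.filter (z < ·.2)) Prod.fst
    ⟨b₀, Finset.mem_filter.2 ⟨hb₀, hzb₀⟩⟩
  rw [Finset.mem_filter] at hb
  refine hne (b.1, z) (h.mem _ ?_ ⟨b, hb.1⟩ ?_ ?_ ?_) rfl
  · exact Finset.mem_product.2 ⟨(Finset.mem_product.1 (h.subset hb.1)).1, hz⟩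
  · intro c hc
    rcases lt_or_gt_of_ne (hne c hc) with hlt | hlt
    · left
      rcases h.chain c hc b hb.1 with h' | h'
      · exact ⟨h'.1, hlt.le⟩
      · exact absurd (h'.2.trans_lt hlt) (not_lt.2 hb.2.le)
    · exact Or.inr ⟨hmin c (Finset.mem_filter.2 ⟨hc, hlt⟩), hlt.le⟩
  · exact fun w _ hw => hw b hb.1
  · exact fun w _ hw => hb.2.le.trans (hw b hb.1)

theorem isBridging_empty (S : Finset α) (T : Finset β) : IsBridging S T ∅ :=
  ⟨by simp, by simp, fun _ _ h => absurd h (by simp)⟩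

/-- A bridging with outermost bridge `c` is a maximal chain of the elements inside `c`. -/
theorem isBridging_and_nonempty_iff {S : Finset α} {T : Finset β} {B : Finset (α × β)} :
    IsBridging S T B ∧ B.Nonempty ↔
      ∃ c ∈ S ×ˢ T, IsMaxChainIn (S.filter (· ≤ c.1)) (T.filter (· ≤ c.2)) B := by
  constructor
  · rintro ⟨h, hne⟩
    obtain ⟨c, hc, hmax⟩ := B.exists_maximal hne
    have htop : ∀ b ∈ B, b ≤ c := fun b hb => (h.chain b hb c hc).elim id fun h' => hmax hb h'
    refine ⟨c, h.subset hc, fun b hb => ?_, h.chain, fun d hd hcomp => ?_⟩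
    · have := Finset.mem_product.1 (h.subset hb)
      exact Finset.mem_product.2 ⟨Finset.mem_filter.2 ⟨this.1, (htop b hb).1⟩,
        Finset.mem_filter.2 ⟨this.2, (htop b hb).2⟩⟩
    · simp only [Finset.mem_product, Finset.mem_filter] at hd
      exact h.mem d (Finset.mem_product.2 ⟨hd.1.1, hd.2.1⟩) hne hcomp
        (fun z _ hz => hd.1.2.trans (hz c hc)) (fun z _ hz => hd.2.2.trans (hz c hc))
  · rintro ⟨c, hc, h⟩
    have hc' := Finset.mem_product.1 hc
    have hle : ∀ b ∈ B, b ≤ c := fun b hb => by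
      have := h.subset hb
      simp only [Finset.mem_product, Finset.mem_filter] at this
      exact ⟨this.1.2, this.2.2⟩
    have hcB : c ∈ B := by
      refine h.mem c ?_ fun b hb => Or.inl (hle b hb)
      simpa only [Finset.mem_product, Finset.mem_filter, le_refl, and_true] using hc'
    refine ⟨⟨fun b hb => ?_, h.chain, fun d hd _ hcomp h1 h2 => h.mem d ?_ hcomp⟩, c, hcB⟩
    · have := h.subset hb
      simp only [Finset.mem_product, Finset.mem_filter] at this
      exact Finset.mem_product.2 ⟨this.1.1, this.2.1⟩
    · have hd' := Finset.mem_product.1 hd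
      exact Finset.mem_product.2
        ⟨Finset.mem_filter.2 ⟨hd'.1, h1 c.1 hc'.1 fun b hb => (hle b hb).1⟩,
          Finset.mem_filter.2 ⟨hd'.2, h2 c.2 hc'.2 fun b hb => (hle b hb).2⟩⟩

/-- The elements `p` of a finite linear order are enumerated by the number of elements `≥ p`. -/
theorem sum_card_filter_le {M : Type*} [AddCommMonoid M] (S : Finset α) (F : ℕ → M) :
    ∑ p ∈ S, F (S.filter (p ≤ ·)).card = ∑ i ∈ Finset.Icc 1 S.card, F i := by
  induction S using Finset.induction_on_min with
  | empty => simp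
  | insert a S ha ih =>
    have hS : a ∉ S := fun h => lt_irrefl a (ha a h)
    rw [Finset.sum_insert hS, Finset.card_insert_of_notMem hS, Finset.sum_Icc_succ_top (by omega),
      ← ih, add_comm]
    congr 1
    · refine Finset.sum_congr rfl fun p hp => ?_
      rw [Finset.filter_insert, if_neg (not_le.2 (ha p hp))]
    · rw [Finset.filter_true_of_mem, Finset.card_insert_of_notMem hS]
      intro x hx
      rcases Finset.mem_insert.1 hx with rfl | hx
      exacts [le_rfl, (ha x hx).le]

theorem card_filter_le_add {S : Finset α} {p : α} (hp : p ∈ S) :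
    (S.filter (· ≤ p)).card + (S.filter (p ≤ ·)).card = S.card + 1 := by
  rw [← Finset.card_union_add_card_inter, ← Finset.filter_or, ← Finset.filter_and]
  congr 1
  · rw [Finset.filter_true_of_mem fun x _ => le_total x p]
  · rw [Finset.card_eq_one]
    refine ⟨p, ?_⟩
    ext x
    simp only [Finset.mem_filter, Finset.mem_singleton]
    exact ⟨fun h => le_antisymm h.2.1 h.2.2, by rintro rfl; exact ⟨hp, le_rfl, le_rfl⟩⟩

open Classical in
/-- The number of root segments compatible with a set of bridges, where `S` and `T` are the
candidates on both sides other than `x₀`. -/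
noncomputable def bridgingDegree (S : Finset α) (T : Finset β) (B : Finset (α × β)) : ℕ :=
  {z ∈ S | ∀ b ∈ B, b.1 ≤ z}.card + {z ∈ T | ∀ b ∈ B, b.2 ≤ z}.card + if B = ∅ then 1 else 0

theorem bridgingDegree_of_isMaxChainIn {S : Finset α} {T : Finset β} {B : Finset (α × β)}
    {c : α × β} (hc : c ∈ S ×ˢ T)
    (h : IsMaxChainIn (S.filter (· ≤ c.1)) (T.filter (· ≤ c.2)) B) :
    bridgingDegree S T B = (S.filter (c.1 ≤ ·)).card + (T.filter (c.2 ≤ ·)).card := by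
  have hc' := Finset.mem_product.1 hc
  have hle : ∀ b ∈ B, b ≤ c := fun b hb => by
    have := h.subset hb
    simp only [Finset.mem_product, Finset.mem_filter] at this
    exact ⟨this.1.2, this.2.2⟩
  have hcB : c ∈ B := by
    refine h.mem c ?_ fun b hb => Or.inl (hle b hb)
    simpa only [Finset.mem_product, Finset.mem_filter, le_refl, and_true] using hc'
  rw [bridgingDegree, if_neg (Finset.ne_empty_of_mem hcB), add_zero]
  congr 2
  · exact Finset.filter_congr fun z _ =>
      ⟨fun hz => hz c hcB, fun hz b hb => (hle b hb).1.trans hz⟩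
  · exact Finset.filter_congr fun z _ =>
      ⟨fun hz => hz c hcB, fun hz b hb => (hle b hb).2.trans hz⟩

open Classical in
/-- The kernel `N` counts bridgings by the number of their root segments. -/
theorem sum_bridgings (R : Type*) [CommRing R] (S : Finset α) (T : Finset β) :
    ∑ B ∈ (S ×ˢ T).powerset with IsBridging S T B,
      (Polynomial.X : R[X]) ^ bridgingDegree S T B = joinKernel R (S.card + 1) (T.card + 1) := by
  have hsplit : {B ∈ (S ×ˢ T).powerset | IsBridging S T B} =
      insert ∅ ((S ×ˢ T).biUnion fun c =>
        maxChains (S.filter (· ≤ c.1)) (T.filter (· ≤ c.2))) := by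
    ext B
    simp only [Finset.mem_filter, Finset.mem_powerset, Finset.mem_insert, Finset.mem_biUnion,
      mem_maxChains]
    rw [← isBridging_and_nonempty_iff]
    constructor
    · rintro ⟨-, h⟩
      rcases B.eq_empty_or_nonempty with rfl | hne
      exacts [Or.inl rfl, Or.inr ⟨h, hne⟩]
    · rintro (rfl | h)
      exacts [⟨by simp, isBridging_empty S T⟩, ⟨h.1.subset, h.1⟩]
  have hempty : ∅ ∉ (S ×ˢ T).biUnion fun c =>
      maxChains (S.filter (· ≤ c.1)) (T.filter (· ≤ c.2)) := by
    simp only [Finset.mem_biUnion, mem_maxChains]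
    rw [← isBridging_and_nonempty_iff]
    simp
  have hgr : ∀ c ∈ S ×ˢ T, IsGreatest (↑(S.filter (· ≤ c.1)) : Set α) c.1 ∧
      IsGreatest (↑(T.filter (· ≤ c.2)) : Set β) c.2 := by
    intro c hc
    have hc' := Finset.mem_product.1 hc
    refine ⟨⟨by simpa using hc'.1, ?_⟩, ⟨by simpa using hc'.2, ?_⟩⟩ <;>
      exact fun x hx => (Finset.mem_filter.1 (Finset.mem_coe.1 hx)).2
  have hdisj : ((S ×ˢ T : Finset (α × β)) : Set (α × β)).PairwiseDisjoint fun c =>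
      maxChains (S.filter (· ≤ c.1)) (T.filter (· ≤ c.2)) := by
    intro c hc d hd hne
    rw [Function.onFun, Finset.disjoint_left]
    intro B h1 h2
    rw [mem_maxChains] at h1 h2
    have c1 := h2.subset (h1.top_mem (hgr c hc).1 (hgr c hc).2)
    have d1 := h1.subset (h2.top_mem (hgr d hd).1 (hgr d hd).2)
    simp only [Finset.mem_product, Finset.mem_filter] at c1 d1
    exact hne (Prod.ext (le_antisymm c1.1.2 d1.1.2) (le_antisymm c1.2.2 d1.2.2))
  rw [hsplit, Finset.sum_insert hempty, Finset.sum_biUnion hdisj, joinKernel]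
  congr 1
  · simp only [bridgingDegree, Finset.notMem_empty, false_imp_iff, implies_true,
      Finset.filter_true, if_true]
    congr 1
    omega
  · have hterm : ∀ c ∈ S ×ˢ T, ∑ B ∈ maxChains (S.filter (· ≤ c.1)) (T.filter (· ≤ c.2)),
        (Polynomial.X : R[X]) ^ bridgingDegree S T B =
        (((S.card + 1 - (S.filter (c.1 ≤ ·)).card) + (T.card + 1 - (T.filter (c.2 ≤ ·)).card)
          - 2).choose (S.card + 1 - (S.filter (c.1 ≤ ·)).card - 1) : R[X]) *
          Polynomial.X ^ ((S.filter (c.1 ≤ ·)).card + (T.filter (c.2 ≤ ·)).card) := by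
      intro c hc
      have hc' := Finset.mem_product.1 hc
      rw [Finset.sum_congr rfl fun B hB => by
        rw [bridgingDegree_of_isMaxChainIn hc (mem_maxChains.1 hB)], Finset.sum_const,
        card_maxChains ⟨_, (hgr c hc).1.1⟩ ⟨_, (hgr c hc).2.1⟩, nsmul_eq_mul,
        Nat.eq_sub_of_add_eq (card_filter_le_add hc'.1),
        Nat.eq_sub_of_add_eq (card_filter_le_add hc'.2)]
    rw [Finset.sum_congr rfl hterm, Finset.sum_product]
    simp only [Nat.add_sub_cancel]
    rw [← sum_card_filter_le S fun i₁ => ∑ i₂ ∈ Finset.Icc 1 T.card,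
      (((S.card + 1 - i₁) + (T.card + 1 - i₂) - 2).choose (S.card + 1 - i₁ - 1) : R[X]) *
        Polynomial.X ^ (i₁ + i₂)]
    refine Finset.sum_congr rfl fun p _ => ?_
    rw [← sum_card_filter_le T]

end chains

/-! ### Extreme elements -/

section extreme

variable {X : Type u} {χ : RootedSignMap X}

open Classical in
/-- The linear order of the elements around the root. -/
noncomputable abbrev IsRootOrdered.linearOrder (h : IsRootOrdered χ) : LinearOrder X where
  le a b := a = b ∨ χ none (some a) (some b) = 1
  le_refl a := Or.inl rfl
  le_trans a b c := by
    rintro (rfl | hab) (rfl | hbc)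
    · exact Or.inl rfl
    · exact Or.inr hbc
    · exact Or.inr hab
    · by_cases h1 : a = b
      · exact Or.inr (h1 ▸ hbc)
      by_cases h2 : b = c
      · exact Or.inr (h2 ▸ hab)
      by_cases h3 : a = c
      · exact Or.inl h3
      exact Or.inr (h.trans h1 h3 h2 hab hbc)
  le_antisymm a b := by
    rintro (rfl | hab) (h' | hba)
    · rfl
    · rfl
    · exact h'.symm
    · by_contra hne
      rw [h.sign.none_swap hne, hba] at hab
      exact int_units_neg_ne 1 hab
  le_total a b := by
    by_cases hne : a = b
    · exact Or.inl (Or.inl hne)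
    · exact (h.sign.total hne).imp Or.inr Or.inr
  toDecidableLE := Classical.decRel _

/-- If `y` is extreme for the root, no segment crosses `u y` or `v y`. -/
theorem not_crossing_of_extreme (h : IsSignFunction χ) {y : X} {ε : ℤˣ}
    (hε : ∀ z, z ≠ y → χ none (some y) (some z) = ε) (f : Sym2 (Vertex X)) :
    ¬ Crossing χ s(.root, .pt y) f ∧ ¬ Crossing χ s(.anti, .pt y) f := by
  induction f with | _ r s
  rcases r with r | _ | _ <;> rcases s with s | _ | _ <;> constructor <;> rw [crossing_mk h] <;>
    rintro ⟨hn, h', -⟩ <;> simp [Vertex.fold] at hn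
  · rw [extSign_root_pt, extSign_root_pt, hε r (Ne.symm hn.1.1), hε s (Ne.symm hn.1.2)] at h'
    exact h' rfl
  · rw [extSign_anti_pt, extSign_anti_pt, hε r (Ne.symm hn.1.1), hε s (Ne.symm hn.1.2)] at h'
    exact h' rfl

theorem not_crossing_hullSucc [Finite X] [Nonempty X] (h : IsRootOrdered χ)
    (f : Sym2 (Vertex X)) :
    ¬ Crossing χ s(.root, .pt (hullSucc χ)) f ∧ ¬ Crossing χ s(.anti, .pt (hullSucc χ)) f :=
  not_crossing_of_extreme h.sign (fun _ hz => h.none_hullSucc hz) f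

theorem not_crossing_hullPred [Finite X] [Nonempty X] (h : IsRootOrdered χ)
    (f : Sym2 (Vertex X)) :
    ¬ Crossing χ s(.root, .pt (hullPred χ)) f ∧ ¬ Crossing χ s(.anti, .pt (hullPred χ)) f :=
  not_crossing_of_extreme (ε := -1) h.sign (fun _ hz => by
    rw [h.sign.none_swap (Ne.symm hz), h.none_hullPred hz]) f

theorem hullSucc_mem_rootVisible [Finite X] [Nonempty X] (h : IsRootOrdered χ)
    (A : Set (Sym2 (Vertex X))) : hullSucc χ ∈ rootVisible χ A :=
  fun f _ => (not_crossing_hullSucc h f).1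

theorem hullPred_mem_rootVisible [Finite X] [Nonempty X] (h : IsRootOrdered χ)
    (A : Set (Sym2 (Vertex X))) : hullPred χ ∈ rootVisible χ A :=
  fun f _ => (not_crossing_hullPred h f).1

theorem hullSucc_ne_hullPred [Finite X] [Nontrivial X] (h : IsRootOrdered χ) :
    hullSucc χ ≠ hullPred χ := by
  intro he
  obtain ⟨z, hz⟩ := exists_ne (hullSucc χ)
  have h1 := h.none_hullSucc hz
  rw [h.sign.none_swap hz.symm, he, h.none_hullPred (he ▸ hz)] at h1
  exact int_units_neg_ne 1 h1

theorem two_le_ncard_rootVisible [Finite X] [Nontrivial X] (h : IsRootOrdered χ)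
    (A : Set (Sym2 (Vertex X))) : 2 ≤ (rootVisible χ A).ncard :=
  (Set.one_lt_ncard (Set.toFinite _)).2 ⟨_, hullSucc_mem_rootVisible h A, _,
    hullPred_mem_rootVisible h A, hullSucc_ne_hullPred h⟩

theorem IsCore.anti_hullSucc_mem [Finite X] [Nonempty X] (h : IsRootOrdered χ)
    {A : Set (Sym2 (Vertex X))} (hA : IsCore χ A) : s(.anti, .pt (hullSucc χ)) ∈ A :=
  hA.mem _ (by simp) (by simp) (fun f _ => (not_crossing_hullSucc h f).2)
    fun _ _ h' => (not_crossing_hullSucc h _).2 h'.symm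

theorem IsCore.anti_hullPred_mem [Finite X] [Nonempty X] (h : IsRootOrdered χ)
    {A : Set (Sym2 (Vertex X))} (hA : IsCore χ A) : s(.anti, .pt (hullPred χ)) ∈ A :=
  hA.mem _ (by simp) (by simp) (fun f _ => (not_crossing_hullPred h f).2)
    fun _ _ h' => (not_crossing_hullPred h _).2 h'.symm

end extreme

/-! ### Decomposing and gluing sets of segments -/

section parts

variable {X₁ : Type u} {X₂ : Type v} [Nonempty X₁] [Nonempty X₂]
  {χ₁ : RootedSignMap X₁} {χ₂ : RootedSignMap X₂}

theorem root_mem_map_inl {e : Sym2 (Vertex X₁)} :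
    .root ∈ e.map (Vertex.inl χ₂) ↔ .root ∈ e := by
  have : Vertex.root = Vertex.inl (X₁ := X₁) χ₂ .root := rfl
  rw [this, Sym2.mem_map]
  exact ⟨fun ⟨a, ha, h⟩ => Vertex.inl_injective h ▸ ha, fun h => ⟨_, h, rfl⟩⟩

theorem root_mem_map_inr {e : Sym2 (Vertex X₂)} :
    .root ∈ e.map (Vertex.inr χ₁ χ₂) ↔ .root ∈ e := by
  have : Vertex.root = Vertex.inr χ₁ χ₂ .root := rfl
  rw [this, Sym2.mem_map]
  exact ⟨fun ⟨a, ha, h⟩ => Vertex.inr_injective h ▸ ha, fun h => ⟨_, h, rfl⟩⟩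

theorem anti_mem_map_inl {e : Sym2 (Vertex X₁)} :
    .anti ∈ e.map (Vertex.inl χ₂) ↔ .anti ∈ e := by
  have : Vertex.anti = Vertex.inl (X₁ := X₁) χ₂ .anti := rfl
  rw [this, Sym2.mem_map]
  exact ⟨fun ⟨a, ha, h⟩ => Vertex.inl_injective h ▸ ha, fun h => ⟨_, h, rfl⟩⟩

theorem anti_mem_map_inr {e : Sym2 (Vertex X₂)} :
    .anti ∈ e.map (Vertex.inr χ₁ χ₂) ↔ .anti ∈ e := by
  have : Vertex.anti = Vertex.inr χ₁ χ₂ .anti := rfl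
  rw [this, Sym2.mem_map]
  exact ⟨fun ⟨a, ha, h⟩ => Vertex.inr_injective h ▸ ha, fun h => ⟨_, h, rfl⟩⟩

/-- A segment of the join that avoids the root lies on one of the two sides or is a bridge. -/
theorem segment_cases {e : Sym2 (Vertex (JoinSet X₁ χ₂))} (hd : ¬ e.IsDiag) (hr : .root ∉ e) :
    (∃ e₁ : Sym2 (Vertex X₁), ¬ e₁.IsDiag ∧ .root ∉ e₁ ∧ e = e₁.map (Vertex.inl χ₂)) ∨
    (∃ e₂ : Sym2 (Vertex X₂), ¬ e₂.IsDiag ∧ .root ∉ e₂ ∧ e = e₂.map (Vertex.inr χ₁ χ₂)) ∨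
    ∃ x y, x ≠ hullPred χ₁ ∧ y ≠ hullSucc χ₂ ∧ e = bridge χ₁ χ₂ x y := by
  have L : ∀ p q : Vertex X₁, e = s(p.inl χ₂, q.inl χ₂) →
      ∃ e₁ : Sym2 (Vertex X₁), ¬ e₁.IsDiag ∧ .root ∉ e₁ ∧ e = e₁.map (Vertex.inl χ₂) := by
    rintro p q rfl
    exact ⟨s(p, q), mt (Sym2.isDiag_map Vertex.inl_injective).2 hd,
      mt root_mem_map_inl.2 hr, rfl⟩
  have R : ∀ p q : Vertex X₂, e = s(p.inr χ₁ χ₂, q.inr χ₁ χ₂) →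
      ∃ e₂ : Sym2 (Vertex X₂), ¬ e₂.IsDiag ∧ .root ∉ e₂ ∧ e = e₂.map (Vertex.inr χ₁ χ₂) := by
    rintro p q rfl
    exact ⟨s(p, q), mt (Sym2.isDiag_map Vertex.inr_injective).2 hd,
      mt root_mem_map_inr.2 hr, rfl⟩
  have hpt : ∀ y : {y : X₂ // y ≠ hullSucc χ₂},
      Vertex.pt (Sum.inr y) = Vertex.inr χ₁ χ₂ (.pt y.1) := fun y => by
    rw [Vertex.inr, joinInr_of_ne y.2]
  have hx₀ : Vertex.pt (Sum.inl (hullPred χ₁)) = Vertex.inr χ₁ χ₂ (.pt (hullSucc χ₂)) := by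
    rw [Vertex.inr, joinInr_hullSucc]
  have M : ∀ (x : X₁) (y : {y : X₂ // y ≠ hullSucc χ₂}),
      e = s(.pt (Sum.inl x), .pt (Sum.inr y)) →
      (∃ e₂ : Sym2 (Vertex X₂), ¬ e₂.IsDiag ∧ .root ∉ e₂ ∧ e = e₂.map (Vertex.inr χ₁ χ₂)) ∨
      ∃ x y, x ≠ hullPred χ₁ ∧ y ≠ hullSucc χ₂ ∧ e = bridge χ₁ χ₂ x y := by
    intro x y he
    by_cases hx : x = hullPred χ₁
    · exact Or.inl (R (.pt (hullSucc χ₂)) (.pt y.1) (by rw [he, hpt, hx, hx₀]))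
    · exact Or.inr ⟨x, y.1, hx, y.2, by rw [he, hpt]; rfl⟩
  induction e with | _ p q
  rcases p with (x | y) | _ | _ <;> rcases q with (x' | y') | _ | _
  · exact Or.inl (L (.pt x) (.pt x') rfl)
  · exact Or.inr (M x y' rfl)
  · simp at hr
  · exact Or.inl (L (.pt x) .anti rfl)
  · exact Or.inr (M x' y Sym2.eq_swap)
  · exact Or.inr (Or.inl (R (.pt y.1) (.pt y'.1) (by rw [hpt, hpt])))
  · simp at hr
  · exact Or.inr (Or.inl (R (.pt y.1) .anti (by rw [hpt]; rfl)))
  · simp at hr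
  · simp at hr
  · simp at hr
  · simp at hr
  · exact Or.inl (L .anti (.pt x') rfl)
  · exact Or.inr (Or.inl (R .anti (.pt y'.1) (by rw [hpt]; rfl)))
  · simp at hr
  · simp at hd

/-- The only segment common to both sides is `v x₀`. -/
theorem eq_of_map_inl_eq_map_inr {e : Sym2 (Vertex X₁)} {f : Sym2 (Vertex X₂)}
    (hd : ¬ e.IsDiag) (hr : .root ∉ e)
    (h : e.map (Vertex.inl χ₂) = f.map (Vertex.inr χ₁ χ₂)) :
    e = s(.anti, .pt (hullPred χ₁)) ∧ f = s(.anti, .pt (hullSucc χ₂)) := by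
  have key : ∀ (p : Vertex X₁) (r : Vertex X₂), p ≠ .root → p.inl χ₂ = r.inr χ₁ χ₂ →
      (p = .anti ∧ r = .anti) ∨ (p = .pt (hullPred χ₁) ∧ r = .pt (hullSucc χ₂)) := by
    rintro (p | _ | _) (r | _ | _) hp h <;> simp [Vertex.inl, Vertex.inr, inl_eq_joinInr] at hp h ⊢
    exact h
  induction e with | _ p q
  induction f with | _ r s
  simp only [Sym2.mem_iff, not_or] at hr
  have hpq : p ≠ q := by simpa using hd
  rw [Sym2.map_mk, Sym2.map_mk, Sym2.eq_iff] at h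
  rcases h with ⟨h1, h2⟩ | ⟨h1, h2⟩ <;>
    rcases key _ _ (Ne.symm hr.1) h1 with ⟨rfl, rfl⟩ | ⟨rfl, rfl⟩ <;>
    rcases key _ _ (Ne.symm hr.2) h2 with ⟨rfl, rfl⟩ | ⟨rfl, rfl⟩ <;> simp at hpq ⊢

theorem map_inl_anti_hullPred :
    (s(.anti, .pt (hullPred χ₁)) : Sym2 (Vertex X₁)).map (Vertex.inl χ₂) =
      (s(.anti, .pt (hullSucc χ₂)) : Sym2 (Vertex X₂)).map (Vertex.inr χ₁ χ₂) := by
  simp only [Sym2.map_mk, Vertex.inl, Vertex.inr, joinInr_hullSucc]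

theorem map_inl_ne_bridge {e : Sym2 (Vertex X₁)} {x : X₁} {y : X₂} (hy : y ≠ hullSucc χ₂) :
    e.map (Vertex.inl χ₂) ≠ bridge χ₁ χ₂ x y := by
  intro h
  have : .pt (joinInr χ₁ χ₂ y) ∈ e.map (Vertex.inl χ₂) := by rw [h]; simp [bridge]
  obtain ⟨p, -, hp⟩ := Sym2.mem_map.1 this
  rcases p with p | _ | _ <;> simp [Vertex.inl, joinInr_of_ne hy] at hp

theorem map_inr_ne_bridge {e : Sym2 (Vertex X₂)} {x : X₁} {y : X₂} (hx : x ≠ hullPred χ₁) :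
    e.map (Vertex.inr χ₁ χ₂) ≠ bridge χ₁ χ₂ x y := by
  intro h
  have : .pt (Sum.inl x) ∈ e.map (Vertex.inr χ₁ χ₂) := by rw [h]; simp [bridge]
  obtain ⟨p, -, hp⟩ := Sym2.mem_map.1 this
  rcases p with p | _ | _ <;> simp only [Vertex.inr, Vertex.pt.injEq, reduceCtorEq] at hp
  exact hx (inl_eq_joinInr.1 hp.symm).1

theorem bridge_injective {x x' : X₁} {y y' : X₂} (hx : x ≠ hullPred χ₁)
    (h : bridge χ₁ χ₂ x y = bridge χ₁ χ₂ x' y') : x = x' ∧ y = y' := by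
  rw [bridge, bridge, Sym2.eq_iff] at h
  rcases h with ⟨h1, h2⟩ | ⟨h1, -⟩
  · exact ⟨by simpa using h1, joinInr_injective (by simpa using h2)⟩
  · simp only [Vertex.pt.injEq] at h1
    exact absurd (inl_eq_joinInr.1 h1).1 hx

/-- The segments on the left side. -/
def leftPart (A : Set (Sym2 (Vertex (JoinSet X₁ χ₂)))) : Set (Sym2 (Vertex X₁)) :=
  Sym2.map (Vertex.inl χ₂) ⁻¹' A

/-- The segments on the right side. -/
def rightPart (χ₁ : RootedSignMap X₁) (A : Set (Sym2 (Vertex (JoinSet X₁ χ₂)))) :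
    Set (Sym2 (Vertex X₂)) :=
  Sym2.map (Vertex.inr χ₁ χ₂) ⁻¹' A

/-- The pairs of endpoints of the bridges. -/
noncomputable def bridgePart [Finite X₁] [Finite X₂] (χ₁ : RootedSignMap X₁)
    (A : Set (Sym2 (Vertex (JoinSet X₁ χ₂)))) : Finset (X₁ × X₂) :=
  (Set.toFinite {c : X₁ × X₂ | c.1 ≠ hullPred χ₁ ∧ c.2 ≠ hullSucc χ₂ ∧
    bridge χ₁ χ₂ c.1 c.2 ∈ A}).toFinset

theorem mem_bridgePart [Finite X₁] [Finite X₂] {A : Set (Sym2 (Vertex (JoinSet X₁ χ₂)))}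
    {c : X₁ × X₂} : c ∈ bridgePart χ₁ A ↔ c.1 ≠ hullPred χ₁ ∧ c.2 ≠ hullSucc χ₂ ∧
      bridge χ₁ χ₂ c.1 c.2 ∈ A := by
  simp [bridgePart]

/-- The set of segments with prescribed sides and bridges. -/
def glue (χ₁ : RootedSignMap X₁) (χ₂ : RootedSignMap X₂) (A₁ : Set (Sym2 (Vertex X₁)))
    (A₂ : Set (Sym2 (Vertex X₂))) (B : Finset (X₁ × X₂)) :
    Set (Sym2 (Vertex (JoinSet X₁ χ₂))) :=
  Sym2.map (Vertex.inl χ₂) '' A₁ ∪ Sym2.map (Vertex.inr χ₁ χ₂) '' A₂ ∪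
    (fun c : X₁ × X₂ => bridge χ₁ χ₂ c.1 c.2) '' B

theorem glue_parts [Finite X₁] [Finite X₂] {A : Set (Sym2 (Vertex (JoinSet X₁ χ₂)))}
    (hd : ∀ e ∈ A, ¬ e.IsDiag) (hr : ∀ e ∈ A, .root ∉ e) :
    glue χ₁ χ₂ (leftPart A) (rightPart χ₁ A) (bridgePart χ₁ A) = A := by
  ext e
  constructor
  · rintro ((⟨f, hf, rfl⟩ | ⟨f, hf, rfl⟩) | ⟨c, hc, rfl⟩)
    exacts [hf, hf, (mem_bridgePart.1 hc).2.2]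
  · intro he
    rcases segment_cases (χ₁ := χ₁) (hd e he) (hr e he) with
      ⟨f, -, -, rfl⟩ | ⟨f, -, -, rfl⟩ | ⟨x, y, hx, hy, rfl⟩
    exacts [Or.inl (Or.inl ⟨f, he, rfl⟩), Or.inl (Or.inr ⟨f, he, rfl⟩),
      Or.inr ⟨(x, y), mem_bridgePart.2 ⟨hx, hy, he⟩, rfl⟩]

end parts

/-! ### Cores of the join -/

section correspondence

variable {X₁ : Type u} {X₂ : Type v} [Nonempty X₁] [Nonempty X₂] [Finite X₁] [Finite X₂]
  {χ₁ : RootedSignMap X₁} {χ₂ : RootedSignMap X₂}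

/-- The possible endpoints of bridges on one side: the elements other than `x₀` that see the
root. -/
noncomputable def bridgeEnds {X : Type u} [Finite X] (χ : RootedSignMap X) (x₀ : X)
    (A : Set (Sym2 (Vertex X))) : Finset X :=
  (Set.toFinite (rootVisible χ A \ {x₀})).toFinset

theorem mem_bridgeEnds {X : Type u} [Finite X] {χ : RootedSignMap X} {x₀ x : X}
    {A : Set (Sym2 (Vertex X))} : x ∈ bridgeEnds χ x₀ A ↔ x ∈ rootVisible χ A ∧ x ≠ x₀ := by
  simp [bridgeEnds]

theorem card_bridgeEnds {X : Type u} [Finite X] {χ : RootedSignMap X} {x₀ : X}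
    {A : Set (Sym2 (Vertex X))} (h : x₀ ∈ rootVisible χ A) :
    (bridgeEnds χ x₀ A).card + 1 = (rootVisible χ A).ncard := by
  rw [bridgeEnds, ← Set.ncard_eq_toFinset_card]
  exact Set.ncard_sdiff_singleton_add_one h

theorem leftPart_glue (h₁ : IsRootOrdered χ₁) {A₁ : Set (Sym2 (Vertex X₁))}
    {A₂ : Set (Sym2 (Vertex X₂))} {B : Finset (X₁ × X₂)} (hA₁ : IsCore χ₁ A₁)
    (hA₂ : IsCore χ₂ A₂) (hB : ∀ c ∈ B, c.2 ≠ hullSucc χ₂) :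
    leftPart (glue χ₁ χ₂ A₁ A₂ B) = A₁ := by
  ext e
  constructor
  · rintro ((⟨f, hf, h⟩ | ⟨f, hf, h⟩) | ⟨c, hc, h⟩)
    · rwa [← Sym2.map.injective Vertex.inl_injective h]
    · have hd := hA₂.not_isDiag f hf
      rw [← Sym2.isDiag_map (Vertex.inr_injective (χ₁ := χ₁) (χ₂ := χ₂)), h,
        Sym2.isDiag_map Vertex.inl_injective] at hd
      have hr := hA₂.root_notMem f hf
      rw [← root_mem_map_inr (χ₁ := χ₁) (χ₂ := χ₂), h, root_mem_map_inl] at hr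
      rw [(eq_of_map_inl_eq_map_inr hd hr h.symm).1]
      exact hA₁.anti_hullPred_mem h₁
    · exact absurd h.symm (map_inl_ne_bridge (hB c hc))
  · exact fun he => Or.inl (Or.inl ⟨e, he, rfl⟩)

theorem rightPart_glue (h₂ : IsRootOrdered χ₂) {A₁ : Set (Sym2 (Vertex X₁))}
    {A₂ : Set (Sym2 (Vertex X₂))} {B : Finset (X₁ × X₂)} (hA₁ : IsCore χ₁ A₁)
    (hA₂ : IsCore χ₂ A₂) (hB : ∀ c ∈ B, c.1 ≠ hullPred χ₁) :
    rightPart χ₁ (glue χ₁ χ₂ A₁ A₂ B) = A₂ := by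
  ext e
  constructor
  · rintro ((⟨f, hf, h⟩ | ⟨f, hf, h⟩) | ⟨c, hc, h⟩)
    · rw [(eq_of_map_inl_eq_map_inr (hA₁.not_isDiag f hf) (hA₁.root_notMem f hf) h).2]
      exact hA₂.anti_hullSucc_mem h₂
    · rwa [← Sym2.map.injective Vertex.inr_injective h]
    · exact absurd h.symm (map_inr_ne_bridge (hB c hc))
  · exact fun he => Or.inl (Or.inr ⟨e, he, rfl⟩)

theorem bridgePart_glue {A₁ : Set (Sym2 (Vertex X₁))} {A₂ : Set (Sym2 (Vertex X₂))}
    {B : Finset (X₁ × X₂)} (hB₁ : ∀ c ∈ B, c.1 ≠ hullPred χ₁)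
    (hB₂ : ∀ c ∈ B, c.2 ≠ hullSucc χ₂) : bridgePart χ₁ (glue χ₁ χ₂ A₁ A₂ B) = B := by
  ext c
  rw [mem_bridgePart]
  constructor
  · rintro ⟨hx, hy, (⟨f, hf, h⟩ | ⟨f, hf, h⟩) | ⟨d, hd, h⟩⟩
    · exact absurd h (map_inl_ne_bridge hy)
    · exact absurd h (map_inr_ne_bridge hx)
    · obtain ⟨e1, e2⟩ := bridge_injective (hB₁ d hd) h
      rwa [← Prod.ext e1 e2]
  · exact fun hc => ⟨hB₁ c hc, hB₂ c hc, Or.inr ⟨c, hc, rfl⟩⟩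

/-- The segment `v x₀` is counted on both sides. -/
theorem edgeDegree_glue_anti (h₁ : IsRootOrdered χ₁) (h₂ : IsRootOrdered χ₂)
    {A₁ : Set (Sym2 (Vertex X₁))} {A₂ : Set (Sym2 (Vertex X₂))} {B : Finset (X₁ × X₂)}
    (hA₁ : IsCore χ₁ A₁) (hA₂ : IsCore χ₂ A₂) :
    edgeDegree (glue χ₁ χ₂ A₁ A₂ B) .anti + 1 = edgeDegree A₁ .anti + edgeDegree A₂ .anti := by
  have e : {e ∈ glue χ₁ χ₂ A₁ A₂ B | .anti ∈ e} =
      Sym2.map (Vertex.inl χ₂) '' {e ∈ A₁ | .anti ∈ e} ∪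
        Sym2.map (Vertex.inr χ₁ χ₂) '' {e ∈ A₂ | .anti ∈ e} := by
    ext e
    constructor
    · rintro ⟨(⟨f, hf, rfl⟩ | ⟨f, hf, rfl⟩) | ⟨c, hc, rfl⟩, ha⟩
      · exact Or.inl ⟨f, ⟨hf, anti_mem_map_inl.1 ha⟩, rfl⟩
      · exact Or.inr ⟨f, ⟨hf, anti_mem_map_inr.1 ha⟩, rfl⟩
      · simp [bridge] at ha
    · rintro (⟨f, ⟨hf, ha⟩, rfl⟩ | ⟨f, ⟨hf, ha⟩, rfl⟩)
      · exact ⟨Or.inl (Or.inl ⟨f, hf, rfl⟩), anti_mem_map_inl.2 ha⟩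
      · exact ⟨Or.inl (Or.inr ⟨f, hf, rfl⟩), anti_mem_map_inr.2 ha⟩
  have ei : Sym2.map (Vertex.inl χ₂) '' {e ∈ A₁ | .anti ∈ e} ∩
        Sym2.map (Vertex.inr χ₁ χ₂) '' {e ∈ A₂ | .anti ∈ e} =
      {Sym2.map (Vertex.inl χ₂) s(.anti, .pt (hullPred χ₁))} := by
    ext e
    constructor
    · rintro ⟨⟨f, ⟨hf, ha⟩, rfl⟩, ⟨g, -, hg⟩⟩
      rw [(eq_of_map_inl_eq_map_inr (hA₁.not_isDiag f hf) (hA₁.root_notMem f hf) hg.symm).1]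
      rfl
    · rintro rfl
      exact ⟨⟨_, ⟨hA₁.anti_hullPred_mem h₁, by simp⟩, rfl⟩,
        ⟨_, ⟨hA₂.anti_hullSucc_mem h₂, by simp⟩, map_inl_anti_hullPred.symm⟩⟩
  have := Set.ncard_union_add_ncard_inter (Sym2.map (Vertex.inl χ₂) '' {e ∈ A₁ | .anti ∈ e})
    (Sym2.map (Vertex.inr χ₁ χ₂) '' {e ∈ A₂ | .anti ∈ e})
  rw [ei, Set.ncard_singleton, ← e,
    Set.ncard_image_of_injective _ (Sym2.map.injective Vertex.inl_injective),
    Set.ncard_image_of_injective _ (Sym2.map.injective Vertex.inr_injective)] at this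
  exact this

/- Both sides are ordered outwards from `x₀`, which is the last element of `X₁` and the first one
of `X₂` around the root; hence the reversal in `o₁`. -/
variable [LinearOrder X₁] [LinearOrder X₂]
  (o₁ : ∀ x x' : X₁, x ≤ x' ↔ x = x' ∨ χ₁ none (some x') (some x) = 1)
  (o₂ : ∀ y y' : X₂, y ≤ y' ↔ y = y' ∨ χ₂ none (some y) (some y') = 1)

include o₁ o₂ in
theorem crossing_bridge_bridge_iff (h₁ : IsRootOrdered χ₁) (h₂ : IsRootOrdered χ₂) {c d : X₁ × X₂}
    (hc₁ : c.1 ≠ hullPred χ₁) (hd₁ : d.1 ≠ hullPred χ₁) (hc₂ : c.2 ≠ hullSucc χ₂)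
    (hd₂ : d.2 ≠ hullSucc χ₂) :
    Crossing (join χ₁ χ₂) (bridge χ₁ χ₂ c.1 c.2) (bridge χ₁ χ₂ d.1 d.2) ↔
      ¬ (c ≤ d ∨ d ≤ c) := by
  obtain ⟨x, y⟩ := c
  obtain ⟨x', y'⟩ := d
  simp only at hc₁ hc₂ hd₁ hd₂
  rw [crossing_bridge_bridge h₁ h₂ hc₁ hd₁ hc₂ hd₂, Prod.mk_le_mk, Prod.mk_le_mk, o₁, o₁, o₂, o₂]
  by_cases hx : x = x'
  · subst hx
    simp only [true_or, true_and, ne_eq, not_true_eq_false, false_and, false_iff, not_not]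
    rw [← o₂, ← o₂]
    exact le_total y y'
  by_cases hy : y = y'
  · subst hy
    simp only [true_or, and_true, ne_eq, not_true_eq_false, false_and, and_false, false_iff,
      not_not]
    rw [← o₁, ← o₁]
    exact le_total x x'
  rw [h₁.sign.none_swap (Ne.symm hx), h₂.sign.none_swap (Ne.symm hy)]
  rcases Int.units_eq_one_or (χ₁ none (some x) (some x')) with e | e <;>
    rcases Int.units_eq_one_or (χ₂ none (some y) (some y')) with e' | e' <;>
    simp [e, e', hx, hy, Ne.symm hx, Ne.symm hy, Units.ext_iff]

include o₁ in
theorem crossing_root_inl_bridge_iff (h₁ : IsRootOrdered χ₁) (h₂ : IsRootOrdered χ₂) {x z : X₁}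
    {y : X₂} (hx : x ≠ hullPred χ₁) (hy : y ≠ hullSucc χ₂) :
    Crossing (join χ₁ χ₂) s(.root, .pt (Sum.inl z)) (bridge χ₁ χ₂ x y) ↔ ¬ x ≤ z := by
  rw [crossing_root_inl_bridge h₁ h₂ hx hy, o₁, not_or]
  refine and_congr_right fun hxz => ?_
  rw [h₁.sign.none_swap hxz]
  rcases Int.units_eq_one_or (χ₁ none (some z) (some x)) with e | e <;> simp [e]

include o₂ in
theorem crossing_root_joinInr_bridge_iff (h₁ : IsRootOrdered χ₁) (h₂ : IsRootOrdered χ₂) {x : X₁}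
    {y z : X₂} (hx : x ≠ hullPred χ₁) :
    Crossing (join χ₁ χ₂) s(.root, .pt (joinInr χ₁ χ₂ z)) (bridge χ₁ χ₂ x y) ↔ ¬ y ≤ z := by
  rw [crossing_root_joinInr_bridge h₁ h₂ hx, o₂, not_or, ne_comm]
  refine and_congr_right fun hyz => ?_
  rw [h₂.sign.none_swap (Ne.symm hyz)]
  rcases Int.units_eq_one_or (χ₂ none (some y) (some z)) with e | e <;> simp [e]

include o₁ in
/-- An element of the left side keeps its root segment unless it lies strictly below a bridge. -/
theorem inl_mem_rootVisible_glue (h₁ : IsRootOrdered χ₁) (h₂ : IsRootOrdered χ₂)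
    {A₁ : Set (Sym2 (Vertex X₁))} {A₂ : Set (Sym2 (Vertex X₂))} {B : Finset (X₁ × X₂)}
    (hB₁ : ∀ c ∈ B, c.1 ≠ hullPred χ₁) (hB₂ : ∀ c ∈ B, c.2 ≠ hullSucc χ₂) {z : X₁} :
    Sum.inl z ∈ rootVisible (join χ₁ χ₂) (glue χ₁ χ₂ A₁ A₂ B) ↔
      z ∈ rootVisible χ₁ A₁ ∧ ∀ b ∈ B, b.1 ≤ z := by
  have hz : (s(.root, .pt (Sum.inl z)) : Sym2 (Vertex (JoinSet X₁ χ₂))) =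
    (s(.root, .pt z) : Sym2 (Vertex X₁)).map (Vertex.inl χ₂) := rfl
  constructor
  · refine fun h => ⟨fun f hf hc => ?_, fun b hb => ?_⟩
    · exact h _ (Or.inl (Or.inl ⟨f, hf, rfl⟩)) (hz ▸ (crossing_inl h₁.sign h₂.sign).2 hc)
    · have := h _ (Or.inr ⟨b, hb, rfl⟩)
      rwa [crossing_root_inl_bridge_iff o₁ h₁ h₂ (hB₁ b hb) (hB₂ b hb), not_not] at this
  · rintro ⟨h, h'⟩ _ ((⟨f, hf, rfl⟩ | ⟨f, hf, rfl⟩) | ⟨c, hc, rfl⟩)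
    · rw [hz, crossing_inl h₁.sign h₂.sign]
      exact h f hf
    · rw [hz]
      exact not_crossing_inl_inr h₁ h₂ _ _
    · rw [crossing_root_inl_bridge_iff o₁ h₁ h₂ (hB₁ c hc) (hB₂ c hc), not_not]
      exact h' c hc

include o₂ in
theorem joinInr_mem_rootVisible_glue (h₁ : IsRootOrdered χ₁) (h₂ : IsRootOrdered χ₂)
    {A₁ : Set (Sym2 (Vertex X₁))} {A₂ : Set (Sym2 (Vertex X₂))} {B : Finset (X₁ × X₂)}
    (hB₁ : ∀ c ∈ B, c.1 ≠ hullPred χ₁) {z : X₂} :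
    joinInr χ₁ χ₂ z ∈ rootVisible (join χ₁ χ₂) (glue χ₁ χ₂ A₁ A₂ B) ↔
      z ∈ rootVisible χ₂ A₂ ∧ ∀ b ∈ B, b.2 ≤ z := by
  have hz : (s(.root, .pt (joinInr χ₁ χ₂ z)) : Sym2 (Vertex (JoinSet X₁ χ₂))) =
    (s(.root, .pt z) : Sym2 (Vertex X₂)).map (Vertex.inr χ₁ χ₂) := rfl
  constructor
  · refine fun h => ⟨fun f hf hc => ?_, fun b hb => ?_⟩
    · exact h _ (Or.inl (Or.inr ⟨f, hf, rfl⟩)) (hz ▸ (crossing_inr h₁ h₂).2 hc)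
    · have := h _ (Or.inr ⟨b, hb, rfl⟩)
      rwa [crossing_root_joinInr_bridge_iff o₂ h₁ h₂ (hB₁ b hb), not_not] at this
  · rintro ⟨h, h'⟩ _ ((⟨f, hf, rfl⟩ | ⟨f, hf, rfl⟩) | ⟨c, hc, rfl⟩)
    · rw [hz, crossing_comm]
      exact not_crossing_inl_inr h₁ h₂ _ _
    · rw [hz, crossing_inr h₁ h₂]
      exact h f hf
    · rw [crossing_root_joinInr_bridge_iff o₂ h₁ h₂ (hB₁ c hc), not_not]
      exact h' c hc

theorem IsCore.leftPart (h₁ : IsRootOrdered χ₁) (h₂ : IsRootOrdered χ₂)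
    {A : Set (Sym2 (Vertex (JoinSet X₁ χ₂)))} (hA : IsCore (join χ₁ χ₂) A) :
    IsCore χ₁ (leftPart A) := by
  refine ⟨fun e he => ?_, fun e he => ?_, fun e he f hf => ?_, fun e hd hr hc hv => ?_⟩
  · exact mt (Sym2.isDiag_map Vertex.inl_injective).2 (hA.not_isDiag _ he)
  · exact mt root_mem_map_inl.2 (hA.root_notMem _ he)
  · exact mt (crossing_inl h₁.sign h₂.sign).2 (hA.not_crossing _ he _ hf)
  · refine hA.mem _ (mt (Sym2.isDiag_map Vertex.inl_injective).1 hd) (mt root_mem_map_inl.1 hr)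
      (fun f hf => ?_) (fun x hx => ?_)
    · rcases segment_cases (χ₁ := χ₁) (hA.not_isDiag f hf) (hA.root_notMem f hf) with
        ⟨f, -, -, rfl⟩ | ⟨f, -, -, rfl⟩ | ⟨x, y, hx, hy, rfl⟩
      · rw [crossing_inl h₁.sign h₂.sign]
        exact hc f hf
      · exact not_crossing_inl_inr h₁ h₂ _ _
      · rw [crossing_comm, crossing_bridge_inl h₁ h₂ hx hy hr]
        refine hv x fun g hg hcg => hA.not_crossing _ hf _ hg ?_
        exact (crossing_bridge_inl h₁ h₂ hx hy (mt root_mem_map_inl.2 (hA.root_notMem _ hg))).2 hcg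
    · rcases x with x | y
      · change ¬ Crossing _ ((s(.root, .pt x) : Sym2 (Vertex X₁)).map (Vertex.inl χ₂)) _
        rw [crossing_inl h₁.sign h₂.sign]
        exact hv x fun g hg hcg => hx _ hg ((crossing_inl h₁.sign h₂.sign).2 hcg)
      · rw [← joinInr_of_ne (χ₁ := χ₁) y.2, crossing_comm]
        exact not_crossing_inl_inr h₁ h₂ e s(.root, .pt y.1)

theorem IsCore.rightPart (h₁ : IsRootOrdered χ₁) (h₂ : IsRootOrdered χ₂)
    {A : Set (Sym2 (Vertex (JoinSet X₁ χ₂)))} (hA : IsCore (join χ₁ χ₂) A) :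
    IsCore χ₂ (rightPart χ₁ A) := by
  refine ⟨fun e he => ?_, fun e he => ?_, fun e he f hf => ?_, fun e hd hr hc hv => ?_⟩
  · exact mt (Sym2.isDiag_map Vertex.inr_injective).2 (hA.not_isDiag _ he)
  · exact mt root_mem_map_inr.2 (hA.root_notMem _ he)
  · exact mt (crossing_inr h₁ h₂).2 (hA.not_crossing _ he _ hf)
  · refine hA.mem _ (mt (Sym2.isDiag_map Vertex.inr_injective).1 hd) (mt root_mem_map_inr.1 hr)
      (fun f hf => ?_) (fun x hx => ?_)
    · rcases segment_cases (χ₁ := χ₁) (hA.not_isDiag f hf) (hA.root_notMem f hf) with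
        ⟨f, -, -, rfl⟩ | ⟨f, -, -, rfl⟩ | ⟨x, y, hx, hy, rfl⟩
      · rw [crossing_comm]
        exact not_crossing_inl_inr h₁ h₂ _ _
      · rw [crossing_inr h₁ h₂]
        exact hc f hf
      · rw [crossing_comm, crossing_bridge_inr h₁ h₂ hx hr]
        refine hv y fun g hg hcg => hA.not_crossing _ hf _ hg ?_
        exact (crossing_bridge_inr h₁ h₂ hx (mt root_mem_map_inr.2 (hA.root_notMem _ hg))).2 hcg
    · have hright : ∀ y, joinInr χ₁ χ₂ y ∈ rootVisible (join χ₁ χ₂) A → ¬ Crossing (join χ₁ χ₂)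
          s(.root, .pt (joinInr χ₁ χ₂ y)) (e.map (Vertex.inr χ₁ χ₂)) := by
        intro y hy
        change ¬ Crossing _ ((s(.root, .pt y) : Sym2 (Vertex X₂)).map (Vertex.inr χ₁ χ₂)) _
        rw [crossing_inr h₁ h₂]
        exact hv y fun g hg hcg => hy _ hg ((crossing_inr h₁ h₂).2 hcg)
      rcases x with x | y
      · exact not_crossing_inl_inr h₁ h₂ s(.root, .pt x) e
      · rw [← joinInr_of_ne (χ₁ := χ₁) y.2] at hx ⊢
        exact hright _ hx

include o₁ o₂ in
theorem IsCore.isBridging (h₁ : IsRootOrdered χ₁) (h₂ : IsRootOrdered χ₂)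
    {A : Set (Sym2 (Vertex (JoinSet X₁ χ₂)))} (hA : IsCore (join χ₁ χ₂) A) :
    IsBridging (bridgeEnds χ₁ (hullPred χ₁) (_root_.leftPart A))
      (bridgeEnds χ₂ (hullSucc χ₂) (_root_.rightPart χ₁ A)) (bridgePart χ₁ A) := by
  refine ⟨fun c hc => ?_, fun b hb c hc => ?_, fun c hc hne hcomp hl hr => ?_⟩
  · obtain ⟨hx, hy, h⟩ := mem_bridgePart.1 hc
    rw [Finset.mem_product, mem_bridgeEnds, mem_bridgeEnds]
    refine ⟨⟨fun g hg hcg => hA.not_crossing _ h _ hg ?_, hx⟩,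
      ⟨fun g hg hcg => hA.not_crossing _ h _ hg ?_, hy⟩⟩
    · exact (crossing_bridge_inl h₁ h₂ hx hy (mt root_mem_map_inl.2 (hA.root_notMem _ hg))).2 hcg
    · exact (crossing_bridge_inr h₁ h₂ hx (mt root_mem_map_inr.2 (hA.root_notMem _ hg))).2 hcg
  · rw [mem_bridgePart] at hb hc
    have := hA.not_crossing _ hb.2.2 _ hc.2.2
    rwa [crossing_bridge_bridge_iff o₁ o₂ h₁ h₂ hb.1 hc.1 hb.2.1 hc.2.1, not_not] at this
  · simp only [Finset.mem_product, mem_bridgeEnds] at hc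
    obtain ⟨⟨hv₁, hx⟩, hv₂, hy⟩ := hc
    have hB₁ : ∀ c ∈ bridgePart χ₁ A, c.1 ≠ hullPred χ₁ := fun c hc => (mem_bridgePart.1 hc).1
    have hB₂ : ∀ c ∈ bridgePart χ₁ A, c.2 ≠ hullSucc χ₂ := fun c hc => (mem_bridgePart.1 hc).2.1
    have hg := glue_parts (χ₁ := χ₁) hA.not_isDiag hA.root_notMem
    refine mem_bridgePart.2 ⟨hx, hy, hA.mem _ (by simp [bridge, inl_eq_joinInr, hx])
      (by simp [bridge]) (fun f hf => ?_) (fun z hz => ?_)⟩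
    · rcases segment_cases (χ₁ := χ₁) (hA.not_isDiag f hf) (hA.root_notMem f hf) with
        ⟨f, -, hrf, rfl⟩ | ⟨f, -, hrf, rfl⟩ | ⟨x, y, hx', hy', rfl⟩
      · rw [crossing_bridge_inl h₁ h₂ hx hy hrf]
        exact hv₁ f hf
      · rw [crossing_bridge_inr h₁ h₂ hx hrf]
        exact hv₂ f hf
      · rw [crossing_bridge_bridge_iff (d := (x, y)) o₁ o₂ h₁ h₂ hx hx' hy hy', not_not]
        exact (hcomp _ (mem_bridgePart.2 ⟨hx', hy', hf⟩)).symm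
    · rcases z with z | z
      · rw [crossing_root_inl_bridge_iff o₁ h₁ h₂ hx hy, not_not]
        rw [← hg, inl_mem_rootVisible_glue o₁ h₁ h₂ hB₁ hB₂] at hz
        refine hl z (mem_bridgeEnds.2 ⟨hz.1, ?_⟩) hz.2
        rintro rfl
        -- no bridge ends at `x₀` or on its inner side
        obtain ⟨b, hb⟩ := hne
        rcases (o₁ _ _).1 (hz.2 b hb) with h | h
        · exact hB₁ b hb h
        · rw [h₁.sign.none_swap (hB₁ b hb).symm, h₁.none_hullPred (hB₁ b hb)] at h
          exact int_units_neg_ne 1 h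
      · rw [← joinInr_of_ne (χ₁ := χ₁) z.2] at hz ⊢
        rw [crossing_root_joinInr_bridge_iff o₂ h₁ h₂ hx, not_not]
        rw [← hg, joinInr_mem_rootVisible_glue o₂ h₁ h₂ hB₁] at hz
        exact hr z.1 (mem_bridgeEnds.2 ⟨hz.1, z.2⟩) hz.2

include o₁ o₂ in
/-- Gluing cores along a maximal family of bridges gives a maximal set. -/
theorem isCore_glue (h₁ : IsRootOrdered χ₁) (h₂ : IsRootOrdered χ₂)
    {A₁ : Set (Sym2 (Vertex X₁))} {A₂ : Set (Sym2 (Vertex X₂))} {B : Finset (X₁ × X₂)}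
    (hA₁ : IsCore χ₁ A₁) (hA₂ : IsCore χ₂ A₂)
    (hB : IsBridging (bridgeEnds χ₁ (hullPred χ₁) A₁) (bridgeEnds χ₂ (hullSucc χ₂) A₂) B) :
    IsCore (join χ₁ χ₂) (glue χ₁ χ₂ A₁ A₂ B) := by
  have hBe : ∀ c ∈ B, (c.1 ∈ rootVisible χ₁ A₁ ∧ c.1 ≠ hullPred χ₁) ∧
      c.2 ∈ rootVisible χ₂ A₂ ∧ c.2 ≠ hullSucc χ₂ := fun c hc => by
    simpa only [Finset.mem_product, mem_bridgeEnds] using hB.subset hc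
  have hB₁ : ∀ c ∈ B, c.1 ≠ hullPred χ₁ := fun c hc => (hBe c hc).1.2
  have hB₂ : ∀ c ∈ B, c.2 ≠ hullSucc χ₂ := fun c hc => (hBe c hc).2.2
  have hbl : ∀ c ∈ B, ∀ f ∈ A₁, ¬ Crossing (join χ₁ χ₂) (bridge χ₁ χ₂ c.1 c.2)
      (f.map (Vertex.inl χ₂)) := fun c hc f hf => by
    rw [crossing_bridge_inl h₁ h₂ (hB₁ c hc) (hB₂ c hc) (hA₁.root_notMem f hf)]
    exact (hBe c hc).1.1 f hf
  have hbr : ∀ c ∈ B, ∀ f ∈ A₂, ¬ Crossing (join χ₁ χ₂) (bridge χ₁ χ₂ c.1 c.2)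
      (f.map (Vertex.inr χ₁ χ₂)) := fun c hc f hf => by
    rw [crossing_bridge_inr h₁ h₂ (hB₁ c hc) (hA₂.root_notMem f hf)]
    exact (hBe c hc).2.1 f hf
  refine ⟨?_, ?_, ?_, fun e hd hr hc hv => ?_⟩
  · rintro _ ((⟨f, hf, rfl⟩ | ⟨f, hf, rfl⟩) | ⟨c, hc, rfl⟩)
    · exact mt (Sym2.isDiag_map Vertex.inl_injective).1 (hA₁.not_isDiag _ hf)
    · exact mt (Sym2.isDiag_map Vertex.inr_injective).1 (hA₂.not_isDiag _ hf)
    · simp [bridge, inl_eq_joinInr, hB₁ c hc]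
  · rintro _ ((⟨f, hf, rfl⟩ | ⟨f, hf, rfl⟩) | ⟨c, hc, rfl⟩)
    · exact mt root_mem_map_inl.1 (hA₁.root_notMem _ hf)
    · exact mt root_mem_map_inr.1 (hA₂.root_notMem _ hf)
    · simp [bridge]
  · rintro _ ((⟨f, hf, rfl⟩ | ⟨f, hf, rfl⟩) | ⟨c, hc, rfl⟩) _
      ((⟨g, hg, rfl⟩ | ⟨g, hg, rfl⟩) | ⟨d, hd, rfl⟩)
    · rw [crossing_inl h₁.sign h₂.sign]
      exact hA₁.not_crossing f hf g hg
    · exact not_crossing_inl_inr h₁ h₂ _ _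
    · rw [crossing_comm]
      exact hbl d hd f hf
    · rw [crossing_comm]
      exact not_crossing_inl_inr h₁ h₂ _ _
    · rw [crossing_inr h₁ h₂]
      exact hA₂.not_crossing f hf g hg
    · rw [crossing_comm]
      exact hbr d hd f hf
    · exact hbl c hc g hg
    · exact hbr c hc g hg
    · rw [crossing_bridge_bridge_iff o₁ o₂ h₁ h₂ (hB₁ c hc) (hB₁ d hd) (hB₂ c hc) (hB₂ d hd),
        not_not]
      exact hB.chain c hc d hd
  · have hvl : ∀ z, z ∈ rootVisible χ₁ A₁ → (∀ b ∈ B, b.1 ≤ z) →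
        ¬ Crossing (join χ₁ χ₂) s(.root, .pt (Sum.inl z)) e := fun z h h' =>
      hv _ ((inl_mem_rootVisible_glue o₁ h₁ h₂ hB₁ hB₂).2 ⟨h, h'⟩)
    have hvr : ∀ z, z ∈ rootVisible χ₂ A₂ → (∀ b ∈ B, b.2 ≤ z) →
        ¬ Crossing (join χ₁ χ₂) s(.root, .pt (joinInr χ₁ χ₂ z)) e := fun z h h' =>
      hv _ ((joinInr_mem_rootVisible_glue o₂ h₁ h₂ hB₁).2 ⟨h, h'⟩)
    rcases segment_cases (χ₁ := χ₁) hd hr with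
      ⟨e, hde, hre, rfl⟩ | ⟨e, hde, hre, rfl⟩ | ⟨x, y, hx, hy, rfl⟩
    · refine Or.inl (Or.inl ⟨e, hA₁.mem e hde hre (fun f hf hcr => ?_) fun z hz hcr => ?_, rfl⟩)
      · exact hc _ (Or.inl (Or.inl ⟨f, hf, rfl⟩)) ((crossing_inl h₁.sign h₂.sign).2 hcr)
      · by_cases hz₀ : z = hullPred χ₁
        · rw [hz₀] at hcr
          exact (not_crossing_hullPred h₁ _).1 hcr
        by_cases hb : ∀ b ∈ B, b.1 ≤ z
        · exact hvl z hz hb ((crossing_inl (e := s(.root, .pt z)) h₁.sign h₂.sign).2 hcr)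
        · -- the root segment of `z` is replaced by a bridge
          push Not at hb
          obtain ⟨c, hcB, rfl⟩ := hB.exists_fst_eq (mem_bridgeEnds.2 ⟨hz, hz₀⟩) hb
          exact hc _ (Or.inr ⟨c, hcB, rfl⟩)
            ((crossing_bridge_inl h₁ h₂ (hB₁ c hcB) (hB₂ c hcB) hre).2 hcr).symm
    · refine Or.inl (Or.inr ⟨e, hA₂.mem e hde hre (fun f hf hcr => ?_) fun z hz hcr => ?_, rfl⟩)
      · exact hc _ (Or.inl (Or.inr ⟨f, hf, rfl⟩)) ((crossing_inr h₁ h₂).2 hcr)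
      · by_cases hz₀ : z = hullSucc χ₂
        · rw [hz₀] at hcr
          exact (not_crossing_hullSucc h₂ _).1 hcr
        by_cases hb : ∀ b ∈ B, b.2 ≤ z
        · exact hvr z hz hb ((crossing_inr (e := s(.root, .pt z)) h₁ h₂).2 hcr)
        · push Not at hb
          obtain ⟨c, hcB, rfl⟩ := hB.exists_snd_eq (mem_bridgeEnds.2 ⟨hz, hz₀⟩) hb
          exact hc _ (Or.inr ⟨c, hcB, rfl⟩)
            ((crossing_bridge_inr h₁ h₂ (hB₁ c hcB) hre).2 hcr).symm
    · refine Or.inr ⟨(x, y), hB.mem (x, y) ?_ ?_ (fun b hb => ?_) (fun z hz h => ?_)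
        (fun z hz h => ?_), rfl⟩
      · rw [Finset.mem_product, mem_bridgeEnds, mem_bridgeEnds]
        refine ⟨⟨fun f hf hcr => ?_, hx⟩, ⟨fun f hf hcr => ?_, hy⟩⟩
        · exact hc _ (Or.inl (Or.inl ⟨f, hf, rfl⟩))
            ((crossing_bridge_inl h₁ h₂ hx hy (hA₁.root_notMem f hf)).2 hcr)
        · exact hc _ (Or.inl (Or.inr ⟨f, hf, rfl⟩))
            ((crossing_bridge_inr h₁ h₂ hx (hA₂.root_notMem f hf)).2 hcr)
      · -- without bridges, the root segment of `x₀` would be present and cross the bridge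
        by_contra hne
        rw [Finset.not_nonempty_iff_eq_empty] at hne
        subst hne
        have := hvl _ (hullPred_mem_rootVisible h₁ A₁) (by simp)
        rw [crossing_root_inl_bridge h₁ h₂ hx hy] at this
        exact this ⟨hx, h₁.none_hullPred hx⟩
      · have := hc _ (Or.inr ⟨b, hb, rfl⟩)
        rw [crossing_bridge_bridge_iff (c := (x, y)) o₁ o₂ h₁ h₂ hx (hB₁ b hb) hy (hB₂ b hb),
          not_not] at this
        exact this.symm
      · have := hvl z (mem_bridgeEnds.1 hz).1 h
        rwa [crossing_root_inl_bridge_iff o₁ h₁ h₂ hx hy, not_not] at this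
      · have := hvr z (mem_bridgeEnds.1 hz).1 h
        rwa [crossing_root_joinInr_bridge_iff o₂ h₁ h₂ hx, not_not] at this

include o₁ o₂ in
theorem ncard_rootVisible_glue (h₁ : IsRootOrdered χ₁) (h₂ : IsRootOrdered χ₂)
    {A₁ : Set (Sym2 (Vertex X₁))} {A₂ : Set (Sym2 (Vertex X₂))} {B : Finset (X₁ × X₂)}
    (hB₁ : ∀ c ∈ B, c.1 ≠ hullPred χ₁) (hB₂ : ∀ c ∈ B, c.2 ≠ hullSucc χ₂) :
    (rootVisible (join χ₁ χ₂) (glue χ₁ χ₂ A₁ A₂ B)).ncard =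
      bridgingDegree (bridgeEnds χ₁ (hullPred χ₁) A₁) (bridgeEnds χ₂ (hullSucc χ₂) A₂) B := by
  classical
  have hx₀ : (∀ b ∈ B, b.1 ≤ hullPred χ₁) ↔ B = ∅ := by
    constructor
    · intro h
      by_contra hne
      obtain ⟨b, hb⟩ := Finset.nonempty_iff_ne_empty.2 hne
      rcases (o₁ _ _).1 (h b hb) with h | h
      · exact hB₁ b hb h
      · rw [h₁.sign.none_swap (hB₁ b hb).symm, h₁.none_hullPred (hB₁ b hb)] at h
        exact int_units_neg_ne 1 h
    · rintro rfl
      simp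
  set S := bridgeEnds χ₁ (hullPred χ₁) A₁ with hS
  set T := bridgeEnds χ₂ (hullSucc χ₂) A₂ with hT
  have e : rootVisible (join χ₁ χ₂) (glue χ₁ χ₂ A₁ A₂ B) =
      ↑(Finset.image (Sum.inl : X₁ → JoinSet X₁ χ₂) {z ∈ S | ∀ b ∈ B, b.1 ≤ z} ∪
        Finset.image (joinInr χ₁ χ₂) {z ∈ T | ∀ b ∈ B, b.2 ≤ z} ∪
        if B = ∅ then {Sum.inl (hullPred χ₁)} else ∅) := by
    ext z
    rcases z with z | z
    · have n : ∀ y ∈ T, joinInr χ₁ χ₂ y ≠ Sum.inl z := fun y hy h =>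
        (mem_bridgeEnds.1 hy).2 (inl_eq_joinInr.1 h.symm).2
      rw [inl_mem_rootVisible_glue o₁ h₁ h₂ hB₁ hB₂]
      by_cases hz : z = hullPred χ₁
      · subst hz
        have n' : hullPred χ₁ ∉ S := fun h => (mem_bridgeEnds.1 h).2 rfl
        rw [hx₀]
        by_cases hBe : B = ∅ <;> simp [hBe, hullPred_mem_rootVisible h₁, n']
        intro y hy _
        exact n y hy
      · have hm : z ∈ S ↔ z ∈ rootVisible χ₁ A₁ := by simp [hS, mem_bridgeEnds, hz]
        have hi : (Sum.inl z : JoinSet X₁ χ₂) ∉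
            (if B = ∅ then {Sum.inl (hullPred χ₁)} else ∅ : Finset (JoinSet X₁ χ₂)) := by
          split_ifs <;> simp [hz]
        have hi' : (Sum.inl z : JoinSet X₁ χ₂) ∉
            Finset.image (joinInr χ₁ χ₂) {z ∈ T | ∀ b ∈ B, b.2 ≤ z} := fun h => by
          obtain ⟨y, hy, h⟩ := Finset.mem_image.1 h
          exact n y (Finset.mem_filter.1 hy).1 h
        simp only [Finset.mem_coe, Finset.mem_union, hi, hi', or_false]
        simp [hm]
    · rw [← joinInr_of_ne (χ₁ := χ₁) z.2, joinInr_mem_rootVisible_glue o₂ h₁ h₂ hB₁]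
      have n : ∀ x, (Sum.inl x : JoinSet X₁ χ₂) ≠ joinInr χ₁ χ₂ z.1 := fun x h =>
        z.2 (inl_eq_joinInr.1 h).2
      have hm : z.1 ∈ T ↔ z.1 ∈ rootVisible χ₂ A₂ := by simp [hT, mem_bridgeEnds, z.2]
      have hi : joinInr χ₁ χ₂ z.1 ∉
          (if B = ∅ then {Sum.inl (hullPred χ₁)} else ∅ : Finset (JoinSet X₁ χ₂)) := by
        split_ifs <;> simp [Ne.symm (n _)]
      have hi' : joinInr χ₁ χ₂ z.1 ∉
          Finset.image (Sum.inl : X₁ → JoinSet X₁ χ₂) {z ∈ S | ∀ b ∈ B, b.1 ≤ z} := fun h => by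
        obtain ⟨x, hx, h⟩ := Finset.mem_image.1 h
        exact n x h
      simp only [Finset.mem_coe, Finset.mem_union, hi, hi', or_false, false_or]
      simp [hm, joinInr_injective.eq_iff]
  rw [e, Set.ncard_coe_finset, Finset.card_union_of_disjoint, Finset.card_union_of_disjoint,
    Finset.card_image_of_injective _ Sum.inl_injective,
    Finset.card_image_of_injective _ joinInr_injective, bridgingDegree]
  · congr 1
    split_ifs <;> simp
  · rw [Finset.disjoint_left]
    intro a ha hb
    obtain ⟨x, hx, rfl⟩ := Finset.mem_image.1 ha
    obtain ⟨y, hy, h⟩ := Finset.mem_image.1 hb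
    exact (mem_bridgeEnds.1 (Finset.mem_filter.1 hy).1).2 (inl_eq_joinInr.1 h.symm).2
  · rw [Finset.disjoint_left]
    intro a ha hb
    split_ifs at hb
    · rw [Finset.mem_singleton] at hb
      subst hb
      rcases Finset.mem_union.1 ha with h | h
      · obtain ⟨x, hx, h⟩ := Finset.mem_image.1 h
        exact (mem_bridgeEnds.1 (Finset.mem_filter.1 hx).1).2 (Sum.inl_injective h)
      · obtain ⟨y, hy, h⟩ := Finset.mem_image.1 h
        exact (mem_bridgeEnds.1 (Finset.mem_filter.1 hy).1).2 (inl_eq_joinInr.1 h.symm).2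
    · simp at hb

end correspondence

/-! ### The generating polynomials -/

section formula

variable {X₁ : Type u} {X₂ : Type v} [Finite X₁] [Finite X₂]
  {χ₁ : RootedSignMap X₁} {χ₂ : RootedSignMap X₂}

/-- The part of `joinFormula` that depends on one factor. -/
theorem sum_coeff_mul {ι : Type*} (s : Finset ι) (d w : ι → ℕ) (hd : ∀ i ∈ s, 2 ≤ d i)
    {P : ℤ[X][X]} (hP : P = ∑ i ∈ s, (Polynomial.X : ℤ[X][X]) ^ d i * C (Polynomial.X ^ w i))
    (F : ℕ → (LaurentPolynomial ℤ)[X]) :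
    ∑ k ∈ Finset.Icc 2 P.natDegree, C (toLaurent (P.coeff k)) * F k =
      ∑ i ∈ s, C (LaurentPolynomial.T (w i : ℤ)) * F (d i) := by
  have hsub : Finset.Icc 2 P.natDegree ⊆ Finset.Icc 2 (P.natDegree + ∑ i ∈ s, d i) :=
    Finset.Icc_subset_Icc_right (Nat.le_add_right _ _)
  rw [Finset.sum_subset hsub]
  swap
  · intro k hk hk'
    rw [Finset.mem_Icc] at hk hk'
    rw [coeff_eq_zero_of_natDegree_lt (by omega)]
    simp
  have hcoeff : ∀ k, C (toLaurent (P.coeff k)) * F k =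
      ∑ i ∈ s, if d i = k then C (LaurentPolynomial.T (w i : ℤ)) * F (d i) else 0 := by
    intro k
    rw [hP, finsetSum_coeff, map_sum, map_sum, Finset.sum_mul]
    refine Finset.sum_congr rfl fun i _ => ?_
    rw [coeff_mul_C, coeff_X_pow]
    by_cases h : d i = k
    · rw [if_pos h, if_pos h.symm, one_mul, toLaurent_X_pow, h]
    · rw [if_neg h, if_neg (Ne.symm h)]
      simp
  simp_rw [hcoeff]
  rw [Finset.sum_comm]
  refine Finset.sum_congr rfl fun i hi => ?_
  rw [Finset.sum_ite_eq, if_pos]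
  rw [Finset.mem_Icc]
  exact ⟨hd i hi, (Finset.single_le_sum (fun _ _ => Nat.zero_le _) hi).trans (Nat.le_add_left _ _)⟩

theorem joinFormula_eq_sum {ι κ : Type*} (s : Finset ι) (t : Finset κ) (d w : ι → ℕ)
    (d' w' : κ → ℕ) (hd : ∀ i ∈ s, 2 ≤ d i) (hd' : ∀ j ∈ t, 2 ≤ d' j) :
    joinFormula (∑ i ∈ s, (Polynomial.X : ℤ[X][X]) ^ d i * C (Polynomial.X ^ w i))
      (∑ j ∈ t, (Polynomial.X : ℤ[X][X]) ^ d' j * C (Polynomial.X ^ w' j)) =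
    ∑ i ∈ s, ∑ j ∈ t, joinKernel (LaurentPolynomial ℤ) (d i) (d' j) *
      C (LaurentPolynomial.T (w i + w' j - 1 : ℤ)) := by
  rw [joinFormula]
  simp_rw [mul_assoc, ← Finset.mul_sum]
  rw [sum_coeff_mul s d w hd rfl]
  refine Finset.sum_congr rfl fun i _ => ?_
  rw [sum_coeff_mul t d' w' hd' rfl, Finset.mul_sum]
  refine Finset.sum_congr rfl fun j _ => ?_
  rw [sub_eq_add_neg, LaurentPolynomial.T_add, LaurentPolynomial.T_add, C_mul, C_mul]
  ring

open Classical in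
/-- The cores of the join are obtained by gluing. -/
theorem sum_cores_join {M : Type*} [AddCommMonoid M] [Nonempty X₁] [Nonempty X₂]
    [LinearOrder X₁] [LinearOrder X₂]
    (o₁ : ∀ x x' : X₁, x ≤ x' ↔ x = x' ∨ χ₁ none (some x') (some x) = 1)
    (o₂ : ∀ y y' : X₂, y ≤ y' ↔ y = y' ∨ χ₂ none (some y) (some y') = 1)
    (h₁ : IsRootOrdered χ₁) (h₂ : IsRootOrdered χ₂)
    (F : Set (Sym2 (Vertex (JoinSet X₁ χ₂))) → M) :
    ∑ A ∈ (Set.toFinite {A | IsCore (join χ₁ χ₂) A}).toFinset, F A =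
      ∑ A₁ ∈ (Set.toFinite {A | IsCore χ₁ A}).toFinset,
        ∑ A₂ ∈ (Set.toFinite {A | IsCore χ₂ A}).toFinset,
          ∑ B ∈ (bridgeEnds χ₁ (hullPred χ₁) A₁ ×ˢ bridgeEnds χ₂ (hullSucc χ₂) A₂).powerset with
            IsBridging (bridgeEnds χ₁ (hullPred χ₁) A₁) (bridgeEnds χ₂ (hullSucc χ₂) A₂) B,
            F (glue χ₁ χ₂ A₁ A₂ B) := by
  rw [← Finset.sum_product', Finset.sum_sigma']
  refine Finset.sum_nbij' (fun A => ⟨(leftPart A, rightPart χ₁ A), bridgePart χ₁ A⟩)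
    (fun p => glue χ₁ χ₂ p.1.1 p.1.2 p.2) ?_ ?_ ?_ ?_ ?_
  · intro A hA
    rw [Set.Finite.mem_toFinset] at hA
    simp only [Finset.mem_sigma, Finset.mem_product, Set.Finite.mem_toFinset, Set.mem_ofPred_eq,
      Finset.mem_filter, Finset.mem_powerset]
    have hB := IsCore.isBridging o₁ o₂ h₁ h₂ hA
    exact ⟨⟨hA.leftPart h₁ h₂, hA.rightPart h₁ h₂⟩, hB.subset, hB⟩
  · rintro ⟨⟨A₁, A₂⟩, B⟩ h
    simp only [Finset.mem_sigma, Finset.mem_product, Set.Finite.mem_toFinset, Set.mem_ofPred_eq,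
      Finset.mem_filter, Finset.mem_powerset] at h ⊢
    exact isCore_glue o₁ o₂ h₁ h₂ h.1.1 h.1.2 h.2.2
  · intro A hA
    rw [Set.Finite.mem_toFinset] at hA
    exact glue_parts hA.not_isDiag hA.root_notMem
  · rintro ⟨⟨A₁, A₂⟩, B⟩ h
    simp only [Finset.mem_sigma, Finset.mem_product, Set.Finite.mem_toFinset, Set.mem_ofPred_eq,
      Finset.mem_filter, Finset.mem_powerset] at h
    obtain ⟨⟨hA₁, hA₂⟩, hB, -⟩ := h
    have hBe : ∀ c ∈ B, c.1 ≠ hullPred χ₁ ∧ c.2 ≠ hullSucc χ₂ := fun c hc => by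
      have := Finset.mem_product.1 (hB hc)
      exact ⟨(mem_bridgeEnds.1 this.1).2, (mem_bridgeEnds.1 this.2).2⟩
    simp only [leftPart_glue h₁ hA₁ hA₂ fun c hc => (hBe c hc).2,
      rightPart_glue h₂ hA₁ hA₂ fun c hc => (hBe c hc).1,
      bridgePart_glue (fun c hc => (hBe c hc).1) fun c hc => (hBe c hc).2]
  · intro A hA
    rw [Set.Finite.mem_toFinset] at hA
    rw [glue_parts hA.not_isDiag hA.root_notMem]

theorem weakPoly_join [Nontrivial X₁] [Nontrivial X₂] (h₁ : IsRootOrdered χ₁)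
    (h₂ : IsRootOrdered χ₂) :
    (weakPoly (join χ₁ χ₂)).map toLaurent = joinFormula (weakPoly χ₁) (weakPoly χ₂) := by
  classical
  -- the order around the root is reversed by the twist, so that `X₁` is ordered outwards from `x₀`
  let _ := h₁.twist.linearOrder
  let _ := h₂.linearOrder
  have o₁ : ∀ x x' : X₁, x ≤ x' ↔ x = x' ∨ χ₁ none (some x') (some x) = 1 := by
    intro x x'
    change (x = x' ∨ twist χ₁ none (some x) (some x') = 1) ↔ _
    by_cases h : x = x'
    · simp [h]
    · rw [twist_none, h₁.sign.none_swap h, neg_neg]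
  have o₂ : ∀ y y' : X₂, y ≤ y' ↔ y = y' ∨ χ₂ none (some y) (some y') = 1 := fun _ _ => Iff.rfl
  rw [weakPoly_eq_sum_cores, weakPoly_eq_sum_cores χ₁, weakPoly_eq_sum_cores χ₂,
    joinFormula_eq_sum _ _ _ _ _ _ (fun A _ => two_le_ncard_rootVisible h₁ A)
      (fun A _ => two_le_ncard_rootVisible h₂ A),
    sum_cores_join o₁ o₂ h₁ h₂, Polynomial.map_sum]
  refine Finset.sum_congr rfl fun A₁ hA₁ => ?_
  rw [Polynomial.map_sum]
  refine Finset.sum_congr rfl fun A₂ hA₂ => ?_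
  rw [Set.Finite.mem_toFinset] at hA₁ hA₂
  rw [Polynomial.map_sum, ← card_bridgeEnds (hullPred_mem_rootVisible h₁ A₁),
    ← card_bridgeEnds (hullSucc_mem_rootVisible h₂ A₂),
    ← sum_bridgings (LaurentPolynomial ℤ), Finset.sum_mul]
  refine Finset.sum_congr rfl fun B hB => ?_
  have hBs := Finset.mem_powerset.1 (Finset.mem_filter.1 hB).1
  rw [Polynomial.map_mul, Polynomial.map_pow, map_X, map_C, toLaurent_X_pow,
    ncard_rootVisible_glue o₁ o₂ h₁ h₂
      (fun c hc => (mem_bridgeEnds.1 (Finset.mem_product.1 (hBs hc)).1).2)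
      (fun c hc => (mem_bridgeEnds.1 (Finset.mem_product.1 (hBs hc)).2).2)]
  have hv : ((edgeDegree (glue χ₁ χ₂ A₁ A₂ B) .anti : ℕ) : ℤ) =
      edgeDegree A₁ .anti + edgeDegree A₂ .anti - 1 := by
    have := edgeDegree_glue_anti (B := B) h₁ h₂ hA₁ hA₂
    omega
  rw [hv]

end formula

theorem proposition3p3 {X₁ : Type u} {X₂ : Type v} [Finite X₁] [Finite X₂]
    [Nontrivial X₁] [Nontrivial X₂]
    (χ₁ : RootedSignMap X₁) (χ₂ : RootedSignMap X₂)
    (h₁ : IsRootedChirotope χ₁) (h₂ : IsRootedChirotope χ₂) :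
    (weakPoly (join χ₁ χ₂)).map toLaurent = joinFormula (weakPoly χ₁) (weakPoly χ₂) ∧
    (Bivariate.swap (weakPoly (meet χ₁ χ₂))).map toLaurent =
      joinFormula (Bivariate.swap (weakPoly χ₁)) (Bivariate.swap (weakPoly χ₂)) := by
  refine ⟨weakPoly_join h₁.isRootOrdered h₂.isRootOrdered, ?_⟩
  rw [meet, ← weakPoly_twist, twist_twist, ← weakPoly_twist, ← weakPoly_twist]
  exact weakPoly_join h₁.isRootOrdered.twist h₂.isRootOrdered.twist
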